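/- **Lemma 5.5 (Difference of convective terms).** Let $d\in\{2,3\}$ and let $\Omega\subset\mathbb R^d$ be a bounded connected open set lying on one side of its boundary, $\operatorname{int}\overline\Omega=\Omega$ (e.g. a bounded Lipschitz domain). Put $\boldsymbol V^{\rm div}=\{\boldsymbol v\in \boldsymbol H^1_0(\Omega):\int_\Omega q\,\nabla\cdot\boldsymbol v=0\ \forall q\in L^2_0(\Omega)\}$. Let $\mathcal T_h$ be a partition of $\Omega$ into finitely many convex polytopes $K$ without hanging nodes, $h_K=\operatorname{diam}K$, $h=\max_K h_K$, with interior facets $\mathcal F_h^i$ and boundary facets $\mathcal F_h^\partial$; $\boldsymbol n_F$ is the unit normal of an interior facet $F$ pointing from $K^+$ to $K^-$ (the outer normal if $F\subset\partial\Omega$), $[\![\phi]\!]=\phi^+-\phi^-$, $\{\!\{\phi\}\!\}=\frac12(\phi^++\phi^-)$ on interior facets and $[\![\phi]\!]=\{\!\{\phi\}\!\}=\phi$ on boundary facets; $\nabla_h$ is the elementwise gradient. Let $\boldsymbol V_h$, $Q_h$ be finite-dimensional, the elements of $\boldsymbol V_h$ being $C^1$ up to the boundary of each $K$, with $\boldsymbol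 V_h\subset \boldsymbol H(\mathrm{div};\Omega)$, $\boldsymbol v_h\cdot\boldsymbol n=0$ on $\partial\Omega$ for $\boldsymbol v_h\in\boldsymbol V_h$, $Q_h\subset L^2_0(\Omega)$ and $\nabla\cdot\boldsymbol V_h\subseteq Q_h$, and let $\boldsymbol V_h^{\rm div}=\{\boldsymbol v_h\in\boldsymbol V_h:\int_\Omega q_h\nabla\cdot\boldsymbol v_h=0\ \forall q_h\in Q_h\}$. Define $$c_h(\boldsymbol\beta;\boldsymbol w,\boldsymbol v)=\int_\Omega(\boldsymbol\beta\cdot\nabla_h)\boldsymbol w\cdot\boldsymbol v+\tfrac12\int_\Omega(\nabla\cdot\boldsymbol\beta)\,\boldsymbol w\cdot\boldsymbol v-\sum_{F\in\mathcal F_h^i}\int_F(\boldsymbol\beta\cdot\boldsymbol n_F)[\![\boldsymbol w]\!]\cdot\{\!\{\boldsymbol v\}\!\}\,ds+\sum_{F\in\mathcal F_h^i}\int_F\tfrac12|\boldsymbol\beta\cdot\boldsymbol n_F|[\![\boldsymbol w]\!]\cdot[\![\boldsymbol v]\!]\,ds,$$ $$|\boldsymbol w|_{\boldsymbol\beta,\rm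 upw}^2=\sum_{F\in\mathcal F_h^i}\int_F\tfrac12|\boldsymbol\beta\cdot\boldsymbol n_F|\,|[\![\boldsymbol w]\!]|^2ds .$$ For $\nu,\sigma>0$, $\delta\ge0$ and $h_F=\operatorname{diam}F$ let $$a_h(\boldsymbol w,\boldsymbol v)=\int_\Omega\nabla_h\boldsymbol w:\nabla_h\boldsymbol v+\tfrac\delta\nu\int_\Omega(\nabla\cdot\boldsymbol w)(\nabla\cdot\boldsymbol v)-\sum_{F\in\mathcal F_h^i\cup\mathcal F_h^\partial}\int_F\Big(\{\!\{\nabla\boldsymbol w\}\!\}\boldsymbol n_F\cdot[\![\boldsymbol v]\!]+[\![\boldsymbol w]\!]\cdot\{\!\{\nabla\boldsymbol v\}\!\}\boldsymbol n_F-\tfrac{\sigma}{h_F}[\![\boldsymbol w]\!]\cdot[\![\boldsymbol v]\!]\Big)ds .$$ For $\boldsymbol w\in\boldsymbol V^{\rm div}$ which is elementwise in $\boldsymbol H^{3/2+\varepsilon}$ for some $\varepsilon>0$ (call such $\boldsymbol w$ admissible), a Stokes projection of $\boldsymbol w$ is a field $\boldsymbol\pi_s\boldsymbol w\in\boldsymbol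 V_h^{\rm div}$ with $a_h(\boldsymbol\pi_s\boldsymbol w,\boldsymbol v_h)=a_h(\boldsymbol w,\boldsymbol v_h)$ for all $\boldsymbol v_h\in\boldsymbol V_h^{\rm div}$. Assume one of the following. 1. *($\boldsymbol H^1$-conforming methods)* $\boldsymbol V_h\subset\boldsymbol H^1_0(\Omega)$, and $\|\nabla_h\boldsymbol\pi_s\boldsymbol w\|_{L^\infty}\le C_E\|\nabla_h\boldsymbol w\|_{L^\infty}$ for all admissible $\boldsymbol w$ and all their Stokes projections. 2. *($\boldsymbol H(\mathrm{div})$-conforming methods)* $\|\boldsymbol w-\boldsymbol\pi_s\boldsymbol w\|_{L^\infty}+h\|\nabla_h\boldsymbol\pi_s\boldsymbol w\|_{L^\infty}\le C_Eh\|\nabla_h\boldsymbol w\|_{L^\infty}$ for all admissible $\boldsymbol w$ and all their Stokes projections; $\|\boldsymbol v_h\|_{L^2(\partial K)}\le C_{\rm tr}h_K^{-1/2}\|\boldsymbol v_h\|_{L^2(K)}$ for all $\boldsymbol v_h\in\boldsymbol V_h$ and $K\in\mathcal T_h$; every $K$ contains a ball of radius $\kappa h_K$, where $\kappa>0$; and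 $h\le\theta h_K$ for all $K$. Let $T>0$, let $\boldsymbol u\in L^1(0,T;\boldsymbol W^{1,\infty}(\Omega))$, and for almost every $t\in(0,T)$ let $\boldsymbol u(t)$ be admissible, let $\boldsymbol\pi_s\boldsymbol u(t)$ be a Stokes projection of $\boldsymbol u(t)$, and let $\boldsymbol u_h(t)\in\boldsymbol V_h^{\rm div}$. Put $\boldsymbol\eta=\boldsymbol u-\boldsymbol\pi_s\boldsymbol u$ and $\boldsymbol e_h=\boldsymbol u_h-\boldsymbol\pi_s\boldsymbol u$. Then there is a constant $C>0$, which depends only on $\Omega$ and $C_E$ in case 1, and only on $\Omega,C_E,C_{\rm tr},\kappa,\theta$ in case 2, such that for almost every $t\in(0,T)$ and all $\varepsilon_1,\varepsilon_2,\varepsilon_3,\varepsilon_4>0$ $$\begin{aligned}c_h(\boldsymbol u;\boldsymbol u,\boldsymbol e_h)-c_h(\boldsymbol u_h;\boldsymbol u_h,\boldsymbol e_h)\le{}&-|\boldsymbol e_h|^2_{\boldsymbol u_h,\rm upw}+\varepsilon_1^{-1}\|\boldsymbol u\|_{L^\infty}\|\nabla_h\boldsymbol\eta\|_{L^2}^2+\big[\varepsilon_2^{-1}+C(\varepsilon_3^{-1}+\varepsilon_4^{-1})h^{-1}\big]\|\nabla\boldsymbol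 u\|_{L^\infty}\|\boldsymbol\eta\|_{L^2}^2\\&+\big[\varepsilon_1\|\boldsymbol u\|_{L^\infty}+\big(C+\varepsilon_2+C(\varepsilon_3+\varepsilon_4)h^{-1}\big)\|\nabla\boldsymbol u\|_{L^\infty}\big]\|\boldsymbol e_h\|_{L^2}^2 .\end{aligned}$$ -/

import Mathlib

open MeasureTheory Filter Topology
open scoped ContDiff ENNReal

noncomputable section

/-- Points and vectors of `ℝ^d` with the Euclidean norm. -/
abbrev Vec (d : ℕ) : Type := EuclideanSpace ℝ (Fin d)

/-- Frobenius inner product `A : B` of two `d × d` tensors. -/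
def frobInner {d : ℕ} (A B : Vec d →L[ℝ] Vec d) : ℝ :=
  ∑ i : Fin d, inner ℝ (A (EuclideanSpace.single i 1)) (B (EuclideanSpace.single i 1))

/-- Frobenius norm of a `d × d` tensor. -/
def frob {d : ℕ} (A : Vec d →L[ℝ] Vec d) : ℝ := √(frobInner A A)

/-! ### Weak derivatives and function spaces -/

/-- `G` is the weak gradient (Jacobian) of the vector field `w` on the open set `U`. -/
def HasWeakGrad {d : ℕ} (U : Set (Vec d)) (w : Vec d → Vec d)
    (G : Vec d → Vec d →L[ℝ] Vec d) : Prop :=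
  LocallyIntegrableOn w U ∧ LocallyIntegrableOn G U ∧
  ∀ φ : Vec d → ℝ, ContDiff ℝ ∞ φ → HasCompactSupport φ → tsupport φ ⊆ U →
    ∀ a : Vec d, ∫ x in U, (fderiv ℝ φ x a) • w x = - ∫ x in U, φ x • (G x a)

open Classical in
/-- The weak gradient on `U` (zero if there is none); it is unique almost everywhere on `U`. -/
def weakGrad {d : ℕ} (U : Set (Vec d)) (w : Vec d → Vec d) : Vec d → Vec d →L[ℝ] Vec d :=
  if h : ∃ G, HasWeakGrad U w G then h.choose else 0

/-- `g` is the distributional divergence of the vector field `v` on the open set `U`. -/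
def HasWeakDiv {d : ℕ} (U : Set (Vec d)) (v : Vec d → Vec d) (g : Vec d → ℝ) : Prop :=
  LocallyIntegrableOn v U ∧ LocallyIntegrableOn g U ∧
  ∀ φ : Vec d → ℝ, ContDiff ℝ ∞ φ → HasCompactSupport φ → tsupport φ ⊆ U →
    ∫ x in U, fderiv ℝ φ x (v x) = - ∫ x in U, φ x * g x

open Classical in
/-- The distributional divergence on `U` (zero if it is not a function). -/
def weakDiv {d : ℕ} (U : Set (Vec d)) (v : Vec d → Vec d) : Vec d → ℝ :=
  if h : ∃ g, HasWeakDiv U v g then h.choose else 0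

/-- `v ∈ H(div; Ω)` with `v · n = 0` on `∂Ω`: the test functions need not vanish on `∂Ω`, so that
Green's formula `∫_Ω v · ∇φ + ∫_Ω φ ∇·v = ∫_∂Ω φ v·n` has no boundary contribution. (`Ω` is meant to
lie on one side of its boundary, `interior (closure Ω) = Ω`.) -/
def MemHdivZero {d : ℕ} (Ω : Set (Vec d)) (v : Vec d → Vec d) : Prop :=
  MemLp v 2 (volume.restrict Ω) ∧
  ∃ g : Vec d → ℝ, MemLp g 2 (volume.restrict Ω) ∧
    ∀ φ : Vec d → ℝ, ContDiff ℝ ∞ φ → HasCompactSupport φ →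
      ∫ x in Ω, fderiv ℝ φ x (v x) = - ∫ x in Ω, φ x * g x

/-- `w ∈ H¹(U)`. -/
def MemH1 {d : ℕ} (U : Set (Vec d)) (w : Vec d → Vec d) : Prop :=
  MemLp w 2 (volume.restrict U) ∧
  ∃ G, HasWeakGrad U w G ∧ MemLp G 2 (volume.restrict U)

/-- `w ∈ H¹₀(U)`, the closure of the smooth compactly supported fields in `H¹(U)`. -/
def MemH10 {d : ℕ} (U : Set (Vec d)) (w : Vec d → Vec d) : Prop :=
  MemLp w 2 (volume.restrict U) ∧
  ∃ G, HasWeakGrad U w G ∧ MemLp G 2 (volume.restrict U) ∧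
  ∃ φ : ℕ → Vec d → Vec d,
    (∀ n, ContDiff ℝ ∞ (φ n) ∧ HasCompactSupport (φ n) ∧ tsupport (φ n) ⊆ U) ∧
    Tendsto (fun n => eLpNorm (fun x => w x - φ n x) 2 (volume.restrict U)) atTop (𝓝 0) ∧
    Tendsto (fun n => eLpNorm (fun x => G x - fderiv ℝ (φ n) x) 2 (volume.restrict U))
      atTop (𝓝 0)

/-- `w ∈ W^{1,∞}(U)`. -/
def MemW1inf {d : ℕ} (U : Set (Vec d)) (w : Vec d → Vec d) : Prop :=
  MemLp w ∞ (volume.restrict U) ∧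
  ∃ G, HasWeakGrad U w G ∧ MemLp G ∞ (volume.restrict U)

/-- The norm `‖w‖_{L^∞} + ‖∇w‖_{L^∞}` of `W^{1,∞}(U)`. -/
def w1infNorm {d : ℕ} (U : Set (Vec d)) (w : Vec d → Vec d) : ℝ≥0∞ :=
  eLpNorm w ∞ (volume.restrict U) + eLpNorm (fun x => frob (weakGrad U w x)) ∞ (volume.restrict U)

/-- `u ∈ L¹(0,T; W^{1,∞}(Ω))` in the sense of Bochner: `u` is almost everywhere the limit of simple
functions with values in `W^{1,∞}(Ω)`, and its norm has a finite integral. -/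
def MemL1W1inf {d : ℕ} (Ω : Set (Vec d)) (T : ℝ) (u : ℝ → Vec d → Vec d) : Prop :=
  (∀ᵐ t ∂(volume.restrict (Set.Ioo 0 T)), MemW1inf Ω (u t)) ∧
  (∃ s : ℕ → SimpleFunc ℝ (Vec d → Vec d), (∀ n t, MemW1inf Ω (s n t)) ∧
    ∀ᵐ t ∂(volume.restrict (Set.Ioo 0 T)),
      Tendsto (fun n => w1infNorm Ω (u t - s n t)) atTop (𝓝 0)) ∧
  ∫⁻ t in Set.Ioo 0 T, w1infNorm Ω (u t) < ⊤

/-- `q ∈ L²₀(Ω)`. -/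
def MemL20 {d : ℕ} (Ω : Set (Vec d)) (q : Vec d → ℝ) : Prop :=
  MemLp q 2 (volume.restrict Ω) ∧ ∫ x in Ω, q x = 0

/-- `b(v, q) = -∫_Ω q ∇·v`. -/
def bForm {d : ℕ} (Ω : Set (Vec d)) (v : Vec d → Vec d) (q : Vec d → ℝ) : ℝ :=
  - ∫ x in Ω, q x * weakDiv Ω v x

/-- The weakly divergence-free fields in `H¹₀(Ω)`. -/
def MemVdiv {d : ℕ} (Ω : Set (Vec d)) (v : Vec d → Vec d) : Prop :=
  MemH10 Ω v ∧ ∀ q, MemL20 Ω q → bForm Ω v q = 0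

/-! ### Meshes -/

/-- Open, nonempty, bounded convex polytopes. -/
def IsPolytopeCell {d : ℕ} (K : Set (Vec d)) : Prop :=
  K.Nonempty ∧ ∃ s : Finset (Vec d), K = interior (convexHull ℝ (s : Set (Vec d)))

/-- `F` is a facet (a face of dimension `d - 1`) of the open cell `K`, with outer unit normal
`n`. -/
def IsFacet {d : ℕ} (K : Set (Vec d)) (n : Vec d) (F : Set (Vec d)) : Prop :=
  ‖n‖ = 1 ∧ F = {x ∈ closure K | ∀ y ∈ K, inner ℝ n y ≤ inner ℝ n x} ∧
  Module.finrank ℝ (vectorSpan ℝ F) + 1 = d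

/-- A partition of `Ω` into finitely many convex polytopes without hanging nodes. An interior facet
is a full facet of its two adjacent elements `plus F` and `minus F`, and `normal F` points from the
former to the latter. A boundary facet belongs to the single element `plus F`, and `normal F` is
the outer normal. -/
structure Mesh {d : ℕ} (Ω : Set (Vec d)) where
  elems : Finset (Set (Vec d))
  intFacets : Finset (Set (Vec d))
  bdFacets : Finset (Set (Vec d))
  plus : Set (Vec d) → Set (Vec d)
  minus : Set (Vec d) → Set (Vec d)
  normal : Set (Vec d) → Vec d
  cell : ∀ K ∈ elems, IsPolytopeCell K
  subset : ∀ K ∈ elems, K ⊆ Ω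
  disjoint : ∀ K ∈ elems, ∀ K' ∈ elems, K ≠ K' → Disjoint K K'
  cover : closure Ω = ⋃ K ∈ elems, closure K
  int_facet : ∀ F ∈ intFacets, plus F ∈ elems ∧ minus F ∈ elems ∧ plus F ≠ minus F ∧
    IsFacet (plus F) (normal F) F ∧ IsFacet (minus F) (-normal F) F
  bd_facet : ∀ F ∈ bdFacets, plus F ∈ elems ∧ IsFacet (plus F) (normal F) F ∧ F ⊆ frontier Ω
  complete : ∀ K ∈ elems, ∀ n F, IsFacet K n F →
    (F ∈ intFacets ∧ (K = plus F ∨ K = minus F)) ∨ (F ∈ bdFacets ∧ K = plus F)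
  int_bd : Disjoint intFacets bdFacets

/-- The mesh size `h = max_K h_K`. -/
def Mesh.h {d : ℕ} {Ω : Set (Vec d)} (M : Mesh Ω) : ℝ :=
  sSup (Metric.diam '' (M.elems : Set (Set (Vec d))))

/-- Shape regularity: every element contains a ball of radius `κ h_K`. -/
def Mesh.ShapeRegular {d : ℕ} {Ω : Set (Vec d)} (M : Mesh Ω) (κ : ℝ) : Prop :=
  ∀ K ∈ M.elems, ∃ x, Metric.ball x (κ * Metric.diam K) ⊆ K

/-- `θ` bounds the ratio `h / h_K` for all elements. -/
def Mesh.QuasiUniform {d : ℕ} {Ω : Set (Vec d)} (M : Mesh Ω) (θ : ℝ) : Prop :=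
  ∀ K ∈ M.elems, M.h ≤ θ * Metric.diam K

/-- The broken gradient `∇_h`. -/
def brokenGrad {d : ℕ} {Ω : Set (Vec d)} (M : Mesh Ω) (w : Vec d → Vec d) :
    Vec d → Vec d →L[ℝ] Vec d :=
  fun x => ∑ K ∈ M.elems, K.indicator (weakGrad K w) x

/-- The trace at `x ∈ ∂K` from within `K`: the limit of the averages over `K ∩ B(x, r)`. For fields
continuous up to the boundary it is the boundary value, for Sobolev functions it is the usual trace
almost everywhere, and it depends only on the class of `w` almost everywhere. -/
def tr {d : ℕ} {X : Type*} [NormedAddCommGroup X] [NormedSpace ℝ X]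
    (K : Set (Vec d)) (w : Vec d → X) (x : Vec d) : X :=
  limUnder (𝓝[>] (0 : ℝ)) (fun r => ⨍ y in Metric.ball x r ∩ K, w y)

/-- Jump across an interior facet. -/
def Mesh.jump {d : ℕ} {Ω : Set (Vec d)} (M : Mesh Ω) {X : Type*} [NormedAddCommGroup X]
    [NormedSpace ℝ X] (F : Set (Vec d)) (w : Vec d → X) (x : Vec d) : X :=
  tr (M.plus F) w x - tr (M.minus F) w x

/-- Average on an interior facet. -/
def Mesh.avg {d : ℕ} {Ω : Set (Vec d)} (M : Mesh Ω) {X : Type*} [NormedAddCommGroup X]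
    [NormedSpace ℝ X] (F : Set (Vec d)) (w : Vec d → X) (x : Vec d) : X :=
  (1 / 2 : ℝ) • (tr (M.plus F) w x + tr (M.minus F) w x)

/-- `‖w‖_{L²(Ω)}`. -/
def normL2 {d : ℕ} (Ω : Set (Vec d)) (w : Vec d → Vec d) : ℝ :=
  (eLpNorm w 2 (volume.restrict Ω)).toReal

/-- `‖w‖_{L^∞(Ω)}`. -/
def normLinf {d : ℕ} (Ω : Set (Vec d)) (w : Vec d → Vec d) : ℝ :=
  (eLpNorm w ∞ (volume.restrict Ω)).toReal

/-- `‖G‖_{L²(Ω)}` for a tensor field, with the Frobenius norm pointwise. -/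
def tnormL2 {d : ℕ} (Ω : Set (Vec d)) (G : Vec d → Vec d →L[ℝ] Vec d) : ℝ :=
  (eLpNorm (fun x => frob (G x)) 2 (volume.restrict Ω)).toReal

/-- `‖G‖_{L^∞(Ω)}` for a tensor field, with the Frobenius norm pointwise. -/
def tnormLinf {d : ℕ} (Ω : Set (Vec d)) (G : Vec d → Vec d →L[ℝ] Vec d) : ℝ :=
  (eLpNorm (fun x => frob (G x)) ∞ (volume.restrict Ω)).toReal

/-- `w ∈ H^{3/2+ε}(𝒯_h)` for some `ε > 0`: on every element, `w` is in `H¹` and its gradient has a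
finite Sobolev-Slobodeckij seminorm of order `s = 1/2 + ε < 1`. -/
def MemBrokenFrac {d : ℕ} {Ω : Set (Vec d)} (M : Mesh Ω) (w : Vec d → Vec d) : Prop :=
  ∃ s : ℝ, 1 / 2 < s ∧ s < 1 ∧ ∀ K ∈ M.elems, MemH1 K w ∧
    ∫⁻ x in K, ∫⁻ y in K,
      ENNReal.ofReal (‖weakGrad K w x - weakGrad K w y‖ ^ 2 / ‖x - y‖ ^ ((d : ℝ) + 2 * s)) < ⊤

/-! ### Discrete spaces and forms -/

/-- A divergence-conforming velocity/pressure pair on the mesh `M`: finite-dimensional spaces of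
velocities that are (at least) `C¹` up to the boundary of every element, `V_h ⊆ H(div; Ω)` with vanishing
normal component on `∂Ω`, `Q_h ⊆ L²₀(Ω)` and `∇ · V_h ⊆ Q_h`. -/
structure FEPair {d : ℕ} {Ω : Set (Vec d)} (M : Mesh Ω) where
  Vh : Submodule ℝ (Vec d → Vec d)
  Qh : Submodule ℝ (Vec d → ℝ)
  finVh : FiniteDimensional ℝ Vh
  finQh : FiniteDimensional ℝ Qh
  piecewise : ∀ v ∈ Vh, ∀ K ∈ M.elems, ∃ g : Vec d → Vec d, ContDiff ℝ 1 g ∧ Set.EqOn v g K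
  hdiv : ∀ v ∈ Vh, MemHdivZero Ω v
  l20 : ∀ q ∈ Qh, MemL20 Ω q
  divConf : ∀ v ∈ Vh, ∃ q ∈ Qh, HasWeakDiv Ω v q

/-- The discretely divergence-free velocities. -/
def FEPair.MemVhdiv {d : ℕ} {Ω : Set (Vec d)} {M : Mesh Ω} (P : FEPair M)
    (v : Vec d → Vec d) : Prop :=
  v ∈ P.Vh ∧ ∀ q ∈ P.Qh, bForm Ω v q = 0

/-- The convective form `c_h(β; w, v)`. The normal component of `β` is single-valued on interior
facets for `β ∈ H(div; Ω)`; it is written through the average. -/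
def ch {d : ℕ} {Ω : Set (Vec d)} (M : Mesh Ω) (β w v : Vec d → Vec d) : ℝ :=
  (∫ x in Ω, inner ℝ (brokenGrad M w x (β x)) (v x))
  + 1 / 2 * (∫ x in Ω, weakDiv Ω β x * inner ℝ (w x) (v x))
  - (∑ F ∈ M.intFacets, ∫ x in F,
      inner ℝ (M.avg F β x) (M.normal F) * inner ℝ (M.jump F w x) (M.avg F v x) ∂μHE[d - 1])
  + ∑ F ∈ M.intFacets, ∫ x in F,
      1 / 2 * |inner ℝ (M.avg F β x) (M.normal F)| * inner ℝ (M.jump F w x) (M.jump F v x)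
        ∂μHE[d - 1]

/-- The squared upwind jump seminorm `|w|²_{β,upw}`. -/
def upwSq {d : ℕ} {Ω : Set (Vec d)} (M : Mesh Ω) (β w : Vec d → Vec d) : ℝ :=
  ∑ F ∈ M.intFacets, ∫ x in F,
    1 / 2 * |inner ℝ (M.avg F β x) (M.normal F)| * ‖M.jump F w x‖ ^ 2 ∂μHE[d - 1]

/-- The symmetric interior penalty form `a_h(w, v)` with viscosity `ν`, grad-div parameter `δ` and
penalty `σ`. On a boundary facet, jump and average are both the trace. -/
def ah {d : ℕ} {Ω : Set (Vec d)} (M : Mesh Ω) (ν δ σ : ℝ) (w v : Vec d → Vec d) : ℝ :=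
  (∫ x in Ω, frobInner (brokenGrad M w x) (brokenGrad M v x))
  + δ / ν * (∫ x in Ω, weakDiv Ω w x * weakDiv Ω v x)
  - (∑ F ∈ M.intFacets, ∫ x in F,
      (inner ℝ (M.avg F (brokenGrad M w) x (M.normal F)) (M.jump F v x)
        + inner ℝ (M.jump F w x) (M.avg F (brokenGrad M v) x (M.normal F))
        - σ / Metric.diam F * inner ℝ (M.jump F w x) (M.jump F v x)) ∂μHE[d - 1])
  - ∑ F ∈ M.bdFacets, ∫ x in F,
      (inner ℝ (tr (M.plus F) (brokenGrad M w) x (M.normal F)) (tr (M.plus F) v x)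
        + inner ℝ (tr (M.plus F) w x) (tr (M.plus F) (brokenGrad M v) x (M.normal F))
        - σ / Metric.diam F * inner ℝ (tr (M.plus F) w x) (tr (M.plus F) v x)) ∂μHE[d - 1]

/-- The fields to which the Stokes projection is applied: divergence-free fields in `H¹₀(Ω)` that
belong to `H^{3/2+ε}(𝒯_h)` for some `ε > 0`. -/
def StokesAdmissible {d : ℕ} {Ω : Set (Vec d)} (M : Mesh Ω) (w : Vec d → Vec d) : Prop :=
  MemVdiv Ω w ∧ MemBrokenFrac M w

/-- `p` is the stationary Stokes projection `π_s w` of `w`. -/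
def IsStokesProj {d : ℕ} {Ω : Set (Vec d)} {M : Mesh Ω} (P : FEPair M) (ν δ σ : ℝ)
    (w p : Vec d → Vec d) : Prop :=
  P.MemVhdiv p ∧ ∀ v, P.MemVhdiv v → ah M ν δ σ p v = ah M ν δ σ w v

/-- The pair is `H¹`-conforming. -/
def FEPair.H1Conforming {d : ℕ} {Ω : Set (Vec d)} {M : Mesh Ω} (P : FEPair M) : Prop :=
  ∀ v ∈ P.Vh, MemH10 Ω v

/-- `L^∞` stability of the Stokes projection for `H¹`-conforming methods:
`‖∇_h π_s w‖_{L^∞} ≤ C ‖∇_h w‖_{L^∞}`. -/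
def StokesStableH1 {d : ℕ} {Ω : Set (Vec d)} {M : Mesh Ω} (P : FEPair M) (ν δ σ C : ℝ) : Prop :=
  ∀ w p, StokesAdmissible M w → IsStokesProj P ν δ σ w p →
    eLpNorm (fun x => frob (brokenGrad M p x)) ∞ (volume.restrict Ω) ≤
      ENNReal.ofReal C * eLpNorm (fun x => frob (brokenGrad M w x)) ∞ (volume.restrict Ω)

/-- `L^∞` stability of the Stokes projection for `H(div)`-conforming methods:
`‖w - π_s w‖_{L^∞} + h ‖∇_h π_s w‖_{L^∞} ≤ C h ‖∇_h w‖_{L^∞}`. -/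
def StokesStableHdiv {d : ℕ} {Ω : Set (Vec d)} {M : Mesh Ω} (P : FEPair M) (ν δ σ C : ℝ) : Prop :=
  ∀ w p, StokesAdmissible M w → IsStokesProj P ν δ σ w p →
    eLpNorm (w - p) ∞ (volume.restrict Ω) + ENNReal.ofReal M.h *
        eLpNorm (fun x => frob (brokenGrad M p x)) ∞ (volume.restrict Ω) ≤
      ENNReal.ofReal (C * M.h) *
        eLpNorm (fun x => frob (brokenGrad M w x)) ∞ (volume.restrict Ω)

/-- Discrete trace inequality `‖v‖_{L²(∂K)} ≤ C h_K^{-1/2} ‖v‖_{L²(K)}` on `V_h`. -/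
def DiscreteTrace {d : ℕ} {Ω : Set (Vec d)} {M : Mesh Ω} (P : FEPair M) (C : ℝ) : Prop :=
  ∀ v ∈ P.Vh, ∀ K ∈ M.elems,
    eLpNorm (tr K v) 2 ((μHE[d - 1] : Measure (Vec d)).restrict (frontier K)) ≤
      ENNReal.ofReal (C * (Metric.diam K) ^ (-(1 / 2) : ℝ)) * eLpNorm v 2 (volume.restrict K)

/-- The estimate of the difference of the convective terms with the constant `C`, where `p` is the
Stokes projection of `u`, `η = u - p` and `e_h = u_h - p`. -/
def ConvectiveBound {d : ℕ} {Ω : Set (Vec d)} (M : Mesh Ω) (C ε₁ ε₂ ε₃ ε₄ : ℝ)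
    (u uh p : Vec d → Vec d) : Prop :=
  ch M u u (uh - p) - ch M uh uh (uh - p) ≤
    - upwSq M uh (uh - p)
    + ε₁⁻¹ * normLinf Ω u * tnormL2 Ω (brokenGrad M (u - p)) ^ 2
    + (ε₂⁻¹ + C * (ε₃⁻¹ + ε₄⁻¹) * M.h⁻¹) * tnormLinf Ω (weakGrad Ω u) * normL2 Ω (u - p) ^ 2
    + (ε₁ * normLinf Ω u
        + (C + ε₂ + C * (ε₃ + ε₄) * M.h⁻¹) * tnormLinf Ω (weakGrad Ω u)) *
      normL2 Ω (uh - p) ^ 2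

end

/-!
The difference of the two convective terms is first rewritten as an exact identity and then
estimated term by term.

*Representatives.* A field `u ∈ W^{1,∞}(Ω) ∩ H¹₀(Ω)` agrees almost everywhere with a function that is
Lipschitz on all of `ℝ^d` and vanishes outside `Ω`: its extension by zero has a bounded weak
gradient, and mollifications of it are equi-Lipschitz (`exists_lipschitz_extension_of_memH10`). This
also gives `‖u‖_∞ ≤ D ‖∇u‖_∞` with `D` depending on `Ω` only. Discrete fields are `C¹` up to the
boundary of each element, so all fields are piecewise Lipschitz (`PiecewiseLip`), and all traces,
jumps and broken gradients in the forms can be computed from the representatives.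

*Green's formula.* The elements are convex polytopes. Such a cell is the intersection of the
half-spaces of its facets (`IsPolytopeCell.eq_polyhedron`), and the divergence theorem on it follows by
integrating against smooth cutoffs that converge to its indicator function
(`integral_lineDeriv_polyhedron`). Testing with all smooth functions on `ℝ^d` shows that the fields in
`V_h^div` have vanishing divergence, continuous normal components across interior facets and no
normal component on `∂Ω` (`PiecewiseLip.normal_continuity`), and that piecewise Lipschitz fields in
`H¹₀(Ω)` do not jump (`PiecewiseLip.jump_eq_zero_of_memH10`). Here facets overlap in null sets only
because `Ω` lies on one side of its boundary (`Mesh.measure_inter_eq_zero`).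

*Identity.* Write `e = u_h - p` and `η = u - p`. Green's formula for the field `½ |e|² u_h` shows that
`c_h(u_h; e, e) = |e|²_{u_h,upw}`. Since `u` has no jumps, what remains are the volume terms
`(∇u u - ∇_h p u_h, e) = (∇_h η u + ∇_h p η - ∇_h p e, e)` and facet terms that are linear in the jump
of `p`, which is minus the jump of `η` (`convective_error_identity`).

*Estimate.* The volume terms are bounded by Cauchy-Schwarz and the stability of the Stokes
projection. In the `H¹`-conforming case the jumps of `p` vanish. In the `H(div)`-conforming case the
velocity on a facet is `u` minus an average of `η` plus an average of `e`, which splits the facet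
terms into three (`facet_terms_le`). They are controlled by the discrete trace inequality for `e`,
by the trace inequality obtained from Green's formula for `f(x) (x - x₀)` applied to `f = |η|²` and
`f = |η|⁴` (`Mesh.mul_sum_integral_facets_le`), and by `‖η‖_∞ ≤ C h ‖∇u‖_∞`. For the term with the velocity
`u` this produces `‖u‖_∞ ‖∇_h η‖ ‖e‖`, which is absorbed by the `ε₁` terms, and `‖u‖_∞ h⁻¹ ‖η‖ ‖e‖`, for
which `‖u‖_∞ ≤ D ‖∇u‖_∞` is used. In the end Young's inequality distributes everything
(`le_of_young`).
-/

noncomputable section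

/-! ### Hyperplanes and the Euclidean Hausdorff measure -/

/-- Coordinates adapted to the direction `n`: the point with coordinate `q.1` along `n` and component
`q.2` orthogonal to `n`. -/
def normalCoord {d : ℕ} (n : Vec d) (q : ℝ × (ℝ ∙ n)ᗮ) : Vec d := q.1 • n + (q.2 : Vec d)

theorem continuous_normalCoord {d : ℕ} (n : Vec d) : Continuous (normalCoord n) := by
  unfold normalCoord; fun_prop

theorem inner_normalCoord {d : ℕ} {n : Vec d} (hn : ‖n‖ = 1) (q : ℝ × (ℝ ∙ n)ᗮ) :
    inner ℝ n (normalCoord n q) = q.1 := by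
  have h : inner ℝ n (q.2 : Vec d) = 0 :=
    Submodule.inner_right_of_mem_orthogonal (Submodule.mem_span_singleton_self n) q.2.2
  simp [normalCoord, inner_add_right, inner_smul_right, h, hn]

theorem norm_le_norm_normalCoord {d : ℕ} (n : Vec d) (q : ℝ × (ℝ ∙ n)ᗮ) :
    ‖q.2‖ ≤ ‖normalCoord n q‖ := by
  have h : inner ℝ (q.1 • n) (q.2 : Vec d) = 0 := by
    rw [inner_smul_left, Submodule.inner_right_of_mem_orthogonal
      (Submodule.mem_span_singleton_self n) q.2.2, mul_zero]
  have h2 := norm_add_sq_eq_norm_sq_add_norm_sq_of_inner_eq_zero _ _ h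
  have h3 : ‖q.2‖ = ‖(q.2 : Vec d)‖ := rfl
  rw [h3]
  refine le_of_sq_le_sq ?_ (norm_nonneg _)
  change _ ≤ ‖q.1 • n + (q.2 : Vec d)‖ ^ 2
  nlinarith [sq_nonneg ‖q.1 • n‖]

theorem measurePreserving_normalCoord {d : ℕ} {n : Vec d} (hn : ‖n‖ = 1) :
    MeasurePreserving (normalCoord n) volume volume ∧ MeasurableEmbedding (normalCoord n) := by
  have h1 := ((ℝ ∙ n).measurePreserving_measurableEquivProd (0 : Vec d)).symm
  rw [InnerProductSpace.euclideanHausdorffMeasure_eq_volume] at h1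
  have h2 := (LinearIsometryEquiv.toSpanUnitSingleton (𝕜 := ℝ) n hn).measurePreserving
  have h3 := h2.prod (MeasurePreserving.id (volume : Measure (ℝ ∙ n)ᗮ))
  have h4 := h1.comp h3
  have he : (⇑(Submodule.measurableEquivProd (ℝ ∙ n) (0 : Vec d)).symm ∘
      Prod.map (LinearIsometryEquiv.toSpanUnitSingleton (𝕜 := ℝ) n hn) id) = normalCoord n := by
    ext1 q
    simp [normalCoord]
  rw [he] at h4
  refine ⟨h4, ?_⟩
  rw [← he]
  refine (MeasurableEquiv.measurableEmbedding _).comp ?_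
  exact ((LinearIsometryEquiv.toSpanUnitSingleton (𝕜 := ℝ) n
    hn).toHomeomorph.toMeasurableEquiv.prodCongr (MeasurableEquiv.refl _)).measurableEmbedding

/-- Fubini in coordinates adapted to `n`, with the coordinate along `n` rescaled to measure the
distance to the hyperplane at level `c` in units of `ε`. -/
theorem integral_eq_integral_normalCoord {d : ℕ} {n : Vec d} (hn : ‖n‖ = 1) (c : ℝ) {ε : ℝ}
    (hε : 0 < ε) (F : Vec d → ℝ) :
    ∫ x, F x = ε * ∫ q : ℝ × (ℝ ∙ n)ᗮ, F (normalCoord n (c - ε * q.1, q.2)) := by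
  obtain ⟨h1, h1e⟩ := measurePreserving_normalCoord hn
  have h2 : MeasurePreserving (fun s : ℝ => c - ε * s) (ENNReal.ofReal ε • volume) volume := by
    have ha : MeasurePreserving (fun s : ℝ => -ε * s) (ENNReal.ofReal ε • volume) volume := by
      refine ⟨by fun_prop, ?_⟩
      rw [Measure.map_smul, Real.map_volume_mul_left (neg_ne_zero.2 hε.ne'), smul_smul,
        ← ENNReal.ofReal_mul hε.le, inv_neg, abs_neg, abs_of_pos (inv_pos.2 hε),
        mul_inv_cancel₀ hε.ne']
      simp
    have hb := (measurePreserving_add_left volume c).comp ha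
    have he : (fun s : ℝ => c - ε * s) = (fun s => c + s) ∘ fun s => -ε * s := by
      ext s; simp [sub_eq_add_neg]
    rwa [he]
  have h2e : MeasurableEmbedding (fun s : ℝ => c - ε * s) := by
    exact (((Homeomorph.mulLeft₀ ε hε.ne').trans (Homeomorph.subLeft c))).measurableEmbedding
  have h3 := h2.prod (MeasurePreserving.id (volume : Measure (ℝ ∙ n)ᗮ))
  have h3e : MeasurableEmbedding (Prod.map (fun s : ℝ => c - ε * s) (id : (ℝ ∙ n)ᗮ → (ℝ ∙ n)ᗮ)) :=
    h2e.prodMap MeasurableEmbedding.id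
  have h4 := (h1.comp h3).integral_comp (h1e.comp h3e) F
  rw [← h4, Measure.prod_smul_left, integral_smul_measure, ENNReal.toReal_ofReal hε.le]
  rfl

theorem finrank_orthogonal_span_of_norm_one {d : ℕ} {n : Vec d} (hn : ‖n‖ = 1) :
    Module.finrank ℝ (ℝ ∙ n)ᗮ = d - 1 := by
  have h := (ℝ ∙ n).finrank_add_finrank_orthogonal
  rw [finrank_span_singleton (by rintro rfl; simp at hn)] at h
  simp at h
  omega

/-- The surface measure on the hyperplane `{⟪n, x⟫ = c}` is the Lebesgue measure of the orthogonal
complement of `n`. -/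
theorem restrict_hyperplane_euclideanHausdorffMeasure {d : ℕ} {n : Vec d} (hn : ‖n‖ = 1) (c : ℝ) :
    MeasurableEmbedding (fun y : (ℝ ∙ n)ᗮ => normalCoord n (c, y)) ∧
    (μHE[d - 1] : Measure (Vec d)).restrict {x | inner ℝ n x = c} =
      Measure.map (fun y : (ℝ ∙ n)ᗮ => normalCoord n (c, y)) volume := by
  have hi : Isometry (fun y : (ℝ ∙ n)ᗮ => normalCoord n (c, y)) := by
    refine Isometry.of_dist_eq fun x y => ?_
    simp [normalCoord, dist_eq_norm]
  have hr : Set.range (fun y : (ℝ ∙ n)ᗮ => normalCoord n (c, y)) = {x | inner ℝ n x = c} := by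
    ext x
    constructor
    · rintro ⟨y, rfl⟩
      exact inner_normalCoord hn _
    · intro hx
      refine ⟨⟨x - c • n, ?_⟩, by simp [normalCoord]⟩
      rw [Submodule.mem_orthogonal_singleton_iff_inner_right, inner_sub_right, inner_smul_right, hx]
      simp [hn]
  refine ⟨(Isometry.isClosedEmbedding hi).measurableEmbedding, ?_⟩
  rw [← hr, ← hi.map_euclideanHausdorffMeasure, ← finrank_orthogonal_span_of_norm_one hn,
    InnerProductSpace.euclideanHausdorffMeasure_eq_volume]

/-- On a hyperplane with unit normal `n`, surface integrals are Lebesgue integrals in the tangential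
coordinates of `normalCoord n`. -/
theorem setIntegral_hyperplane {d : ℕ} {n : Vec d} (hn : ‖n‖ = 1) (c : ℝ) {S : Set (Vec d)}
    (hS : S ⊆ {x | inner ℝ n x = c}) (f : Vec d → ℝ) :
    ∫ x in S, f x ∂μHE[d - 1] =
      ∫ y in (fun y : (ℝ ∙ n)ᗮ => normalCoord n (c, y)) ⁻¹' S, f (normalCoord n (c, y)) := by
  obtain ⟨h1, h2⟩ := restrict_hyperplane_euclideanHausdorffMeasure hn c
  rw [← h1.setIntegral_map, ← h2, Measure.restrict_restrict_of_subset hS]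

/-- On a hyperplane with unit normal `n`, the surface measure is Lebesgue measure in the tangential
coordinates of `normalCoord n`. -/
theorem measure_hyperplane {d : ℕ} {n : Vec d} (hn : ‖n‖ = 1) (c : ℝ) {S : Set (Vec d)}
    (hS : S ⊆ {x | inner ℝ n x = c}) :
    (μHE[d - 1] : Measure (Vec d)) S =
      volume ((fun y : (ℝ ∙ n)ᗮ => normalCoord n (c, y)) ⁻¹' S) := by
  obtain ⟨h1, h2⟩ := restrict_hyperplane_euclideanHausdorffMeasure hn c
  rw [← h1.map_apply, ← h2, Measure.restrict_eq_self _ hS]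

theorem measure_hyperplane_lt_top {d : ℕ} {n : Vec d} (hn : ‖n‖ = 1) (c : ℝ) {S : Set (Vec d)}
    (hS : S ⊆ {x | inner ℝ n x = c}) (hb : Bornology.IsBounded S) :
    (μHE[d - 1] : Measure (Vec d)) S < ⊤ := by
  rw [measure_hyperplane hn c hS]
  obtain ⟨R, hR⟩ := hb.subset_closedBall 0
  refine lt_of_le_of_lt (measure_mono fun y hy => ?_)
    (measure_closedBall_lt_top (x := (0 : (ℝ ∙ n)ᗮ)) (r := R))
  have := hR hy
  rw [mem_closedBall_zero_iff] at this ⊢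
  exact (norm_le_norm_normalCoord n (c, y)).trans this

theorem volume_setOf_inner_eq_zero {W : Type*} [NormedAddCommGroup W] [InnerProductSpace ℝ W]
    [FiniteDimensional ℝ W] [MeasurableSpace W] [BorelSpace W] {w : W} (hw : w ≠ 0) (c : ℝ) :
    volume {y : W | inner ℝ w y = c} = 0 := by
  by_cases h : ∃ y₀ : W, inner ℝ w y₀ = c
  · obtain ⟨y₀, h₀⟩ := h
    refine measure_mono_null (t := (AffineSubspace.mk' y₀ (ℝ ∙ w)ᗮ : Set W)) ?_
      (Measure.addHaar_affineSubspace volume _ fun htop => ?_)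
    · intro y hy
      simp only [Set.mem_ofPred_eq] at hy
      simp only [SetLike.mem_coe, AffineSubspace.mem_mk', vsub_eq_sub,
        Submodule.mem_orthogonal_singleton_iff_inner_right, inner_sub_right, hy, h₀, sub_self]
    · have h1 : y₀ + w ∈ AffineSubspace.mk' y₀ (ℝ ∙ w)ᗮ := by rw [htop]; trivial
      rw [AffineSubspace.mem_mk', vsub_eq_sub, add_sub_cancel_left,
        Submodule.mem_orthogonal_singleton_iff_inner_right] at h1
      exact hw (inner_self_eq_zero.1 h1)
  · push Not at h
    have : {y : W | inner ℝ w y = c} = ∅ := by ext y; simp [h y]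
    simp [this]

/-- A hyperplane with normal `m` meets the hyperplane `{⟪n, x⟫ = c}` in a null set unless `m` and
`n` are parallel. -/
theorem ae_inner_normalCoord_ne {d : ℕ} {n m : Vec d} (hn : ‖n‖ = 1) (hm : ‖m‖ = 1) (h1 : m ≠ n)
    (h2 : m ≠ -n) (c c' : ℝ) :
    ∀ᵐ y : (ℝ ∙ n)ᗮ, inner ℝ m (normalCoord n (c, y)) ≠ c' := by
  set w : (ℝ ∙ n)ᗮ := (ℝ ∙ n)ᗮ.orthogonalProjectionOnto m with hw
  have hw0 : w ≠ 0 := by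
    intro h0
    rw [hw, Submodule.orthogonalProjectionOnto_eq_zero_iff, Submodule.orthogonal_orthogonal,
      Submodule.mem_span_singleton] at h0
    obtain ⟨a, rfl⟩ := h0
    rw [norm_smul, hn, mul_one, Real.norm_eq_abs] at hm
    rcases eq_or_eq_neg_of_abs_eq hm with h | h
    · exact h1 (by simp [h])
    · exact h2 (by simp [h])
  rw [ae_iff]
  refine measure_mono_null (fun y hy => ?_) (volume_setOf_inner_eq_zero hw0 (c' - c * inner ℝ m n))
  simp only [ne_eq, not_not, Set.mem_ofPred_eq, normalCoord, inner_add_right, inner_smul_right]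
    at hy ⊢
  rw [hw, Submodule.inner_orthogonalProjectionOnto_eq_of_mem_right]
  linarith

/-! ### The divergence theorem on polytopes -/

theorem deriv_smoothTransition_eq_zero {s : ℝ} (hs : s ∉ Set.Icc (0 : ℝ) 1) :
    deriv Real.smoothTransition s = 0 := by
  rw [Set.mem_Icc, not_and_or, not_le, not_le] at hs
  rcases hs with hs | hs
  · have : Real.smoothTransition =ᶠ[𝓝 s] fun _ => 0 := by
      filter_upwards [Iio_mem_nhds hs] with x hx
      exact Real.smoothTransition.zero_of_nonpos (le_of_lt hx)
    rw [this.deriv_eq, deriv_const]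
  · have : Real.smoothTransition =ᶠ[𝓝 s] fun _ => 1 := by
      filter_upwards [Ioi_mem_nhds hs] with x hx
      exact Real.smoothTransition.one_of_one_le (le_of_lt hx)
    rw [this.deriv_eq, deriv_const]

theorem continuous_deriv_smoothTransition : Continuous (deriv Real.smoothTransition) :=
  (Real.smoothTransition.contDiff (n := 1)).continuous_deriv le_rfl

theorem integral_deriv_smoothTransition : ∫ s, deriv Real.smoothTransition s = 1 := by
  have h1 : ∫ s in Set.Icc (0 : ℝ) 1, deriv Real.smoothTransition s
      = ∫ s, deriv Real.smoothTransition s :=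
    setIntegral_eq_integral_of_forall_compl_eq_zero fun s hs => deriv_smoothTransition_eq_zero hs
  rw [← h1, integral_Icc_eq_integral_Ioc, ← intervalIntegral.integral_of_le zero_le_one,
    intervalIntegral.integral_deriv_eq_sub]
  · simp
  · intro x _
    exact (Real.smoothTransition.contDiff (n := 1)).differentiable one_ne_zero x
  · exact continuous_deriv_smoothTransition.intervalIntegrable _ _

section Polyhedron

variable {d : ℕ} {ι : Type*}

/-- The open polyhedron `{⟪n i, x⟫ < c i for all i}`. -/
def polyhedron (n : ι → Vec d) (c : ι → ℝ) : Set (Vec d) := {x | ∀ i, inner ℝ (n i) x < c i}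

/-- The `i`-th face of the closed polyhedron. -/
def polyFace (n : ι → Vec d) (c : ι → ℝ) (i : ι) : Set (Vec d) :=
  {x | inner ℝ (n i) x = c i ∧ ∀ j, inner ℝ (n j) x ≤ c j}

theorem closure_polyhedron {n : ι → Vec d} {c : ι → ℝ} (hne : (polyhedron n c).Nonempty) :
    closure (polyhedron n c) = {x | ∀ i, inner ℝ (n i) x ≤ c i} := by
  apply Set.Subset.antisymm
  · refine closure_minimal (fun x hx i => (hx i).le) ?_
    simp only [Set.ofPred_forall]
    exact isClosed_iInter fun i => isClosed_le (by fun_prop) (by fun_prop)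
  · intro x hx
    obtain ⟨z, hz⟩ := hne
    have ht : Tendsto (fun t : ℝ => x + t • (z - x)) (𝓝[>] 0) (𝓝 x) := by
      have : Tendsto (fun t : ℝ => x + t • (z - x)) (𝓝 0) (𝓝 (x + (0 : ℝ) • (z - x))) :=
        Continuous.tendsto (by fun_prop) 0
      rw [zero_smul, add_zero] at this
      exact this.mono_left nhdsWithin_le_nhds
    refine mem_closure_of_tendsto ht ?_
    filter_upwards [Ioo_mem_nhdsGT (zero_lt_one (α := ℝ))] with t ht i
    simp only [inner_add_right, inner_smul_right, inner_sub_right]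
    have h1 := hx i
    have h2 := hz i
    nlinarith [ht.1, ht.2]

variable [Fintype ι]

theorem isOpen_polyhedron (n : ι → Vec d) (c : ι → ℝ) : IsOpen (polyhedron n c) := by
  simp only [polyhedron, Set.ofPred_forall]
  exact isOpen_iInter_of_finite fun i => isOpen_lt (by fun_prop) (by fun_prop)

/-- A smooth approximation of the indicator function of a polyhedron, which differs from it only in
a layer of width `ε` along the boundary. -/
def polyCutoff (n : ι → Vec d) (c : ι → ℝ) (ε : ℝ) (x : Vec d) : ℝ :=
  ∏ i, Real.smoothTransition ((c i - inner ℝ (n i) x) / ε)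

theorem contDiff_polyCutoff (n : ι → Vec d) (c : ι → ℝ) (ε : ℝ) :
    ContDiff ℝ 1 (polyCutoff n c ε) := by
  unfold polyCutoff
  refine contDiff_prod fun i _ => ?_
  exact (Real.smoothTransition.contDiff (n := 1)).comp
    ((contDiff_const.sub (contDiff_const.inner ℝ contDiff_id)).div_const ε)

theorem polyCutoff_eq_zero {n : ι → Vec d} {c : ι → ℝ} {ε : ℝ} (hε : 0 < ε) {x : Vec d}
    (hx : x ∉ polyhedron n c) : polyCutoff n c ε x = 0 := by
  simp only [polyhedron, Set.mem_ofPred_eq, not_forall, not_lt] at hx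
  obtain ⟨i, hi⟩ := hx
  refine Finset.prod_eq_zero (Finset.mem_univ i) (Real.smoothTransition.zero_of_nonpos ?_)
  exact div_nonpos_of_nonpos_of_nonneg (by linarith) hε.le

theorem abs_polyCutoff_le (n : ι → Vec d) (c : ι → ℝ) (ε : ℝ) (x : Vec d) :
    |polyCutoff n c ε x| ≤ 1 := by
  rw [polyCutoff, Finset.abs_prod]
  refine Finset.prod_le_one (fun i _ => abs_nonneg _) fun i _ => ?_
  rw [abs_of_nonneg (Real.smoothTransition.nonneg _)]
  exact Real.smoothTransition.le_one _

theorem hasCompactSupport_polyCutoff {n : ι → Vec d} {c : ι → ℝ} {ε : ℝ} (hε : 0 < ε)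
    (hb : Bornology.IsBounded (polyhedron n c)) : HasCompactSupport (polyCutoff n c ε) := by
  refine HasCompactSupport.of_support_subset_isCompact (K := closure (polyhedron n c))
    hb.isCompact_closure fun x hx => ?_
  by_contra h
  exact hx (polyCutoff_eq_zero hε fun h' => h (subset_closure h'))

theorem tendsto_polyCutoff {n : ι → Vec d} {c : ι → ℝ} (x : Vec d) :
    Tendsto (fun ε => polyCutoff n c ε x) (𝓝[>] 0) (𝓝 ((polyhedron n c).indicator 1 x)) := by
  by_cases hx : x ∈ polyhedron n c
  · rw [Set.indicator_of_mem hx]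
    have : (1 : Vec d → ℝ) x = ∏ i : ι, 1 := by simp
    rw [this]
    refine tendsto_finsetProd _ fun i _ => ?_
    have h1 : Tendsto (fun ε : ℝ => (c i - inner ℝ (n i) x) * ε⁻¹) (𝓝[>] 0) atTop :=
      tendsto_inv_nhdsGT_zero.const_mul_atTop (sub_pos.2 (hx i))
    refine tendsto_const_nhds.congr' ?_
    filter_upwards [h1.eventually_ge_atTop 1] with ε hε
    exact (Real.smoothTransition.one_of_one_le (by rwa [div_eq_mul_inv])).symm
  · rw [Set.indicator_of_notMem hx]
    refine tendsto_const_nhds.congr' ?_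
    filter_upwards [self_mem_nhdsWithin] with ε hε
    exact (polyCutoff_eq_zero hε hx).symm

variable [DecidableEq ι]

theorem lineDeriv_polyCutoff (n : ι → Vec d) (c : ι → ℝ) (ε : ℝ) (x v : Vec d) :
    lineDeriv ℝ (polyCutoff n c ε) x v =
      ∑ i, (∏ j ∈ Finset.univ.erase i, Real.smoothTransition ((c j - inner ℝ (n j) x) / ε)) *
        (deriv Real.smoothTransition ((c i - inner ℝ (n i) x) / ε) * (-inner ℝ (n i) v / ε)) := by
  have h : ∀ i ∈ (Finset.univ : Finset ι), HasDerivAt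
      (fun t : ℝ => Real.smoothTransition ((c i - inner ℝ (n i) (x + t • v)) / ε))
      (deriv Real.smoothTransition ((c i - inner ℝ (n i) x) / ε) * (-inner ℝ (n i) v / ε)) 0 := by
    intro i _
    have h1 : HasDerivAt (fun t : ℝ => (c i - inner ℝ (n i) (x + t • v)) / ε)
        (-inner ℝ (n i) v / ε) 0 := by
      simp only [inner_add_right, inner_smul_right]
      have h2 := ((((hasDerivAt_id (0 : ℝ)).mul_const (inner ℝ (n i) v)).const_add
        (inner ℝ (n i) x)).const_sub (c i)).div_const ε
      simpa using h2
    have h3 : HasDerivAt Real.smoothTransition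
        (deriv Real.smoothTransition ((c i - inner ℝ (n i) x) / ε))
        ((c i - inner ℝ (n i) (x + (0 : ℝ) • v)) / ε) := by
      rw [zero_smul, add_zero]
      exact ((Real.smoothTransition.contDiff (n := 1)).differentiable one_ne_zero _).hasDerivAt
    exact h3.comp (0 : ℝ) h1
  have h4 := HasDerivAt.fun_finsetProd h
  rw [lineDeriv]
  have h5 := h4.deriv
  simp only [zero_smul, add_zero, smul_eq_mul] at h5
  exact h5

/-- The integral over the boundary layer of the `i`-th face, in rescaled coordinates. -/
def polyLayer (n : ι → Vec d) (c : ι → ℝ) (f : Vec d → ℝ) (i : ι) (ε : ℝ)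
    (q : ℝ × (ℝ ∙ n i)ᗮ) : ℝ :=
  (∏ j ∈ Finset.univ.erase i, Real.smoothTransition
    ((c j - inner ℝ (n j) (normalCoord (n i) (c i - ε * q.1, q.2))) / ε)) *
    (deriv Real.smoothTransition q.1 * f (normalCoord (n i) (c i - ε * q.1, q.2)))

theorem continuous_polyLayer (n : ι → Vec d) (c : ι → ℝ) {f : Vec d → ℝ} (hf : Continuous f)
    (i : ι) (ε : ℝ) : Continuous (polyLayer n c f i ε) := by
  have h1 : Continuous fun q : ℝ × (ℝ ∙ n i)ᗮ => normalCoord (n i) (c i - ε * q.1, q.2) :=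
    (continuous_normalCoord _).comp (by fun_prop)
  have h2 := continuous_deriv_smoothTransition
  have h3 := Real.smoothTransition.continuous
  unfold polyLayer
  refine Continuous.mul (continuous_finsetProd _ fun j _ => ?_) ?_
  · exact h3.comp (by fun_prop)
  · exact (h2.comp continuous_fst).mul (hf.comp h1)

/-- A bound for the boundary layer integrands that does not depend on `ε`: where the integrand does
not vanish, its argument lies in the closed polyhedron. -/
theorem abs_polyLayer_le {n : ι → Vec d} (hn : ∀ i, ‖n i‖ = 1) {c : ι → ℝ} {f : Vec d → ℝ}
    (hne : (polyhedron n c).Nonempty) {R B D : ℝ}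
    (hR : closure (polyhedron n c) ⊆ Metric.closedBall 0 R)
    (hB : ∀ x ∈ closure (polyhedron n c), |f x| ≤ B)
    (hD : ∀ s, |deriv Real.smoothTransition s| ≤ D) (i : ι) {ε : ℝ} (hε : 0 < ε)
    (q : ℝ × (ℝ ∙ n i)ᗮ) :
    |polyLayer n c f i ε q| ≤
      (Set.Icc (0 : ℝ) 1 ×ˢ Metric.closedBall (0 : (ℝ ∙ n i)ᗮ) R).indicator (fun _ => D * B) q := by
  have hB0 : 0 ≤ B := by
    obtain ⟨z, hz⟩ := hne
    exact (abs_nonneg _).trans (hB z (subset_closure hz))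
  have hD0 : 0 ≤ D := (abs_nonneg _).trans (hD 0)
  by_cases h0 : polyLayer n c f i ε q = 0
  · rw [h0, abs_zero]
    exact Set.indicator_nonneg (fun _ _ => mul_nonneg hD0 hB0) _
  · have hp : ∀ j ∈ Finset.univ.erase i, Real.smoothTransition
        ((c j - inner ℝ (n j) (normalCoord (n i) (c i - ε * q.1, q.2))) / ε) ≠ 0 := by
      intro j hj hz
      exact h0 (by rw [polyLayer, Finset.prod_eq_zero hj hz, zero_mul])
    have hs : q.1 ∈ Set.Icc (0 : ℝ) 1 := by
      by_contra h
      exact h0 (by rw [polyLayer, deriv_smoothTransition_eq_zero h]; simp)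
    have hx : normalCoord (n i) (c i - ε * q.1, q.2) ∈ closure (polyhedron n c) := by
      rw [closure_polyhedron hne]
      intro j
      by_cases hj : j = i
      · subst hj
        rw [inner_normalCoord (hn j)]
        nlinarith [hs.1]
      · have := hp j (Finset.mem_erase.2 ⟨hj, Finset.mem_univ _⟩)
        rw [Ne, Real.smoothTransition.zero_iff_nonpos, not_le] at this
        have := (div_pos_iff_of_pos_right hε).1 this
        linarith
    have hq : q ∈ Set.Icc (0 : ℝ) 1 ×ˢ Metric.closedBall (0 : (ℝ ∙ n i)ᗮ) R := by
      refine ⟨hs, ?_⟩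
      have := hR hx
      rw [mem_closedBall_zero_iff] at this ⊢
      exact (norm_le_norm_normalCoord (n i) (c i - ε * q.1, q.2)).trans this
    rw [Set.indicator_of_mem hq, polyLayer, abs_mul, abs_mul]
    have h1 : |∏ j ∈ Finset.univ.erase i, Real.smoothTransition
        ((c j - inner ℝ (n j) (normalCoord (n i) (c i - ε * q.1, q.2))) / ε)| ≤ 1 := by
      rw [Finset.abs_prod]
      refine Finset.prod_le_one (fun i _ => abs_nonneg _) fun i _ => ?_
      rw [abs_of_nonneg (Real.smoothTransition.nonneg _)]
      exact Real.smoothTransition.le_one _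
    calc _ ≤ 1 * (D * B) := mul_le_mul h1 (mul_le_mul (hD _) (hB _ hx) (abs_nonneg _) hD0)
          (by positivity) zero_le_one
      _ = D * B := one_mul _

/-- Almost every point of the hyperplane of the `i`-th face lies on no other face hyperplane. -/
theorem ae_ne_face {n : ι → Vec d} (hn : ∀ i, ‖n i‖ = 1) (hinj : Function.Injective n) {c : ι → ℝ}
    (hne : (polyhedron n c).Nonempty) (i : ι) :
    ∀ᵐ y : (ℝ ∙ n i)ᗮ, ∀ j, j ≠ i → inner ℝ (n j) (normalCoord (n i) (c i, y)) ≠ c j := by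
  rw [ae_all_iff]
  intro j
  by_cases hj : j = i
  · exact .of_forall fun y h => absurd hj h
  by_cases h2 : n j = -n i
  -- planes with opposite normals are parallel, and distinct because the polyhedron is nonempty
  · refine .of_forall fun y _ => ?_
    obtain ⟨z, hz⟩ := hne
    have h3 := hz i
    have h4 := hz j
    rw [h2, inner_neg_left, inner_normalCoord (hn i)]
    rw [h2, inner_neg_left] at h4
    simp only
    intro h5
    linarith
  · filter_upwards [ae_inner_normalCoord_ne (hn i) (hn j) (fun h => hj (hinj h)) h2 (c i) (c j)]
      with y hy _ using hy

/-- As `ε → 0`, the cutoffs of the other faces tend to the indicator functions of their half-spaces,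
so the boundary layer integrand concentrates on the face. -/
theorem tendsto_polyLayer {n : ι → Vec d} {c : ι → ℝ}
    {f : Vec d → ℝ} (hf : Continuous f) (i : ι) (q : ℝ × (ℝ ∙ n i)ᗮ)
    (hq : ∀ j, j ≠ i → inner ℝ (n j) (normalCoord (n i) (c i, q.2)) ≠ c j) :
    Tendsto (fun ε => polyLayer n c f i ε q) (𝓝[>] 0)
      (𝓝 ((∏ j ∈ Finset.univ.erase i,
        if inner ℝ (n j) (normalCoord (n i) (c i, q.2)) < c j then (1 : ℝ) else 0) *
        (deriv Real.smoothTransition q.1 * f (normalCoord (n i) (c i, q.2))))) := by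
  have hX : Tendsto (fun ε : ℝ => normalCoord (n i) (c i - ε * q.1, q.2)) (𝓝[>] 0)
      (𝓝 (normalCoord (n i) (c i, q.2))) := by
    have : Tendsto (fun ε : ℝ => normalCoord (n i) (c i - ε * q.1, q.2)) (𝓝 0)
        (𝓝 (normalCoord (n i) (c i - 0 * q.1, q.2))) :=
      Continuous.tendsto ((continuous_normalCoord _).comp (by fun_prop)) 0
    rw [zero_mul, sub_zero] at this
    exact this.mono_left nhdsWithin_le_nhds
  unfold polyLayer
  refine Tendsto.mul (tendsto_finsetProd _ fun j hj => ?_) (tendsto_const_nhds.mul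
    ((hf.tendsto _).comp hX))
  have hji : j ≠ i := (Finset.mem_erase.1 hj).1
  have hg : Tendsto (fun ε : ℝ => c j - inner ℝ (n j) (normalCoord (n i) (c i - ε * q.1, q.2)))
      (𝓝[>] 0) (𝓝 (c j - inner ℝ (n j) (normalCoord (n i) (c i, q.2)))) :=
    tendsto_const_nhds.sub (tendsto_const_nhds.inner hX)
  split_ifs with h
  · have h1 := hg.pos_mul_atTop (sub_pos.2 h) tendsto_inv_nhdsGT_zero
    refine tendsto_const_nhds.congr' ?_
    filter_upwards [h1.eventually_ge_atTop 1] with ε hε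
    exact (Real.smoothTransition.one_of_one_le (by rwa [div_eq_mul_inv])).symm
  · have h2 : c j - inner ℝ (n j) (normalCoord (n i) (c i, q.2)) < 0 := by
      have := hq j hji
      rw [not_lt] at h
      exact sub_neg.2 (lt_of_le_of_ne h this.symm)
    refine tendsto_const_nhds.congr' ?_
    filter_upwards [hg.eventually_lt_const h2, self_mem_nhdsWithin] with ε hε hpos
    exact (Real.smoothTransition.zero_of_nonpos
      (div_nonpos_of_nonpos_of_nonneg hε.le (le_of_lt hpos))).symm

/-- The boundary layer integrals converge to the integral over the face. -/
theorem tendsto_integral_polyLayer {n : ι → Vec d} (hn : ∀ i, ‖n i‖ = 1)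
    (hinj : Function.Injective n) {c : ι → ℝ} (hne : (polyhedron n c).Nonempty)
    (hb : Bornology.IsBounded (polyhedron n c)) {f : Vec d → ℝ} (hf : Continuous f) (i : ι) :
    Tendsto (fun ε => ∫ q, polyLayer n c f i ε q) (𝓝[>] 0)
      (𝓝 (∫ x in polyFace n c i, f x ∂μHE[d - 1])) := by
  obtain ⟨R, hR⟩ := hb.closure.subset_closedBall 0
  obtain ⟨B, hB⟩ := hb.isCompact_closure.exists_bound_of_continuousOn hf.continuousOn
  obtain ⟨D, hD⟩ := (isCompact_Icc (a := (0 : ℝ)) (b := 1)).exists_bound_of_continuousOn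
    continuous_deriv_smoothTransition.continuousOn
  have hD' : ∀ s, |deriv Real.smoothTransition s| ≤ D := by
    intro s
    by_cases hs : s ∈ Set.Icc (0 : ℝ) 1
    · exact hD s hs
    · rw [deriv_smoothTransition_eq_zero hs, abs_zero]
      exact (norm_nonneg _).trans (hD 0 ⟨le_rfl, zero_le_one⟩)
  have hae := ae_ne_face hn hinj hne i
  have haeq : ∀ᵐ q : ℝ × (ℝ ∙ n i)ᗮ, ∀ j, j ≠ i →
      inner ℝ (n j) (normalCoord (n i) (c i, q.2)) ≠ c j :=
    Measure.quasiMeasurePreserving_snd.ae hae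
  have hlim := tendsto_integral_filter_of_dominated_convergence (l := 𝓝[>] (0 : ℝ))
    (F := fun ε => polyLayer n c f i ε) (μ := volume)
    ((Set.Icc (0 : ℝ) 1 ×ˢ Metric.closedBall (0 : (ℝ ∙ n i)ᗮ) R).indicator (fun _ => D * B))
    (.of_forall fun ε => (continuous_polyLayer n c hf i ε).aestronglyMeasurable)
    (by
      filter_upwards [self_mem_nhdsWithin] with ε hε
      exact .of_forall fun q => abs_polyLayer_le hn hne hR hB hD' i hε q)
    (by
      rw [integrable_indicator_iff (measurableSet_Icc.prod Metric.isClosed_closedBall.measurableSet)]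
      refine integrableOn_const ?_
      rw [Measure.volume_eq_prod, Measure.prod_prod]
      exact (ENNReal.mul_lt_top (by simp) measure_closedBall_lt_top).ne)
    (by
      filter_upwards [haeq] with q hq
      exact tendsto_polyLayer hf i q hq)
  convert hlim using 2
  rw [setIntegral_hyperplane (hn i) (c i) (fun x hx => hx.1)]
  have hsplit := integral_prod_mul (μ := (volume : Measure ℝ)) (ν := (volume : Measure (ℝ ∙ n i)ᗮ))
    (deriv Real.smoothTransition) (fun y => (∏ j ∈ Finset.univ.erase i,
        if inner ℝ (n j) (normalCoord (n i) (c i, y)) < c j then (1 : ℝ) else 0) *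
        f (normalCoord (n i) (c i, y)))
  rw [integral_deriv_smoothTransition, one_mul] at hsplit
  have hre : ∀ q : ℝ × (ℝ ∙ n i)ᗮ, (∏ j ∈ Finset.univ.erase i,
        if inner ℝ (n j) (normalCoord (n i) (c i, q.2)) < c j then (1 : ℝ) else 0) *
        (deriv Real.smoothTransition q.1 * f (normalCoord (n i) (c i, q.2))) =
      deriv Real.smoothTransition q.1 * ((∏ j ∈ Finset.univ.erase i,
        if inner ℝ (n j) (normalCoord (n i) (c i, q.2)) < c j then (1 : ℝ) else 0) *
        f (normalCoord (n i) (c i, q.2))) := fun q => by ring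
  simp_rw [hre]
  rw [Measure.volume_eq_prod, hsplit]
  have hcoord : Measurable (fun y : (ℝ ∙ n i)ᗮ => normalCoord (n i) (c i, y)) :=
    ((continuous_normalCoord _).comp (by fun_prop)).measurable
  have hclosed : IsClosed (polyFace n c i) := by
    simp only [polyFace, Set.ofPred_and, Set.ofPred_forall]
    exact (isClosed_eq (by fun_prop) (by fun_prop)).inter
      (isClosed_iInter fun j => isClosed_le (by fun_prop) (by fun_prop))
  rw [← integral_indicator (hcoord hclosed.measurableSet)]
  refine integral_congr_ae ?_
  filter_upwards [hae] with y hy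
  by_cases hyF : normalCoord (n i) (c i, y) ∈ polyFace n c i
  · rw [Set.indicator_of_mem (by exact hyF), Finset.prod_eq_one, one_mul]
    intro j hj
    rw [if_pos]
    exact lt_of_le_of_ne (hyF.2 j) (hy j (Finset.mem_erase.1 hj).1)
  · rw [Set.indicator_of_notMem (by exact hyF)]
    have : ∃ j, c j < inner ℝ (n j) (normalCoord (n i) (c i, y)) := by
      by_contra hcon
      push Not at hcon
      exact hyF ⟨inner_normalCoord (hn i) _, hcon⟩
    obtain ⟨j, hj⟩ := this
    have hji : j ≠ i := by
      rintro rfl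
      rw [inner_normalCoord (hn j)] at hj
      exact lt_irrefl _ hj
    rw [Finset.prod_eq_zero (Finset.mem_erase.2 ⟨hji, Finset.mem_univ j⟩), zero_mul]
    rw [if_neg (not_lt.2 hj.le)]

/-- Integration by parts against the cutoff moves the derivative onto the factor of one face at a
time; rescaling the normal coordinate by `ε` absorbs the factor `ε⁻¹`. -/
theorem integral_lineDeriv_mul_polyCutoff {n : ι → Vec d} (hn : ∀ i, ‖n i‖ = 1)
    {c : ι → ℝ} (hne : (polyhedron n c).Nonempty) (hb : Bornology.IsBounded (polyhedron n c))
    {C : NNReal} {f : Vec d → ℝ} (hf : LipschitzWith C f) (v : Vec d) {ε : ℝ} (hε : 0 < ε) :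
    ∫ x, lineDeriv ℝ f x v * polyCutoff n c ε x =
      ∑ i, inner ℝ (n i) v * ∫ q, polyLayer n c f i ε q := by
  have hcs := hasCompactSupport_polyCutoff hε hb
  obtain ⟨D, hD⟩ := (contDiff_polyCutoff n c ε).lipschitzWith_of_hasCompactSupport hcs one_ne_zero
  rw [hf.integral_lineDeriv_mul_eq hD hcs]
  simp_rw [lineDeriv_polyCutoff, Finset.sum_mul]
  have hint : ∀ i ∈ (Finset.univ : Finset ι), Integrable (fun x =>
      (∏ j ∈ Finset.univ.erase i, Real.smoothTransition ((c j - inner ℝ (n j) x) / ε)) *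
        (deriv Real.smoothTransition ((c i - inner ℝ (n i) x) / ε) * (-inner ℝ (n i) (-v) / ε)) *
        f x) := by
    intro i _
    refine Continuous.integrable_of_hasCompactSupport ?_ ?_
    · have h2 := continuous_deriv_smoothTransition
      have h3 := Real.smoothTransition.continuous
      refine Continuous.mul (Continuous.mul (continuous_finsetProd _ fun j _ => ?_) ?_)
        hf.continuous
      · exact h3.comp (by fun_prop)
      · exact (h2.comp (by fun_prop)).mul continuous_const
    · refine HasCompactSupport.of_support_subset_isCompact (K := {x | ∀ i, inner ℝ (n i) x ≤ c i})
        ?_ fun x hx j => ?_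
      · rw [← closure_polyhedron hne]
        exact hb.isCompact_closure
      · by_contra hcon
        rw [not_le] at hcon
        refine hx ?_
        have hneg : (c j - inner ℝ (n j) x) / ε < 0 := div_neg_of_neg_of_pos (by linarith) hε
        by_cases hj : j = i
        · subst hj
          simp only
          rw [deriv_smoothTransition_eq_zero (fun h => absurd h.1 (not_le.2 hneg))]
          simp
        · simp only
          rw [Finset.prod_eq_zero (Finset.mem_erase.2 ⟨hj, Finset.mem_univ j⟩)
            (Real.smoothTransition.zero_of_nonpos hneg.le)]
          simp
  rw [integral_finsetSum _ hint]
  refine Finset.sum_congr rfl fun i _ => ?_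
  rw [integral_eq_integral_normalCoord (hn i) (c i) hε, ← integral_const_mul, ← integral_const_mul]
  refine integral_congr_ae (.of_forall fun q => ?_)
  simp only [polyLayer]
  have h6 : (c i - inner ℝ (n i) (normalCoord (n i) (c i - ε * q.1, q.2))) / ε = q.1 := by
    rw [inner_normalCoord (hn i)]
    simp only
    field_simp
    ring
  rw [h6, inner_neg_right]
  field_simp

/-- Integration by parts for Lipschitz functions on a bounded polyhedron. -/
theorem integral_lineDeriv_polyhedron {n : ι → Vec d} (hn : ∀ i, ‖n i‖ = 1)
    (hinj : Function.Injective n) {c : ι → ℝ} (hne : (polyhedron n c).Nonempty)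
    (hb : Bornology.IsBounded (polyhedron n c)) {C : NNReal} {f : Vec d → ℝ}
    (hf : LipschitzWith C f) (v : Vec d) :
    ∫ x in polyhedron n c, lineDeriv ℝ f x v =
      ∑ i, inner ℝ (n i) v * ∫ x in polyFace n c i, f x ∂μHE[d - 1] := by
  have hmeas := (isOpen_polyhedron n c).measurableSet
  have h1 : Tendsto (fun ε => ∫ x, lineDeriv ℝ f x v * polyCutoff n c ε x) (𝓝[>] 0)
      (𝓝 (∫ x, lineDeriv ℝ f x v * (polyhedron n c).indicator 1 x)) := by
    refine tendsto_integral_filter_of_dominated_convergence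
      ((polyhedron n c).indicator fun _ => (C : ℝ) * ‖v‖) (.of_forall fun ε => ?_) ?_ ?_ ?_
    · exact ((measurable_lineDeriv hf.continuous).mul
        (contDiff_polyCutoff n c ε).continuous.measurable).aestronglyMeasurable
    · filter_upwards [self_mem_nhdsWithin] with ε hε
      refine .of_forall fun x => ?_
      by_cases hx : x ∈ polyhedron n c
      · rw [Set.indicator_of_mem hx, norm_mul]
        calc _ ≤ (C * ‖v‖) * 1 := mul_le_mul (norm_lineDeriv_le_of_lipschitz ℝ hf)
              (abs_polyCutoff_le n c ε x) (abs_nonneg _) (by positivity)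
          _ = _ := mul_one _
      · rw [Set.indicator_of_notMem hx, polyCutoff_eq_zero hε hx, mul_zero, norm_zero]
    · rw [integrable_indicator_iff hmeas]
      exact integrableOn_const hb.measure_lt_top.ne
    · exact .of_forall fun x => tendsto_const_nhds.mul (tendsto_polyCutoff x)
  have h2 : Tendsto (fun ε => ∫ x, lineDeriv ℝ f x v * polyCutoff n c ε x) (𝓝[>] 0)
      (𝓝 (∑ i, inner ℝ (n i) v * ∫ x in polyFace n c i, f x ∂μHE[d - 1])) := by
    have h3 : Tendsto (fun ε => ∑ i, inner ℝ (n i) v * ∫ q, polyLayer n c f i ε q) (𝓝[>] 0)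
        (𝓝 (∑ i, inner ℝ (n i) v * ∫ x in polyFace n c i, f x ∂μHE[d - 1])) :=
      tendsto_finsetSum _ fun i _ =>
        (tendsto_integral_polyLayer hn hinj hne hb hf.continuous i).const_mul _
    refine h3.congr' ?_
    filter_upwards [self_mem_nhdsWithin] with ε hε
    exact (integral_lineDeriv_mul_polyCutoff hn hne hb hf v hε).symm
  rw [← tendsto_nhds_unique h1 h2, ← integral_indicator hmeas]
  refine integral_congr_ae (.of_forall fun x => ?_)
  by_cases hx : x ∈ polyhedron n c <;> simp [hx]

end Polyhedron

/-! ### Polytopes are the intersections of their facet half-spaces -/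

section Polytope

variable {d : ℕ} {K : Set (Vec d)}

theorem IsPolytopeCell.isOpen (hK : IsPolytopeCell K) : IsOpen K := by
  obtain ⟨-, s, rfl⟩ := hK
  exact isOpen_interior

theorem IsPolytopeCell.convex (hK : IsPolytopeCell K) : Convex ℝ K := by
  obtain ⟨-, s, rfl⟩ := hK
  exact (convex_convexHull ℝ _).interior

theorem IsPolytopeCell.exists_closure_eq (hK : IsPolytopeCell K) :
    ∃ s : Finset (Vec d), closure K = convexHull ℝ (s : Set (Vec d)) := by
  obtain ⟨hne, s, rfl⟩ := hK
  refine ⟨s, ?_⟩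
  rw [(convex_convexHull ℝ _).closure_interior_eq_closure_of_nonempty_interior hne]
  exact (s.finite_toSet.isCompact_convexHull ℝ).isClosed.closure_eq

theorem IsPolytopeCell.isCompact_closure (hK : IsPolytopeCell K) : IsCompact (closure K) := by
  obtain ⟨s, hs⟩ := hK.exists_closure_eq
  rw [hs]
  exact s.finite_toSet.isCompact_convexHull ℝ

theorem IsPolytopeCell.isBounded (hK : IsPolytopeCell K) : Bornology.IsBounded K :=
  hK.isCompact_closure.isBounded.subset subset_closure

theorem IsPolytopeCell.interior_closure (hK : IsPolytopeCell K) : interior (closure K) = K := by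
  rw [hK.convex.interior_closure_eq_interior_of_nonempty_interior, hK.isOpen.interior_eq]
  rw [hK.isOpen.interior_eq]
  exact hK.1

/-- A nonzero linear functional does not attain its supremum on an open set. -/
theorem inner_lt_of_isOpen_of_forall_le {n : Vec d} (hn : ‖n‖ = 1) (ho : IsOpen K) {c : ℝ}
    (h : ∀ y ∈ K, inner ℝ n y ≤ c) {y : Vec d} (hy : y ∈ K) : inner ℝ n y < c := by
  obtain ⟨r, hr, hball⟩ := Metric.isOpen_iff.1 ho y hy
  have h1 : y + (r / 2) • n ∈ K := by
    refine hball ?_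
    rw [mem_ball_iff_norm, add_sub_cancel_left, norm_smul, hn, mul_one, Real.norm_eq_abs,
      abs_of_pos (by positivity)]
    linarith
  have h2 := h _ h1
  rw [inner_add_right, inner_smul_right, real_inner_self_eq_norm_sq, hn] at h2
  linarith

/-- A facet is the part of the closed cell on a supporting hyperplane. -/
theorem IsFacet.exists_level (hK : IsPolytopeCell K) {n : Vec d} {F : Set (Vec d)}
    (hF : IsFacet K n F) :
    ∃ c : ℝ, (∀ y ∈ K, inner ℝ n y < c) ∧ F = {x ∈ closure K | inner ℝ n x = c} ∧
      F.Nonempty := by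
  obtain ⟨hn, hFe, -⟩ := hF
  obtain ⟨x, hx, hmax⟩ := hK.isCompact_closure.exists_isMaxOn (hK.1.mono subset_closure)
    (f := fun x => inner ℝ n x) (Continuous.continuousOn (by fun_prop))
  have hmax' : ∀ y ∈ closure K, inner ℝ n y ≤ inner ℝ n x := hmax
  refine ⟨inner ℝ n x, fun y hy => inner_lt_of_isOpen_of_forall_le hn hK.isOpen
    (fun z hz => hmax' z (subset_closure hz)) hy, ?_, ?_⟩
  · rw [hFe]
    ext z
    simp only [Set.mem_ofPred_eq]
    refine and_congr_right fun hz => ⟨fun h => le_antisymm (hmax' z hz) ?_, fun h y hy => ?_⟩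
    · have hcl : closure K ⊆ {y | inner ℝ n y ≤ inner ℝ n z} :=
        closure_minimal h (isClosed_le (by fun_prop) (by fun_prop))
      exact hcl hx
    · rw [h]; exact hmax' y (subset_closure hy)
  · rw [hFe]
    exact ⟨x, hx, fun y hy => hmax' y (subset_closure hy)⟩

/-- The outer unit normal is determined by the facet: the vectors orthogonal to the facet form a
line, and outwardness fixes the sign. -/
theorem IsFacet.normal_unique (hK : IsPolytopeCell K) {n m : Vec d} {F : Set (Vec d)}
    (hn : IsFacet K n F) (hm : IsFacet K m F) : n = m := by
  obtain ⟨c, hc, hFc, x, hx⟩ := hn.exists_level hK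
  obtain ⟨c', hc', hFc', -⟩ := hm.exists_level hK
  obtain ⟨y, hy⟩ := hK.1
  have horth : ∀ {k : Vec d} {b : ℝ}, F = {x ∈ closure K | inner ℝ k x = b} →
      k ∈ (vectorSpan ℝ F)ᗮ := by
    intro k b hk
    rw [Submodule.mem_orthogonal']
    intro u hu
    have hle : vectorSpan ℝ F ≤ (ℝ ∙ k)ᗮ := by
      rw [vectorSpan, Submodule.span_le]
      rintro _ ⟨a, ha, a', ha', rfl⟩
      rw [hk] at ha ha'
      simp only [vsub_eq_sub, SetLike.mem_coe, Submodule.mem_orthogonal_singleton_iff_inner_right,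
        inner_sub_right, ha.2, ha'.2, sub_self]
    exact Submodule.mem_orthogonal_singleton_iff_inner_right.1 (hle hu)
  have h1 := horth hFc
  have h2 := horth hFc'
  have hdim : Module.finrank ℝ (vectorSpan ℝ F)ᗮ = 1 := by
    have h := (vectorSpan ℝ F).finrank_add_finrank_orthogonal
    have h' := hn.2.2
    simp at h
    omega
  have hn0 : (⟨n, h1⟩ : (vectorSpan ℝ F)ᗮ) ≠ 0 := by
    intro h
    have : n = 0 := congrArg Subtype.val h
    have h1 := hn.1
    simp [this] at h1
  obtain ⟨a, ha⟩ := (finrank_eq_one_iff_of_nonzero' _ hn0).1 hdim ⟨m, h2⟩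
  have ha' : a • n = m := congrArg Subtype.val ha
  have habs : |a| = 1 := by
    have := hm.1
    rwa [← ha', norm_smul, hn.1, mul_one, Real.norm_eq_abs] at this
  rcases eq_or_eq_neg_of_abs_eq habs with h | h
  · rw [← ha', h, one_smul]
  · exfalso
    have e1 := hc y hy
    have e2 := hc' y hy
    have hx1 := hx
    have hx2 := hx
    rw [hFc] at hx1
    rw [hFc'] at hx2
    rw [← hx1.2] at e1
    rw [← hx2.2, ← ha', h, neg_one_smul, inner_neg_left, inner_neg_left] at e2
    linarith

/-- A point of a convex hull which maximizes a linear functional lies in the convex hull of the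
maximizing generators. -/
theorem mem_convexHull_filter_of_inner_eq {s : Finset (Vec d)} {n z : Vec d} {c : ℝ}
    (hs : ∀ y ∈ s, inner ℝ n y ≤ c) (hz : z ∈ convexHull ℝ (s : Set (Vec d)))
    (hzc : inner ℝ n z = c) :
    z ∈ convexHull ℝ ({y | y ∈ s ∧ inner ℝ n y = c} : Set (Vec d)) := by
  rw [Finset.mem_convexHull'] at hz
  obtain ⟨w, hw0, hw1, hwz⟩ := hz
  have hsum : ∑ y ∈ s, w y * (c - inner ℝ n y) = 0 := by
    have h1 : ∑ y ∈ s, w y * inner ℝ n y = c := by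
      rw [← hzc, ← hwz, inner_sum]
      exact Finset.sum_congr rfl fun y _ => by rw [inner_smul_right]
    simp_rw [mul_sub]
    rw [Finset.sum_sub_distrib, h1, ← Finset.sum_mul, hw1, one_mul, sub_self]
  have hzero := (Finset.sum_eq_zero_iff_of_nonneg fun y hy =>
    mul_nonneg (hw0 y hy) (sub_nonneg.2 (hs y hy))).1 hsum
  classical
  have hset : ({y | y ∈ s ∧ inner ℝ n y = c} : Set (Vec d)) =
      ((s.filter fun y => inner ℝ n y = c : Finset (Vec d)) : Set (Vec d)) := by
    ext y; simp
  have hout : ∀ y ∈ s, y ∉ s.filter (fun y => inner ℝ n y = c) → w y = 0 := by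
    intro y hy hny
    rcases mul_eq_zero.1 (hzero y hy) with h | h
    · exact h
    · exact absurd (Finset.mem_filter.2 ⟨hy, by linarith⟩) hny
  rw [hset, Finset.mem_convexHull']
  refine ⟨w, fun y hy => hw0 y (Finset.mem_filter.1 hy).1, ?_, ?_⟩
  · rw [← hw1]
    exact Finset.sum_subset (Finset.filter_subset _ _) hout
  · rw [← hwz]
    exact Finset.sum_subset (Finset.filter_subset _ _) fun y hy hny => by
      rw [hout y hy hny, zero_smul]

/-- A point beyond a polytope `K` that satisfies all facet inequalities lies, together with a given
interior point, in the affine span of few vertices: the segment between the two leaves `K` through a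
face of dimension less than `d - 1`. -/
theorem mem_affineSpan_of_facet_inequalities (hK : IsPolytopeCell K) {s : Finset (Vec d)}
    (hs : closure K = convexHull ℝ (s : Set (Vec d))) {x₀ y : Vec d} (hx₀ : x₀ ∈ K)
    (hy : y ∉ closure K)
    (hfac : ∀ n F, IsFacet K n F → ∀ c, (∀ x ∈ F, inner ℝ n x = c) → inner ℝ n y < c) :
    ∃ t ∈ s.powerset, Module.finrank ℝ (vectorSpan ℝ (t : Set (Vec d))) + 2 ≤ d ∧
      y ∈ affineSpan ℝ (insert x₀ (t : Set (Vec d))) := by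
  -- the point `z` where the segment from `x₀` to `y` leaves `K`, and a supporting hyperplane there
  have hfr : ∃ z ∈ segment ℝ x₀ y, z ∉ K ∧ z ∈ closure K := by
    by_contra! hcon
    obtain ⟨w, -, hw1, hw2⟩ := (convex_segment x₀ y).isPreconnected K (closure K)ᶜ hK.isOpen
      isClosed_closure.isOpen_compl
      (fun z hz => (em (z ∈ K)).imp id fun h => hcon z hz h)
      ⟨x₀, left_mem_segment ℝ _ _, hx₀⟩ ⟨y, right_mem_segment ℝ _ _, hy⟩
    exact hw2 (subset_closure hw1)
  obtain ⟨z, hzs, hzK, hzcl⟩ := hfr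
  obtain ⟨f, hf⟩ := geometric_hahn_banach_open_point hK.convex hK.isOpen hzK
  set m := (InnerProductSpace.toDual ℝ (Vec d)).symm f with hm
  have hfm : ∀ x, f x = inner ℝ m x := fun x => by
    rw [hm, InnerProductSpace.toDual_symm_apply]
  have hm0 : m ≠ 0 := by
    intro h0
    have := hf x₀ hx₀
    rw [hfm, hfm, h0, inner_zero_left, inner_zero_left] at this
    exact lt_irrefl _ this
  set n : Vec d := ‖m‖⁻¹ • m with hndef
  have hmpos : 0 < ‖m‖ := norm_pos_iff.2 hm0
  have hn : ‖n‖ = 1 := norm_smul_inv_norm hm0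
  have hnK : ∀ a ∈ K, inner ℝ n a < inner ℝ n z := by
    intro a ha
    have := hf a ha
    rw [hfm, hfm] at this
    rw [hndef, real_inner_smul_left, real_inner_smul_left]
    exact mul_lt_mul_of_pos_left this (inv_pos.2 hmpos)
  have hncl : ∀ a ∈ closure K, inner ℝ n a ≤ inner ℝ n z := fun a ha =>
    closure_minimal (fun a ha => (hnK a ha).le)
      (isClosed_le (by fun_prop) (by fun_prop) : IsClosed {a | inner ℝ n a ≤ inner ℝ n z}) ha
  set F : Set (Vec d) := {x ∈ closure K | ∀ y ∈ K, inner ℝ n y ≤ inner ℝ n x} with hF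
  have hFc : ∀ x ∈ F, inner ℝ n x = inner ℝ n z := by
    intro x hx
    refine le_antisymm (hncl x hx.1) ?_
    have hcl : closure K ⊆ {y | inner ℝ n y ≤ inner ℝ n x} :=
      closure_minimal hx.2 (isClosed_le (by fun_prop) (by fun_prop))
    exact hcl hzcl
  obtain ⟨a, b, ha, hb, hab, rfl⟩ := hzs
  have hb0 : b ≠ 0 := by
    rintro rfl
    rw [add_zero] at hab
    subst hab
    simp at hzK
    exact hzK hx₀
  classical
  set t := s.filter fun v => inner ℝ n v = inner ℝ n (a • x₀ + b • y) with ht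
  have hzt : a • x₀ + b • y ∈ convexHull ℝ (t : Set (Vec d)) := by
    have := mem_convexHull_filter_of_inner_eq (s := s) (n := n)
      (fun v hv => hncl v (by rw [hs]; exact subset_convexHull ℝ _ hv)) (hs ▸ hzcl) rfl
    convert this using 2
    ext v; simp [ht]
  have htF : (t : Set (Vec d)) ⊆ F := by
    intro v hv
    have hv' := Finset.mem_filter.1 (Finset.mem_coe.1 hv)
    refine ⟨by rw [hs]; exact subset_convexHull ℝ _ hv'.1, fun w hw => ?_⟩
    rw [hv'.2]
    exact (hnK w hw).le
  -- if the face of that hyperplane were a facet, then `x₀` and `y`, hence `z`, would satisfy its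
  -- inequality strictly
  by_cases hdim : Module.finrank ℝ (vectorSpan ℝ F) + 1 = d
  · exfalso
    have h1 := hfac n F ⟨hn, hF, hdim⟩ _ hFc
    have h2 := hnK x₀ hx₀
    have hb' : 0 < b := lt_of_le_of_ne hb hb0.symm
    have h3 : a * inner ℝ n x₀ + b * inner ℝ n y = inner ℝ n (a • x₀ + b • y) := by
      rw [inner_add_right, inner_smul_right, inner_smul_right]
    generalize inner ℝ n (a • x₀ + b • y) = e at *
    have : a * e + b * e = e := by rw [← add_mul, hab, one_mul]
    nlinarith [mul_lt_mul_of_pos_left h1 hb', mul_le_mul_of_nonneg_left h2.le ha]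
  · refine ⟨t, Finset.mem_powerset.2 (Finset.filter_subset _ _), ?_, ?_⟩
    · have hle : Module.finrank ℝ (vectorSpan ℝ F) ≤ d - 1 := by
        rw [← finrank_orthogonal_span_of_norm_one hn]
        refine Submodule.finrank_mono ?_
        rw [vectorSpan, Submodule.span_le]
        rintro _ ⟨p, hp, q, hq, rfl⟩
        simp only [vsub_eq_sub, SetLike.mem_coe,
          Submodule.mem_orthogonal_singleton_iff_inner_right, inner_sub_right, hFc p hp, hFc q hq,
          sub_self]
      have hd0 : d ≠ 0 := by
        rintro rfl
        have : n = 0 := Subsingleton.elim _ _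
        simp [this] at hn
      have hle2 : Module.finrank ℝ (vectorSpan ℝ (t : Set (Vec d))) ≤
          Module.finrank ℝ (vectorSpan ℝ F) := Submodule.finrank_mono (vectorSpan_mono ℝ htF)
      omega
    · have h1 : x₀ ∈ affineSpan ℝ (insert x₀ (t : Set (Vec d))) :=
        subset_affineSpan ℝ _ (Set.mem_insert _ _)
      have h2 : a • x₀ + b • y ∈ affineSpan ℝ (insert x₀ (t : Set (Vec d))) :=
        affineSpan_mono ℝ (Set.subset_insert _ _) (convexHull_subset_affineSpan _ hzt)
      have h3 := AffineMap.lineMap_mem b⁻¹ h1 h2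
      convert h3 using 1
      rw [AffineMap.lineMap_apply_module']
      have ha' : a = 1 - b := by linarith
      rw [ha', sub_smul, one_smul, add_sub_assoc, smul_add, smul_sub, smul_sub]
      simp only [smul_smul, inv_mul_cancel₀ hb0, one_smul]
      abel_nf

/-- The Minkowski–Weyl theorem for full-dimensional polytopes: a cell is the intersection of the open
half-spaces of its facets. -/
theorem IsPolytopeCell.eq_polyhedron (hK : IsPolytopeCell K) {ι : Type*} [Fintype ι]
    {n : ι → Vec d} {F : ι → Set (Vec d)} (hF : ∀ i, IsFacet K (n i) (F i))
    (hall : ∀ m G, IsFacet K m G → ∃ i, n i = m) :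
    ∃ c : ι → ℝ, K = polyhedron n c ∧ ∀ i, F i = polyFace n c i := by
  choose c hc hFc hFne using fun i => (hF i).exists_level hK
  have hsub : K ⊆ polyhedron n c := fun x hx i => hc i x hx
  have hsup : polyhedron n c ⊆ closure K := by
    by_contra hcon
    rw [Set.not_subset] at hcon
    obtain ⟨y, hy1, hy2⟩ := hcon
    obtain ⟨x₀, hx₀⟩ := hK.1
    obtain ⟨s, hs⟩ := hK.exists_closure_eq
    -- the exceptional set is open, and it is covered by finitely many proper affine subspaces
    have hUo : IsOpen (polyhedron n c ∩ (closure K)ᶜ) :=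
      (isOpen_polyhedron n c).inter isClosed_closure.isOpen_compl
    have hUpos := hUo.measure_pos volume ⟨y, hy1, hy2⟩
    refine hUpos.ne' (measure_mono_null (t := ⋃ t ∈ s.powerset.filter (fun t : Finset (Vec d) =>
      Module.finrank ℝ (vectorSpan ℝ (t : Set (Vec d))) + 2 ≤ d),
        (affineSpan ℝ (insert x₀ (t : Set (Vec d))) : Set (Vec d))) ?_ ?_)
    · intro w hw
      obtain ⟨t, ht, htd, hwt⟩ := mem_affineSpan_of_facet_inequalities hK hs hx₀ hw.2 (by
        intro m G hG b hb
        obtain ⟨i, hi⟩ := hall m G hG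
        have hGF : G = F i := by rw [hG.2.1, (hF i).2.1, hi]
        obtain ⟨x, hx⟩ := hFne i
        have h1 := hb x (hGF ▸ hx)
        rw [hFc i] at hx
        rw [← h1, ← hi, hx.2]
        exact hw.1 i)
      exact Set.mem_biUnion (Finset.mem_filter.2 ⟨ht, htd⟩) hwt
    · refine (measure_biUnion_null_iff (Finset.countable_toSet _)).2 fun t ht => ?_
      refine Measure.addHaar_affineSubspace volume _ fun htop => ?_
      have h1 := finrank_vectorSpan_insert_le_set ℝ (t : Set (Vec d)) x₀
      rw [← direction_affineSpan, htop, AffineSubspace.direction_top, finrank_top] at h1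
      have h2 := (Finset.mem_filter.1 ht).2
      simp at h1
      omega
  have heq : K = polyhedron n c := by
    refine hsub.antisymm ?_
    rw [← hK.interior_closure]
    exact (isOpen_polyhedron n c).subset_interior_iff.2 hsup
  refine ⟨c, heq, fun i => ?_⟩
  rw [hFc i, polyFace, heq, closure_polyhedron (heq ▸ hK.1)]
  ext x
  simp only [Set.mem_ofPred_eq]
  exact and_comm

end Polytope

/-! ### Fields that are Lipschitz up to the boundary of a cell -/

/-- `f` is Lipschitz on the closure of `K`. -/
def LipClosure {d : ℕ} {X : Type*} [PseudoEMetricSpace X] (K : Set (Vec d)) (f : Vec d → X) : Prop :=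
  ∃ C, LipschitzOnWith C f (closure K)

section LipClosure

variable {d : ℕ} {K : Set (Vec d)} {E F G : Type*} [NormedAddCommGroup E]

theorem LipClosure.continuousOn {f : Vec d → E} (hf : LipClosure K f) :
    ContinuousOn f (closure K) := hf.choose_spec.continuousOn

theorem LipschitzWith.lipClosure {C : NNReal} {f : Vec d → E} (hf : LipschitzWith C f) :
    LipClosure K f := ⟨C, hf.lipschitzOnWith⟩

theorem LipClosure.add {f g : Vec d → E} (hf : LipClosure K f) (hg : LipClosure K g) :
    LipClosure K (fun x => f x + g x) := by
  obtain ⟨C, hC⟩ := hf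
  obtain ⟨D, hD⟩ := hg
  exact ⟨C + D, hC.add hD⟩

theorem LipClosure.sub {f g : Vec d → E} (hf : LipClosure K f) (hg : LipClosure K g) :
    LipClosure K (fun x => f x - g x) := by
  obtain ⟨C, hC⟩ := hf
  obtain ⟨D, hD⟩ := hg
  exact ⟨C + D, hC.sub hD⟩

theorem lipClosure_const (e : E) : LipClosure K (fun _ : Vec d => e) :=
  ⟨0, (LipschitzWith.const e).lipschitzOnWith⟩

theorem LipClosure.exists_bound (hK : IsPolytopeCell K) {f : Vec d → E} (hf : LipClosure K f) :
    ∃ C : ℝ, ∀ x ∈ closure K, ‖f x‖ ≤ C :=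
  hK.isCompact_closure.exists_bound_of_continuousOn hf.continuousOn

theorem LipClosure.aestronglyMeasurable (hK : IsPolytopeCell K) {f : Vec d → E}
    (hf : LipClosure K f) : AEStronglyMeasurable f (volume.restrict K) :=
  (hf.continuousOn.mono subset_closure).aestronglyMeasurable hK.isOpen.measurableSet

variable [NormedSpace ℝ E] [NormedAddCommGroup F] [NormedSpace ℝ F] [NormedAddCommGroup G]
  [NormedSpace ℝ G]

theorem ContDiff.lipClosure {f : Vec d → E} (hf : ContDiff ℝ 1 f) (hK : IsPolytopeCell K) :
    LipClosure K f :=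
  hf.locallyLipschitz.locallyLipschitzOn.exists_lipschitzOnWith_of_compact hK.isCompact_closure

theorem LipClosure.clm (L : E →L[ℝ] F) {f : Vec d → E} (hf : LipClosure K f) :
    LipClosure K (fun x => L (f x)) := by
  obtain ⟨C, hC⟩ := hf
  exact ⟨_, L.lipschitz.comp_lipschitzOnWith hC⟩

theorem LipClosure.bilin (hK : IsPolytopeCell K) (B : E →L[ℝ] F →L[ℝ] G) {f : Vec d → E}
    {g : Vec d → F} (hf : LipClosure K f) (hg : LipClosure K g) :
    LipClosure K (fun x => B (f x) (g x)) := by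
  obtain ⟨a, ha⟩ := hK.isCompact_closure.exists_bound_of_continuousOn hf.continuousOn
  obtain ⟨b, hb⟩ := hK.isCompact_closure.exists_bound_of_continuousOn hg.continuousOn
  obtain ⟨C, hC⟩ := hf
  obtain ⟨D, hD⟩ := hg
  refine ⟨Real.toNNReal (‖B‖ * C * b + ‖B‖ * a * D), LipschitzOnWith.of_dist_le_mul
    fun x hx y hy => ?_⟩
  have ha0 : 0 ≤ a := (norm_nonneg _).trans (ha x hx)
  have hb0 : 0 ≤ b := (norm_nonneg _).trans (hb x hx)
  rw [Real.coe_toNNReal _ (by positivity), dist_eq_norm]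
  have h1 : B (f x) (g x) - B (f y) (g y) = B (f x - f y) (g x) + B (f y) (g x - g y) := by
    simp
  have h2 := hC.dist_le_mul x hx y hy
  have h3 := hD.dist_le_mul x hx y hy
  rw [dist_eq_norm] at h2 h3
  rw [h1]
  calc _ ≤ ‖B (f x - f y) (g x)‖ + ‖B (f y) (g x - g y)‖ := norm_add_le _ _
    _ ≤ ‖B‖ * ‖f x - f y‖ * ‖g x‖ + ‖B‖ * ‖f y‖ * ‖g x - g y‖ :=
        add_le_add (B.le_opNorm₂ _ _) (B.le_opNorm₂ _ _)
    _ ≤ ‖B‖ * (C * dist x y) * b + ‖B‖ * a * (D * dist x y) := by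
        gcongr
        · exact hb x hx
        · exact ha y hy
    _ = _ := by ring

theorem LipClosure.smul (hK : IsPolytopeCell K) {f : Vec d → ℝ} {g : Vec d → E}
    (hf : LipClosure K f) (hg : LipClosure K g) : LipClosure K (fun x => f x • g x) :=
  LipClosure.bilin hK (ContinuousLinearMap.lsmul ℝ ℝ) hf hg

theorem LipClosure.inner (hK : IsPolytopeCell K) {f g : Vec d → Vec d}
    (hf : LipClosure K f) (hg : LipClosure K g) : LipClosure K (fun x => inner ℝ (f x) (g x)) :=
  LipClosure.bilin hK (innerSL ℝ) hf hg

theorem LipClosure.ae_differentiableAt [FiniteDimensional ℝ E] (hKo : IsOpen K) {f : Vec d → E}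
    (hf : LipClosure K f) : ∀ᵐ x ∂(volume.restrict K), DifferentiableAt ℝ f x := by
  obtain ⟨C, hC⟩ := hf
  filter_upwards [(hC.mono subset_closure).ae_differentiableWithinAt hKo.measurableSet,
    ae_restrict_mem hKo.measurableSet] with x hx hxK
  exact hx.differentiableAt (hKo.mem_nhds hxK)

theorem LipClosure.exists_fderiv_bound (hKo : IsOpen K) {f : Vec d → E}
    (hf : LipClosure K f) : ∃ C : ℝ, ∀ x ∈ K, ‖fderiv ℝ f x‖ ≤ C := by
  obtain ⟨C, hC⟩ := hf
  exact ⟨C, fun x hx => norm_fderiv_le_of_lipschitzOn ℝ (hKo.mem_nhds hx) (hC.mono subset_closure)⟩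

end LipClosure

/-- The pointwise divergence of a field, from its Fréchet derivative. -/
def pointDiv {d : ℕ} (V : Vec d → Vec d) (x : Vec d) : ℝ :=
  ∑ i, (fderiv ℝ V x (EuclideanSpace.single i 1)) i

theorem measurable_pointDiv {d : ℕ} (V : Vec d → Vec d) : Measurable (pointDiv V) := by
  unfold pointDiv
  refine Finset.measurable_sum _ fun i _ => ?_
  exact (EuclideanSpace.proj i : Vec d →L[ℝ] ℝ).continuous.measurable.comp
    (measurable_fderiv_apply_const ℝ V _)

theorem sum_apply_single {d : ℕ} {E : Type*} [NormedAddCommGroup E] [NormedSpace ℝ E]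
    (L : Vec d →L[ℝ] E) (v : Vec d) : ∑ i, v i • L (EuclideanSpace.single i 1) = L v := by
  have h := (EuclideanSpace.basisFun (Fin d) ℝ).sum_repr v
  conv_rhs => rw [← h, map_sum]
  exact Finset.sum_congr rfl fun i _ => by simp

theorem inner_eq_sum_coord {d : ℕ} (v w : Vec d) : inner ℝ v w = ∑ i, v i * w i := by
  rw [PiLp.inner_apply]
  exact Finset.sum_congr rfl fun i _ => by simp [mul_comm]

theorem pointDiv_smul {d : ℕ} {f : Vec d → ℝ} {V : Vec d → Vec d} {x : Vec d}
    (hf : DifferentiableAt ℝ f x) (hV : DifferentiableAt ℝ V x) :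
    pointDiv (fun y => f y • V y) x = f x * pointDiv V x + fderiv ℝ f x (V x) := by
  unfold pointDiv
  rw [fderiv_fun_smul hf hV, Finset.mul_sum, ← sum_apply_single (fderiv ℝ f x) (V x),
    ← Finset.sum_add_distrib]
  exact Finset.sum_congr rfl fun i _ => by simp [mul_comm]

/-! ### Facets of mesh cells and Green's formula -/

section Mesh

variable {d : ℕ} {Ω : Set (Vec d)} (M : Mesh Ω)

open Classical in
/-- The facets of the element `K`. -/
def Mesh.facets (K : Set (Vec d)) : Finset (Set (Vec d)) :=
  (M.intFacets ∪ M.bdFacets).filter fun F => K = M.plus F ∨ (F ∈ M.intFacets ∧ K = M.minus F)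

open Classical in
/-- The unit normal of the facet `F` pointing out of the element `K`. -/
def Mesh.outer (K F : Set (Vec d)) : Vec d :=
  if F ∈ M.intFacets ∧ K = M.minus F then -M.normal F else M.normal F

variable {M}

theorem Mesh.isFacet_outer {K F : Set (Vec d)} (hF : F ∈ M.facets K) :
    IsFacet K (M.outer K F) F := by
  classical
  obtain ⟨h1, h2⟩ := Finset.mem_filter.1 hF
  unfold Mesh.outer
  split_ifs with h
  · rw [h.2]
    exact (M.int_facet F h.1).2.2.2.2
  · have hK : K = M.plus F := h2.resolve_right h
    rcases Finset.mem_union.1 h1 with h3 | h3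
    · rw [hK]; exact (M.int_facet F h3).2.2.2.1
    · rw [hK]; exact (M.bd_facet F h3).2.1

theorem Mesh.mem_facets_of_isFacet {K F : Set (Vec d)} (hK : K ∈ M.elems) {n : Vec d}
    (hF : IsFacet K n F) : F ∈ M.facets K := by
  classical
  refine Finset.mem_filter.2 ⟨?_, ?_⟩
  · rcases M.complete K hK n F hF with h | h
    · exact Finset.mem_union_left _ h.1
    · exact Finset.mem_union_right _ h.1
  · rcases M.complete K hK n F hF with h | h
    · exact h.2.imp id fun h' => ⟨h.1, h'⟩
    · exact Or.inl h.2

theorem Mesh.outer_eq_of_isFacet {K F : Set (Vec d)} (hK : K ∈ M.elems) {n : Vec d}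
    (hF : IsFacet K n F) : M.outer K F = n :=
  IsFacet.normal_unique (M.cell K hK) (M.isFacet_outer (M.mem_facets_of_isFacet hK hF)) hF

theorem Mesh.exists_polyhedron {K : Set (Vec d)} (hK : K ∈ M.elems) :
    ∃ c : M.facets K → ℝ, K = polyhedron (fun F : M.facets K => M.outer K F) c ∧
      ∀ F : M.facets K, (F : Set (Vec d)) = polyFace (fun F : M.facets K => M.outer K F) c F :=
  (M.cell K hK).eq_polyhedron (F := fun F : M.facets K => (F : Set (Vec d)))
    (fun F => M.isFacet_outer F.2)
    fun _ G hG => ⟨⟨G, M.mem_facets_of_isFacet hK hG⟩, M.outer_eq_of_isFacet hK hG⟩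

theorem Mesh.outer_injective {K : Set (Vec d)} :
    Function.Injective (fun F : M.facets K => M.outer K F) := by
  intro F G h
  have h1 := (M.isFacet_outer F.2).2.1
  have h2 := (M.isFacet_outer G.2).2.1
  have h' : M.outer K F = M.outer K G := h
  ext1
  rw [h1, h2, h']

theorem Mesh.facet_subset {K F : Set (Vec d)} (hF : F ∈ M.facets K) : F ⊆ closure K := by
  rw [(M.isFacet_outer hF).2.1]
  exact fun x hx => hx.1

theorem IsFacet.isCompact {K F : Set (Vec d)} (hK : IsPolytopeCell K) {n : Vec d}
    (hF : IsFacet K n F) : IsCompact F := by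
  obtain ⟨c, -, hFc, -⟩ := hF.exists_level hK
  rw [hFc]
  exact hK.isCompact_closure.inter_right (isClosed_eq (by fun_prop) (by fun_prop))

theorem IsFacet.measure_lt_top {K F : Set (Vec d)} (hK : IsPolytopeCell K) {n : Vec d}
    (hF : IsFacet K n F) : (μHE[d - 1] : Measure (Vec d)) F < ⊤ := by
  obtain ⟨c, -, hFc, -⟩ := hF.exists_level hK
  exact measure_hyperplane_lt_top hF.1 c (fun x hx => by rw [hFc] at hx; exact hx.2)
    (hF.isCompact hK).isBounded

theorem IsFacet.integrableOn {K F : Set (Vec d)} (hK : IsPolytopeCell K) {n : Vec d}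
    (hF : IsFacet K n F) {E : Type*} [NormedAddCommGroup E] {f : Vec d → E}
    (hf : ContinuousOn f F) : IntegrableOn f F μHE[d - 1] :=
  hf.integrableOn_of_subset_isCompact (hF.isCompact hK) (hF.isCompact hK).measurableSet
    subset_rfl (hF.measure_lt_top hK).ne

theorem Mesh.integral_lineDeriv {K : Set (Vec d)} (hK : K ∈ M.elems) {f : Vec d → ℝ}
    (hf : LipClosure K f) (v : Vec d) :
    ∫ x in K, lineDeriv ℝ f x v =
      ∑ F ∈ M.facets K, inner ℝ (M.outer K F) v * ∫ x in F, f x ∂μHE[d - 1] := by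
  classical
  obtain ⟨C, hC⟩ := hf
  obtain ⟨g, hg, hfg⟩ := hC.extend_real
  obtain ⟨c, hc, hFc⟩ := M.exists_polyhedron hK
  have hcell := M.cell K hK
  have h1 := integral_lineDeriv_polyhedron (n := fun F : M.facets K => M.outer K F)
    (fun F => (M.isFacet_outer F.2).1) M.outer_injective (hc ▸ hcell.1) (hc ▸ hcell.isBounded) hg v
  rw [← hc] at h1
  rw [← Finset.sum_coe_sort (M.facets K)]
  have h2 : ∫ x in K, lineDeriv ℝ f x v = ∫ x in K, lineDeriv ℝ g x v := by
    refine setIntegral_congr_fun hcell.isOpen.measurableSet fun x hx => ?_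
    refine Filter.EventuallyEq.lineDeriv_eq ?_
    filter_upwards [hcell.isOpen.mem_nhds hx] with y hy using hfg (subset_closure hy)
  rw [h2, h1]
  refine Finset.sum_congr rfl fun F _ => ?_
  rw [← hFc F]
  congr 1
  exact (setIntegral_congr_fun ((M.isFacet_outer F.2).isCompact hcell).measurableSet
    fun x hx => (hfg (M.facet_subset F.2 hx)).symm)

theorem LipClosure.integrableOn_pointDiv {K : Set (Vec d)} (hK : IsPolytopeCell K)
    {V : Vec d → Vec d} (hV : LipClosure K V) : IntegrableOn (pointDiv V) K := by
  obtain ⟨C, hC⟩ := hV.exists_fderiv_bound hK.isOpen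
  refine IntegrableOn.of_bound hK.isBounded.measure_lt_top
    (measurable_pointDiv V).aestronglyMeasurable (∑ i : Fin d, C) ?_
  filter_upwards [ae_restrict_mem hK.isOpen.measurableSet] with x hx
  unfold pointDiv
  refine (norm_sum_le _ _).trans (Finset.sum_le_sum fun i _ => ?_)
  refine (PiLp.norm_apply_le _ i).trans ?_
  refine ((fderiv ℝ V x).le_opNorm _).trans ?_
  simpa using hC x hx

/-- The divergence theorem on an element, for fields that are Lipschitz up to the boundary. -/
theorem Mesh.integral_pointDiv {K : Set (Vec d)} (hK : K ∈ M.elems) {V : Vec d → Vec d}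
    (hV : LipClosure K V) :
    ∫ x in K, pointDiv V x =
      ∑ F ∈ M.facets K, ∫ x in F, inner ℝ (V x) (M.outer K F) ∂μHE[d - 1] := by
  have hcell := M.cell K hK
  have hVi : ∀ i, LipClosure K (fun x => V x i) := fun i =>
    hV.clm (EuclideanSpace.proj i : Vec d →L[ℝ] ℝ)
  have hline : ∀ᵐ x ∂(volume.restrict K), ∀ i, lineDeriv ℝ (fun x => V x i) x
      (EuclideanSpace.single i 1) = (fderiv ℝ V x (EuclideanSpace.single i 1)) i := by
    filter_upwards [hV.ae_differentiableAt hcell.isOpen] with x hx i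
    have h1 := ((EuclideanSpace.proj i : Vec d →L[ℝ] ℝ).hasFDerivAt.comp x
      hx.hasFDerivAt)
    exact (h1.hasLineDerivAt (EuclideanSpace.single i 1)).lineDeriv
  have hint : ∀ i ∈ (Finset.univ : Finset (Fin d)),
      IntegrableOn (fun x => (fderiv ℝ V x (EuclideanSpace.single i 1)) i) K := by
    intro i _
    obtain ⟨C, hC⟩ := hV.exists_fderiv_bound hcell.isOpen
    refine IntegrableOn.of_bound hcell.isBounded.measure_lt_top
      ((EuclideanSpace.proj i : Vec d →L[ℝ] ℝ).continuous.measurable.comp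
        (measurable_fderiv_apply_const ℝ V _)).aestronglyMeasurable C ?_
    filter_upwards [ae_restrict_mem hcell.isOpen.measurableSet] with x hx
    refine (PiLp.norm_apply_le _ i).trans ?_
    refine ((fderiv ℝ V x).le_opNorm _).trans ?_
    simpa using hC x hx
  have h1 : ∫ x in K, pointDiv V x =
      ∑ i, ∫ x in K, lineDeriv ℝ (fun x => V x i) x (EuclideanSpace.single i 1) := by
    unfold pointDiv
    rw [integral_finsetSum _ hint]
    refine Finset.sum_congr rfl fun i _ => integral_congr_ae ?_
    filter_upwards [hline] with x hx using (hx i).symm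
  rw [h1]
  simp_rw [M.integral_lineDeriv hK (hVi _)]
  rw [Finset.sum_comm]
  refine Finset.sum_congr rfl fun F hF => ?_
  have hFI : ∀ i ∈ (Finset.univ : Finset (Fin d)),
      IntegrableOn (fun x => V x i * M.outer K F i) F μHE[d - 1] := fun i _ =>
    (M.isFacet_outer hF).integrableOn hcell
      (((hVi i).continuousOn.mono (M.facet_subset hF)).mul continuousOn_const)
  simp_rw [inner_eq_sum_coord (V _)]
  rw [integral_finsetSum _ hFI]
  refine Finset.sum_congr rfl fun i _ => ?_
  rw [integral_mul_const, mul_comm]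
  congr 1
  simp [EuclideanSpace.inner_single_right]

end Mesh

/-! ### Weak derivatives -/

section WeakDerivatives

variable {d : ℕ} {U : Set (Vec d)}

theorem integrable_smul_of_locallyIntegrableOn {E : Type*} [NormedAddCommGroup E]
    [NormedSpace ℝ E] {f : Vec d → E} (hf : LocallyIntegrableOn f U) {φ : Vec d → ℝ}
    (hφ : Continuous φ) (hc : HasCompactSupport φ) (ht : tsupport φ ⊆ U) :
    Integrable (fun x => φ x • f x) := by
  have h1 := (hf.integrableOn_compact_subset ht hc).continuousOn_smul hφ.continuousOn hc
  refine (integrableOn_iff_integrable_of_support_subset fun x hx => ?_).1 h1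
  refine subset_tsupport φ fun h0 => hx ?_
  simp only [h0, zero_smul]

theorem setIntegral_smul_eq_integral {E : Type*} [NormedAddCommGroup E]
    [NormedSpace ℝ E] (f : Vec d → E) {φ : Vec d → ℝ} (ht : tsupport φ ⊆ U) :
    ∫ x in U, φ x • f x = ∫ x, φ x • f x := by
  refine setIntegral_eq_integral_of_forall_compl_eq_zero fun x hx => ?_
  rw [image_eq_zero_of_notMem_tsupport fun h => hx (ht h), zero_smul]

theorem ae_eq_of_forall_integral_smul_eq {E : Type*} [NormedAddCommGroup E]
    [NormedSpace ℝ E] [CompleteSpace E] (hU : IsOpen U) {f g : Vec d → E}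
    (hf : LocallyIntegrableOn f U) (hg : LocallyIntegrableOn g U)
    (h : ∀ φ : Vec d → ℝ, ContDiff ℝ ∞ φ → HasCompactSupport φ → tsupport φ ⊆ U →
      ∫ x in U, φ x • f x = ∫ x in U, φ x • g x) :
    f =ᵐ[volume.restrict U] g := by
  rw [Filter.EventuallyEq, ae_restrict_iff' hU.measurableSet]
  filter_upwards [hU.ae_eq_zero_of_integral_contDiff_smul_eq_zero (f := fun x => f x - g x)
    (hf.sub hg) (fun φ h1 h2 h3 => by
      simp_rw [smul_sub]
      rw [integral_sub (integrable_smul_of_locallyIntegrableOn hf h1.continuous h2 h3)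
        (integrable_smul_of_locallyIntegrableOn hg h1.continuous h2 h3), sub_eq_zero,
        ← setIntegral_smul_eq_integral f h3, ← setIntegral_smul_eq_integral g h3]
      exact h φ h1 h2 h3)] with x hx hxU
  exact sub_eq_zero.1 (hx hxU)

theorem locallyIntegrableOn_clm_apply {G : Vec d → Vec d →L[ℝ] Vec d}
    (hG : LocallyIntegrableOn G U) (a : Vec d) : LocallyIntegrableOn (fun x => G x a) U :=
  (ContinuousLinearMap.apply ℝ (Vec d) a).locallyIntegrableOn_comp hG

theorem HasWeakGrad.ae_unique (hU : IsOpen U) {w : Vec d → Vec d}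
    {G H : Vec d → Vec d →L[ℝ] Vec d} (hG : HasWeakGrad U w G) (hH : HasWeakGrad U w H) :
    G =ᵐ[volume.restrict U] H := by
  have h : ∀ i : Fin d, (fun x => G x (EuclideanSpace.single i 1)) =ᵐ[volume.restrict U]
      fun x => H x (EuclideanSpace.single i 1) := fun i =>
    ae_eq_of_forall_integral_smul_eq hU (locallyIntegrableOn_clm_apply hG.2.1 _) (locallyIntegrableOn_clm_apply hH.2.1 _)
      fun φ h1 h2 h3 => neg_injective
        ((hG.2.2 φ h1 h2 h3 _).symm.trans (hH.2.2 φ h1 h2 h3 _))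
  have h' : ∀ᵐ x ∂(volume.restrict U), ∀ i : Fin d,
      G x (EuclideanSpace.single i 1) = H x (EuclideanSpace.single i 1) := ae_all_iff.2 h
  filter_upwards [h'] with x hx
  ext1 v
  rw [← sum_apply_single (G x) v, ← sum_apply_single (H x) v]
  exact Finset.sum_congr rfl fun i _ => by rw [hx i]

theorem HasWeakDiv.ae_unique (hU : IsOpen U) {w : Vec d → Vec d} {g h : Vec d → ℝ}
    (hg : HasWeakDiv U w g) (hh : HasWeakDiv U w h) : g =ᵐ[volume.restrict U] h :=
  ae_eq_of_forall_integral_smul_eq hU hg.2.1 hh.2.1 fun φ h1 h2 h3 => neg_injective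
    ((hg.2.2 φ h1 h2 h3).symm.trans (hh.2.2 φ h1 h2 h3))

theorem HasWeakGrad.weakGrad_ae_eq (hU : IsOpen U) {w : Vec d → Vec d}
    {G : Vec d → Vec d →L[ℝ] Vec d} (hG : HasWeakGrad U w G) :
    weakGrad U w =ᵐ[volume.restrict U] G := by
  have h : ∃ G, HasWeakGrad U w G := ⟨G, hG⟩
  rw [weakGrad, dif_pos h]
  exact HasWeakGrad.ae_unique hU h.choose_spec hG

theorem HasWeakDiv.weakDiv_ae_eq (hU : IsOpen U) {w : Vec d → Vec d} {g : Vec d → ℝ}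
    (hg : HasWeakDiv U w g) : weakDiv U w =ᵐ[volume.restrict U] g := by
  have h : ∃ g, HasWeakDiv U w g := ⟨g, hg⟩
  rw [weakDiv, dif_pos h]
  exact HasWeakDiv.ae_unique hU h.choose_spec hg

theorem HasWeakGrad.mono {w : Vec d → Vec d} {G : Vec d → Vec d →L[ℝ] Vec d}
    (hG : HasWeakGrad U w G) {V : Set (Vec d)} (hVU : V ⊆ U) : HasWeakGrad V w G := by
  refine ⟨hG.1.mono_set hVU, hG.2.1.mono_set hVU, fun φ h1 h2 h3 a => ?_⟩
  have h4 : tsupport (fun x => fderiv ℝ φ x a) ⊆ V := (tsupport_fderiv_apply_subset ℝ a).trans h3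
  have := hG.2.2 φ h1 h2 (h3.trans hVU) a
  rwa [setIntegral_smul_eq_integral _ (h4.trans hVU), setIntegral_smul_eq_integral _
    (h3.trans hVU), ← setIntegral_smul_eq_integral _ h4, ← setIntegral_smul_eq_integral _ h3]
    at this

theorem HasWeakDiv.mono {w : Vec d → Vec d} {g : Vec d → ℝ}
    (hg : HasWeakDiv U w g) {V : Set (Vec d)} (hVU : V ⊆ U) : HasWeakDiv V w g := by
  refine ⟨hg.1.mono_set hVU, hg.2.1.mono_set hVU, fun φ h1 h2 h3 => ?_⟩
  have h4 : ∀ {W : Set (Vec d)}, tsupport φ ⊆ W →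
      ∫ x in W, fderiv ℝ φ x (w x) = ∫ x, fderiv ℝ φ x (w x) := fun {W} hW => by
    refine setIntegral_eq_integral_of_forall_compl_eq_zero fun x hx => ?_
    rw [fderiv_of_notMem_tsupport ℝ fun h => hx (hW h)]
    rfl
  have := hg.2.2 φ h1 h2 (h3.trans hVU)
  have h5 : ∫ x in U, φ x * g x = ∫ x in V, φ x * g x :=
    (setIntegral_smul_eq_integral g (h3.trans hVU)).trans (setIntegral_smul_eq_integral g h3).symm
  rwa [h4 (h3.trans hVU), h5, ← h4 h3] at this

variable (d) in
/-- The trace of an endomorphism of `ℝ^d`, as a continuous linear functional. -/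
def traceCLM : (Vec d →L[ℝ] Vec d) →L[ℝ] ℝ :=
  ∑ i : Fin d, (EuclideanSpace.proj i : Vec d →L[ℝ] ℝ).comp
    (ContinuousLinearMap.apply ℝ (Vec d) (EuclideanSpace.single i 1))

theorem traceCLM_apply (A : Vec d →L[ℝ] Vec d) :
    traceCLM d A = ∑ i, (A (EuclideanSpace.single i 1)) i := by
  simp [traceCLM]

theorem pointDiv_eq_traceCLM (V : Vec d → Vec d) (x : Vec d) :
    pointDiv V x = traceCLM d (fderiv ℝ V x) := (traceCLM_apply _).symm

/-- If the integration by parts formula defining a weak gradient holds for a test function, so does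
the one for the divergence. -/
theorem integral_fderiv_apply_eq_of_integral_smul_eq {w : Vec d → Vec d}
    {G : Vec d → Vec d →L[ℝ] Vec d} {φ : Vec d → ℝ} (μ : Measure (Vec d))
    (h1 : ∀ a, Integrable (fun x => (fderiv ℝ φ x a) • w x) μ)
    (h2 : ∀ a, Integrable (fun x => φ x • G x a) μ)
    (h : ∀ a, ∫ x, (fderiv ℝ φ x a) • w x ∂μ = -∫ x, φ x • G x a ∂μ) :
    ∫ x, fderiv ℝ φ x (w x) ∂μ = -∫ x, φ x * traceCLM d (G x) ∂μ := by
  have e1 : ∀ x, fderiv ℝ φ x (w x) =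
      ∑ i, (EuclideanSpace.proj i : Vec d →L[ℝ] ℝ)
        (fderiv ℝ φ x (EuclideanSpace.single i 1) • w x) := by
    intro x
    rw [← sum_apply_single (fderiv ℝ φ x) (w x)]
    exact Finset.sum_congr rfl fun i _ => by simp [mul_comm]
  have e2 : ∀ x, φ x * traceCLM d (G x) =
      ∑ i, (EuclideanSpace.proj i : Vec d →L[ℝ] ℝ) (φ x • G x (EuclideanSpace.single i 1)) := by
    intro x
    rw [traceCLM_apply, Finset.mul_sum]
    exact Finset.sum_congr rfl fun i _ => by simp
  simp_rw [e1, e2]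
  rw [integral_finsetSum _ fun i _ => ContinuousLinearMap.integrable_comp _ (h1 _),
    integral_finsetSum _ fun i _ => ContinuousLinearMap.integrable_comp _ (h2 _),
    ← Finset.sum_neg_distrib]
  refine Finset.sum_congr rfl fun i _ => ?_
  rw [ContinuousLinearMap.integral_comp_comm _ (h1 _),
    ContinuousLinearMap.integral_comp_comm _ (h2 _), h, map_neg]

theorem HasWeakGrad.hasWeakDiv {w : Vec d → Vec d} {G : Vec d → Vec d →L[ℝ] Vec d}
    (hG : HasWeakGrad U w G) : HasWeakDiv U w (fun x => traceCLM d (G x)) := by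
  refine ⟨hG.1, (traceCLM d).locallyIntegrableOn_comp hG.2.1, fun φ h1 h2 h3 => ?_⟩
  refine integral_fderiv_apply_eq_of_integral_smul_eq _ (fun a => ?_) (fun a => ?_)
    (hG.2.2 φ h1 h2 h3)
  · refine (integrable_smul_of_locallyIntegrableOn hG.1 ?_ (h2.fderiv_apply (𝕜 := ℝ) a)
      ((tsupport_fderiv_apply_subset ℝ a).trans h3)).integrableOn
    exact (h1.continuous_fderiv (by simp)).clm_apply continuous_const
  · exact (integrable_smul_of_locallyIntegrableOn (locallyIntegrableOn_clm_apply hG.2.1 a) h1.continuous h2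
      h3).integrableOn

theorem integral_fderiv_smul_of_lipschitzWith {C : NNReal} {g : Vec d → Vec d}
    (hg : LipschitzWith C g) {φ : Vec d → ℝ} (h1 : ContDiff ℝ 1 φ) (h2 : HasCompactSupport φ)
    (a : Vec d) : ∫ x, (fderiv ℝ φ x a) • g x = -∫ x, φ x • fderiv ℝ g x a := by
  obtain ⟨D, hD⟩ := h1.lipschitzWith_of_hasCompactSupport h2 one_ne_zero
  have hi1 : Integrable fun x => (fderiv ℝ φ x a) • g x := by
    refine Continuous.integrable_of_hasCompactSupport ?_ ?_
    · exact ((h1.continuous_fderiv one_ne_zero).clm_apply continuous_const).smul hg.continuous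
    · exact (h2.fderiv_apply (𝕜 := ℝ) a).smul_right
  have hi2 : Integrable fun x => φ x • fderiv ℝ g x a := by
    refine (h1.continuous.integrable_of_hasCompactSupport h2).smul_bdd (C * ‖a‖)
      (measurable_fderiv_apply_const ℝ g a).aestronglyMeasurable (.of_forall fun x => ?_)
    exact ((fderiv ℝ g x).le_opNorm a).trans
      (mul_le_mul_of_nonneg_right (norm_fderiv_le_of_lipschitz ℝ hg) (norm_nonneg _))
  ext i
  have hgi : LipschitzWith (‖(EuclideanSpace.proj i : Vec d →L[ℝ] ℝ)‖₊ * C) fun x => g x i :=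
    (EuclideanSpace.proj i : Vec d →L[ℝ] ℝ).lipschitz.comp hg
  have h3 := hgi.integral_lineDeriv_mul_eq (μ := volume) hD h2 a
  have e1 : (∫ x, (fderiv ℝ φ x a) • g x) i = ∫ x, fderiv ℝ φ x a * g x i :=
    ((EuclideanSpace.proj i : Vec d →L[ℝ] ℝ).integral_comp_comm hi1).symm
  have e2 : (∫ x, φ x • fderiv ℝ g x a) i = ∫ x, φ x * (fderiv ℝ g x a) i :=
    ((EuclideanSpace.proj i : Vec d →L[ℝ] ℝ).integral_comp_comm hi2).symm
  rw [PiLp.neg_apply, e1, e2]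
  have e3 : ∫ x, lineDeriv ℝ (fun x => g x i) x a * φ x = ∫ x, φ x * (fderiv ℝ g x a) i := by
    refine integral_congr_ae ?_
    filter_upwards [hg.ae_differentiableAt] with x hx
    have h4 := ((EuclideanSpace.proj i : Vec d →L[ℝ] ℝ).hasFDerivAt.comp x hx.hasFDerivAt)
    have h5 : lineDeriv ℝ (fun x => g x i) x a = (fderiv ℝ g x a) i :=
      (h4.hasLineDerivAt a).lineDeriv
    rw [h5, mul_comm]
  have e4 : ∫ x, lineDeriv ℝ φ x (-a) * g x i = -∫ x, fderiv ℝ φ x a * g x i := by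
    rw [← integral_neg]
    refine integral_congr_ae (.of_forall fun x => ?_)
    simp only
    rw [((h1.differentiable one_ne_zero x).hasFDerivAt.hasLineDerivAt (-a)).lineDeriv]
    simp
  rw [← e3, h3, e4, neg_neg]

/-- The weak gradient of a Lipschitz field is its derivative almost everywhere. -/
theorem LipschitzWith.hasWeakGrad {C : NNReal} {g w : Vec d → Vec d}
    (hg : LipschitzWith C g) (hw : w =ᵐ[volume.restrict U] g) :
    HasWeakGrad U w (fderiv ℝ g) := by
  refine ⟨(hg.continuous.locallyIntegrable.locallyIntegrableOn U).congr hw.symm, ?_, ?_⟩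
  · refine LocallyIntegrable.locallyIntegrableOn ?_ U
    exact (memLp_top_of_bound (measurable_fderiv ℝ g).aestronglyMeasurable C
      (.of_forall fun x => norm_fderiv_le_of_lipschitz ℝ hg)).locallyIntegrable le_top
  · intro φ h1 h2 h3 a
    have e : ∫ x in U, (fderiv ℝ φ x a) • w x = ∫ x in U, (fderiv ℝ φ x a) • g x :=
      integral_congr_ae (by filter_upwards [hw] with x hx; rw [hx])
    rw [e, setIntegral_smul_eq_integral _ ((tsupport_fderiv_apply_subset ℝ a).trans h3),
      setIntegral_smul_eq_integral _ h3]
    exact integral_fderiv_smul_of_lipschitzWith hg (h1.of_le (by simp)) h2 a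

theorem LipClosure.hasWeakGrad (hU : IsOpen U) {g w : Vec d → Vec d}
    (hg : LipClosure U g) (hw : w =ᵐ[volume.restrict U] g) : HasWeakGrad U w (fderiv ℝ g) := by
  obtain ⟨C, hC⟩ := hg
  obtain ⟨f, hf, hgf⟩ := hC.extend_finite_dimension
  have hwf : w =ᵐ[volume.restrict U] f := by
    filter_upwards [hw, ae_restrict_mem hU.measurableSet] with x hx hxU
    rw [hx, hgf (subset_closure hxU)]
  have hfd : fderiv ℝ f =ᵐ[volume.restrict U] fderiv ℝ g := by
    filter_upwards [ae_restrict_mem hU.measurableSet] with x hxU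
    refine Filter.EventuallyEq.fderiv_eq ?_
    filter_upwards [hU.mem_nhds hxU] with y hy using (hgf (subset_closure hy)).symm
  obtain ⟨h1, h2, h3⟩ := hf.hasWeakGrad hwf
  refine ⟨h1, h2.congr hfd, fun φ p1 p2 p3 a => ?_⟩
  rw [h3 φ p1 p2 p3 a]
  congr 1
  exact integral_congr_ae (by filter_upwards [hfd] with x hx; rw [hx])

/-! ### Fields in `H¹₀` and in `W^{1,∞}` -/

theorem integrable_smul_of_memLp_two {E : Type*} [NormedAddCommGroup E] [NormedSpace ℝ E]
    {μ : Measure (Vec d)} [IsFiniteMeasureOnCompacts μ] {φ : Vec d → ℝ} (hφ : Continuous φ)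
    (hc : HasCompactSupport φ) {f : Vec d → E} (hf : MemLp f 2 μ) :
    Integrable (fun x => φ x • f x) μ :=
  memLp_one_iff_integrable.1 (hf.smul (r := 1) (hφ.memLp_of_hasCompactSupport (p := 2) hc))

/-- Pairing with a fixed test function is continuous along `L²`-convergent sequences. -/
theorem tendsto_integral_smul_of_tendsto_eLpNorm {E : Type*} [NormedAddCommGroup E]
    [NormedSpace ℝ E] {μ : Measure (Vec d)} [IsFiniteMeasureOnCompacts μ] {φ : Vec d → ℝ}
    (hφ : Continuous φ) (hc : HasCompactSupport φ) {f : Vec d → E} {F : ℕ → Vec d → E}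
    (hf : MemLp f 2 μ) (hF : ∀ k, MemLp (F k) 2 μ)
    (hlim : Tendsto (fun k => eLpNorm (fun x => f x - F k x) 2 μ) atTop (𝓝 0)) :
    Tendsto (fun k => ∫ x, φ x • F k x ∂μ) atTop (𝓝 (∫ x, φ x • f x ∂μ)) := by
  refine tendsto_integral_of_L1 _ (integrable_smul_of_memLp_two hφ hc hf).aestronglyMeasurable
    (.of_forall fun k => integrable_smul_of_memLp_two hφ hc (hF k)) ?_
  have hφL : eLpNorm φ 2 μ ≠ ⊤ := (hφ.memLp_of_hasCompactSupport hc).2.ne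
  have h2 : Tendsto (fun k => eLpNorm φ 2 μ * eLpNorm (fun x => f x - F k x) 2 μ) atTop (𝓝 0) := by
    simpa using ENNReal.Tendsto.const_mul hlim (Or.inr hφL)
  refine tendsto_of_tendsto_of_tendsto_of_le_of_le tendsto_const_nhds h2 (fun _ => zero_le)
    fun k => ?_
  have h3 := eLpNorm_smul_le_mul_eLpNorm (p := 2) (q := 2) (r := 1) (μ := μ) (φ := φ)
    (f := fun x => f x - F k x) (hf.sub (hF k)).1 hφ.aestronglyMeasurable
  rw [eLpNorm_one_eq_lintegral_enorm] at h3
  refine le_trans (le_of_eq (lintegral_congr fun x => ?_)) h3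
  rw [← enorm_neg]
  congr 1
  simp [smul_sub]

/-- For fields in `H¹₀(U)` the integration by parts formula holds for test functions that do not
vanish on the boundary. -/
theorem MemH10.exists_grad {w : Vec d → Vec d} (hw : MemH10 U w) :
    ∃ G, HasWeakGrad U w G ∧ MemLp G 2 (volume.restrict U) ∧
      ∀ φ : Vec d → ℝ, ContDiff ℝ ∞ φ → HasCompactSupport φ → ∀ a,
        ∫ x in U, (fderiv ℝ φ x a) • w x = -∫ x in U, φ x • G x a := by
  obtain ⟨hw2, G, hG, hG2, ψ, hψ, hlim, hlimG⟩ := hw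
  refine ⟨G, hG, hG2, fun φ h1 h2 a => ?_⟩
  have hψ2 : ∀ k, MemLp (ψ k) 2 (volume.restrict U) := fun k =>
    (hψ k).1.continuous.memLp_of_hasCompactSupport (hψ k).2.1
  have hψd : ∀ k, MemLp (fderiv ℝ (ψ k)) 2 (volume.restrict U) := fun k =>
    ((hψ k).1.continuous_fderiv (by simp)).memLp_of_hasCompactSupport ((hψ k).2.1.fderiv ℝ)
  have hφd : Continuous fun x => fderiv ℝ φ x a :=
    (h1.continuous_fderiv (by simp)).clm_apply continuous_const
  have t1 := tendsto_integral_smul_of_tendsto_eLpNorm hφd (h2.fderiv_apply (𝕜 := ℝ) a) hw2 hψ2 hlim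
  have t2 := tendsto_integral_smul_of_tendsto_eLpNorm h1.continuous h2 hG2 hψd hlimG
  have t3 := ((ContinuousLinearMap.apply ℝ (Vec d) a).continuous.tendsto _).comp t2.neg
  have e1 : ∀ k, (ContinuousLinearMap.apply ℝ (Vec d) a) (-∫ x in U, φ x • fderiv ℝ (ψ k) x) =
      ∫ x in U, (fderiv ℝ φ x a) • ψ k x := by
    intro k
    have hL := (hψ k).1.lipschitzWith_of_hasCompactSupport (hψ k).2.1 (by simp)
    obtain ⟨C, hC⟩ := hL
    have h4 := integral_fderiv_smul_of_lipschitzWith hC (h1.of_le (by simp)) h2 a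
    have h5 : ∫ x in U, (fderiv ℝ φ x a) • ψ k x = ∫ x, (fderiv ℝ φ x a) • ψ k x :=
      setIntegral_eq_integral_of_forall_compl_eq_zero fun x hx => by
        rw [image_eq_zero_of_notMem_tsupport fun h => hx ((hψ k).2.2 h), smul_zero]
    have h6 : ∫ x in U, φ x • fderiv ℝ (ψ k) x a = ∫ x, φ x • fderiv ℝ (ψ k) x a :=
      setIntegral_eq_integral_of_forall_compl_eq_zero fun x hx => by
        rw [fderiv_of_notMem_tsupport ℝ fun h => hx ((hψ k).2.2 h)]
        simp
    rw [h5, h4, ← h6, map_neg, ← ContinuousLinearMap.integral_comp_comm _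
      (integrable_smul_of_memLp_two h1.continuous h2 (hψd k))]
    rfl
  have e2 : (ContinuousLinearMap.apply ℝ (Vec d) a) (-∫ x in U, φ x • G x) =
      -∫ x in U, φ x • G x a := by
    rw [map_neg, ← ContinuousLinearMap.integral_comp_comm _
        (integrable_smul_of_memLp_two h1.continuous h2 hG2)]
    rfl
  rw [← e2]
  refine tendsto_nhds_unique t1 (t3.congr fun k => ?_)
  exact e1 k

theorem frobInner_self {d : ℕ} (A : Vec d →L[ℝ] Vec d) :
    frobInner A A = ∑ i, ‖A (EuclideanSpace.single i 1)‖ ^ 2 := by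
  simp [frobInner]

theorem frob_nonneg {d : ℕ} (A : Vec d →L[ℝ] Vec d) : 0 ≤ frob A := Real.sqrt_nonneg _

theorem frob_sq {d : ℕ} (A : Vec d →L[ℝ] Vec d) :
    frob A ^ 2 = ∑ i, ‖A (EuclideanSpace.single i 1)‖ ^ 2 := by
  rw [frob, Real.sq_sqrt, frobInner_self]
  rw [frobInner_self]
  exact Finset.sum_nonneg fun i _ => sq_nonneg _

theorem norm_apply_le_frob {d : ℕ} (A : Vec d →L[ℝ] Vec d) (v : Vec d) :
    ‖A v‖ ≤ frob A * ‖v‖ := by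
  rw [← sum_apply_single A v]
  refine (norm_sum_le _ _).trans ?_
  simp_rw [norm_smul]
  have h := Finset.sum_mul_sq_le_sq_mul_sq Finset.univ (fun i => ‖v i‖)
    (fun i => ‖A (EuclideanSpace.single i 1)‖)
  rw [← frob_sq, ← EuclideanSpace.norm_sq_eq] at h
  refine abs_le_of_sq_le_sq' (h.trans (le_of_eq (by ring)))
    (mul_nonneg (frob_nonneg A) (norm_nonneg v)) |>.2

theorem frob_le {d : ℕ} (A : Vec d →L[ℝ] Vec d) : frob A ≤ √d * ‖A‖ := by
  refine abs_le_of_sq_le_sq' ?_ (by positivity) |>.2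
  rw [frob_sq, mul_pow, Real.sq_sqrt (Nat.cast_nonneg d)]
  calc _ ≤ ∑ i : Fin d, ‖A‖ ^ 2 := Finset.sum_le_sum fun i _ => by
        have := A.le_opNorm (EuclideanSpace.single i 1)
        rw [PiLp.norm_single, norm_one, mul_one] at this
        exact pow_le_pow_left₀ (norm_nonneg _) this 2
    _ = _ := by simp

theorem frob_add_le {d : ℕ} (A B : Vec d →L[ℝ] Vec d) : frob (A + B) ≤ frob A + frob B := by
  have hsq : frob (A + B) ^ 2 ≤ (frob A + frob B) ^ 2 := by
    have h := Finset.sum_mul_sq_le_sq_mul_sq Finset.univ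
      (fun i => ‖A (EuclideanSpace.single i 1)‖) (fun i => ‖B (EuclideanSpace.single i 1)‖)
    rw [← frob_sq, ← frob_sq, ← mul_pow] at h
    have h1 := (abs_le_of_sq_le_sq' h (mul_nonneg (frob_nonneg A) (frob_nonneg B))).2
    have h2 : frob (A + B) ^ 2 ≤ frob A ^ 2 + 2 * ∑ i, ‖A (EuclideanSpace.single i 1)‖ *
        ‖B (EuclideanSpace.single i 1)‖ + frob B ^ 2 := by
      rw [frob_sq, frob_sq, frob_sq, Finset.mul_sum, ← Finset.sum_add_distrib,
        ← Finset.sum_add_distrib]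
      refine Finset.sum_le_sum fun i _ => ?_
      have := norm_add_le (A (EuclideanSpace.single i 1)) (B (EuclideanSpace.single i 1))
      have := pow_le_pow_left₀ (norm_nonneg _) this 2
      rw [_root_.add_apply]
      linarith [this]
    nlinarith
  exact (abs_le_of_sq_le_sq' hsq (add_nonneg (frob_nonneg A) (frob_nonneg B))).2

theorem frob_neg {d : ℕ} (A : Vec d →L[ℝ] Vec d) : frob (-A) = frob A := by
  simp [frob, frobInner]

end WeakDerivatives

/-! ### Lipschitz representatives of fields in `W^{1,∞} ∩ H¹₀` -/

section Lipschitz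

variable {d : ℕ}

/-- A mollification of a field with bounded weak gradient on `ℝ^d` has a derivative with the same
bound. -/
theorem lipschitzWith_convolution_of_weakGrad {w : Vec d → Vec d} {G : Vec d → Vec d →L[ℝ] Vec d}
    (hw : LocallyIntegrable w) {L : NNReal} (hL : ∀ᵐ x, ∀ a, ‖G x a‖ ≤ L * ‖a‖)
    (h : ∀ φ : Vec d → ℝ, ContDiff ℝ ∞ φ → HasCompactSupport φ → ∀ a,
      ∫ x, (fderiv ℝ φ x a) • w x = -∫ x, φ x • G x a) (ρ : ContDiffBump (0 : Vec d)) :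
    LipschitzWith L (convolution (ρ.normed volume) w (ContinuousLinearMap.lsmul ℝ ℝ) volume) := by
  set r := ρ.normed (volume : Measure (Vec d)) with hr
  have hrc : HasCompactSupport r := ρ.hasCompactSupport_normed
  have hrs : ContDiff ℝ ∞ r := ρ.contDiff_normed
  have hr1 : ContDiff ℝ 1 r := ρ.contDiff_normed
  have hD := hrc.hasFDerivAt_convolution_left (ContinuousLinearMap.lsmul ℝ ℝ) hr1 hw
  refine lipschitzWith_of_nnnorm_fderiv_le (𝕜 := ℝ) (fun x => (hD x).differentiableAt) fun x => ?_
  rw [(hD x).fderiv, ← NNReal.coe_le_coe, coe_nnnorm]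
  refine ContinuousLinearMap.opNorm_le_bound _ L.2 fun a => ?_
  have hint := (hrc.fderiv ℝ).convolutionExists_left
    ((ContinuousLinearMap.lsmul ℝ ℝ).precompL (Vec d)) (hr1.continuous_fderiv one_ne_zero) hw x
  have e1 : (convolution (fderiv ℝ r) w
      ((ContinuousLinearMap.lsmul ℝ ℝ).precompL (Vec d)) volume x) a =
      ∫ t, (fderiv ℝ r t a) • w (x - t) := by
    rw [convolution_def, ContinuousLinearMap.integral_apply hint]
    rfl
  have e2 : ∫ t, (fderiv ℝ r t a) • w (x - t) = ∫ y, (fderiv ℝ r (x - y) a) • w y := by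
    rw [← integral_sub_left_eq_self _ volume x]
    simp
  have hφ : ContDiff ℝ ∞ fun y => r (x - y) := hrs.comp (contDiff_const.sub contDiff_id)
  have hφc : HasCompactSupport fun y => r (x - y) :=
    hrc.comp_homeomorph (Homeomorph.subLeft x)
  have e3 : ∀ y, fderiv ℝ (fun y => r (x - y)) y a = -(fderiv ℝ r (x - y) a) := by
    intro y
    have h1 : HasFDerivAt r (fderiv ℝ r (x - y)) (x - y) :=
      (hr1.differentiable one_ne_zero _).hasFDerivAt
    have h2 : HasFDerivAt (fun y : Vec d => x - y) (-ContinuousLinearMap.id ℝ (Vec d)) y :=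
      (hasFDerivAt_id y).const_sub x
    have h3 : HasFDerivAt (fun y => r (x - y)) _ y := h1.comp y h2
    rw [h3.fderiv]
    simp
  have e4 : ∫ y, (fderiv ℝ r (x - y) a) • w y = ∫ y, r (x - y) • G y a := by
    have := h _ hφ hφc a
    simp_rw [e3, neg_smul] at this
    rw [integral_neg, neg_inj] at this
    exact this
  rw [e1, e2, e4]
  have hb : ∀ᵐ y, ‖r (x - y) • G y a‖ ≤ r (x - y) * (L * ‖a‖) := by
    filter_upwards [hL] with y hy
    rw [norm_smul, Real.norm_of_nonneg (ρ.nonneg_normed _)]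
    exact mul_le_mul_of_nonneg_left (hy a) (ρ.nonneg_normed _)
  have hi : Integrable fun y => r (x - y) * (L * ‖a‖) :=
    (hφ.continuous.integrable_of_hasCompactSupport hφc).mul_const _
  refine (norm_integral_le_of_norm_le hi hb).trans (le_of_eq ?_)
  rw [integral_mul_const, integral_sub_left_eq_self r volume x, ρ.integral_normed, one_mul]

/-- A field on `ℝ^d` with bounded weak gradient has a Lipschitz representative. -/
theorem exists_lipschitzWith_of_weakGrad {w : Vec d → Vec d} {G : Vec d → Vec d →L[ℝ] Vec d}
    (hw : LocallyIntegrable w) {L : NNReal} (hL : ∀ᵐ x, ∀ a, ‖G x a‖ ≤ L * ‖a‖)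
    (h : ∀ φ : Vec d → ℝ, ContDiff ℝ ∞ φ → HasCompactSupport φ → ∀ a,
      ∫ x, (fderiv ℝ φ x a) • w x = -∫ x, φ x • G x a) :
    ∃ g, LipschitzWith (lipschitzExtensionConstant (Vec d) * L) g ∧ w =ᵐ[volume] g := by
  let ρ : ℕ → ContDiffBump (0 : Vec d) := fun k =>
    ⟨1 / (2 * ((k : ℝ) + 1)), 1 / ((k : ℝ) + 1), by positivity, by
      rw [div_lt_div_iff₀ (by positivity) (by positivity)]
      have : (0 : ℝ) ≤ k := Nat.cast_nonneg k
      linarith⟩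
  have hlim := ContDiffBump.ae_convolution_tendsto_right_of_locallyIntegrable (φ := ρ) (l := atTop)
    (K := 2) tendsto_one_div_add_atTop_nhds_zero_nat (.of_forall fun k => le_of_eq (by
      simp only [ρ]; field_simp)) hw
  have hS : LipschitzOnWith L w {x | Tendsto (fun k => convolution ((ρ k).normed volume) w
      (ContinuousLinearMap.lsmul ℝ ℝ) volume x) atTop (𝓝 (w x))} := by
    refine LipschitzOnWith.of_dist_le_mul fun x hx y hy => ?_
    refine le_of_tendsto (Tendsto.dist hx hy) (.of_forall fun k => ?_)
    exact (lipschitzWith_convolution_of_weakGrad hw hL h (ρ k)).dist_le_mul x y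
  obtain ⟨g, hg, hwg⟩ := hS.extend_finite_dimension
  refine ⟨g, hg, ?_⟩
  filter_upwards [hlim] with x hx using hwg hx

/-- An essentially bounded gradient has finite essential supremum in the Frobenius norm, so the
real-valued `tnormLinf` is not a junk value and bounds it almost everywhere. -/
theorem ae_norm_apply_le_of_weakGrad {U : Set (Vec d)} {G : Vec d → Vec d →L[ℝ] Vec d}
    (hG : MemLp G ∞ (volume.restrict U)) :
    eLpNorm (fun x => frob (G x)) ∞ (volume.restrict U) < ⊤ ∧
    ∀ᵐ x ∂(volume.restrict U), frob (G x) ≤ tnormLinf U G := by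
  have hfin : eLpNorm (fun x => frob (G x)) ∞ (volume.restrict U) < ⊤ := by
    refine lt_of_le_of_lt (eLpNorm_le_mul_eLpNorm_of_ae_le_mul (c := √d) (g := G) (.of_forall
      fun x => ?_) ∞) (ENNReal.mul_lt_top ENNReal.ofReal_lt_top hG.2)
    rw [Real.norm_of_nonneg (frob_nonneg _)]
    exact frob_le _
  refine ⟨hfin, ?_⟩
  filter_upwards [ae_le_eLpNormEssSup (f := fun x => frob (G x)) (μ := volume.restrict U)]
    with x hx
  rw [← eLpNorm_exponent_top] at hx
  have h1 := ENNReal.toReal_mono hfin.ne hx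
  rwa [toReal_enorm, Real.norm_of_nonneg (frob_nonneg _)] at h1

/-- Fields in `W^{1,∞} ∩ H¹₀` on a bounded open set are restrictions of Lipschitz fields on `ℝ^d`
that vanish outside, and they satisfy a Poincaré inequality in the maximum norm. -/
theorem exists_lipschitz_extension_of_memH10 (hd : d ≠ 0) {Ω : Set (Vec d)} (hΩ : IsOpen Ω)
    (hb : Bornology.IsBounded Ω) :
    ∃ D : ℝ, 0 ≤ D ∧ ∀ u : Vec d → Vec d, MemW1inf Ω u → MemH10 Ω u →
      ∃ (g : Vec d → Vec d) (C : NNReal), LipschitzWith C g ∧ u =ᵐ[volume.restrict Ω] g ∧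
        (∀ x, x ∉ closure Ω → g x = 0) ∧ ∀ x, ‖g x‖ ≤ D * tnormLinf Ω (weakGrad Ω u) := by
  obtain ⟨R, hR⟩ := hb.closure.subset_closedBall 0
  refine ⟨lipschitzExtensionConstant (Vec d) * (2 * |R| + 1), by positivity, fun u hu hu0 => ?_⟩
  obtain ⟨G, hG, hG2, hGt⟩ := hu0.exists_grad
  obtain ⟨-, G', hG', hG'inf⟩ := hu
  have hGG' : weakGrad Ω u =ᵐ[volume.restrict Ω] G' := hG'.weakGrad_ae_eq hΩ
  have hGw : weakGrad Ω u =ᵐ[volume.restrict Ω] G := hG.weakGrad_ae_eq hΩ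
  obtain ⟨-, hbd⟩ := ae_norm_apply_le_of_weakGrad (hG'inf.ae_eq hGG'.symm)
  set L := tnormLinf Ω (weakGrad Ω u) with hLdef
  have hL0 : 0 ≤ L := ENNReal.toReal_nonneg
  have hmeas := hΩ.measurableSet
  -- the extension of `u` by zero has the extension of `G` by zero as its weak gradient on `ℝ^d`
  have hw : LocallyIntegrable (Ω.indicator u) := by
    have : MemLp (Ω.indicator u) 2 volume := (memLp_indicator_iff_restrict hmeas).2 hu0.1
    exact this.locallyIntegrable (by norm_num)
  have hbound : ∀ᵐ x, ∀ a, ‖Ω.indicator G x a‖ ≤ L.toNNReal * ‖a‖ := by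
    have h1 : ∀ᵐ x ∂(volume.restrict Ω), ∀ a, ‖G x a‖ ≤ L * ‖a‖ := by
      filter_upwards [hbd, hGw] with x hx hx2 a
      rw [← hx2]
      exact (norm_apply_le_frob _ a).trans (mul_le_mul_of_nonneg_right hx (norm_nonneg a))
    rw [ae_restrict_iff' hmeas] at h1
    filter_upwards [h1] with x hx a
    rw [Real.coe_toNNReal _ hL0]
    by_cases hxΩ : x ∈ Ω
    · rw [Set.indicator_of_mem hxΩ]; exact hx hxΩ a
    · rw [Set.indicator_of_notMem hxΩ]
      simp only [zero_apply, norm_zero]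
      positivity
  obtain ⟨g, hg, hug⟩ := exists_lipschitzWith_of_weakGrad hw hbound fun φ h1 h2 a => by
    have := hGt φ h1 h2 a
    rw [← integral_indicator hmeas, ← integral_indicator hmeas] at this
    have i1 : ∀ x, (fderiv ℝ φ x a) • Ω.indicator u x =
        Ω.indicator (fun x => (fderiv ℝ φ x a) • u x) x := fun x => by
      by_cases hxΩ : x ∈ Ω <;> simp [hxΩ]
    have i2 : ∀ x, φ x • Ω.indicator G x a = Ω.indicator (fun x => φ x • G x a) x := fun x => by
      by_cases hxΩ : x ∈ Ω <;> simp [hxΩ]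
    simp_rw [i1, i2]
    exact this
  have hzero : ∀ x, x ∉ closure Ω → g x = 0 := by
    have h1 : g =ᵐ[volume.restrict (closure Ω)ᶜ] fun _ => 0 := by
      filter_upwards [ae_restrict_of_ae hug, ae_restrict_mem isClosed_closure.measurableSet.compl]
        with x hx hx2
      rw [← hx, Set.indicator_of_notMem fun h => hx2 (subset_closure h)]
    have h2 := Measure.eqOn_open_of_ae_eq h1 isClosed_closure.isOpen_compl
      hg.continuous.continuousOn continuousOn_const
    exact fun x hx => h2 hx
  refine ⟨g, _, hg, ?_, hzero, fun x => ?_⟩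
  · filter_upwards [ae_restrict_of_ae hug, ae_restrict_mem hmeas] with x hx hx2
    rw [← hx, Set.indicator_of_mem hx2]
  · by_cases hx : x ∈ closure Ω
    · have hxR := hR hx
      rw [mem_closedBall_zero_iff] at hxR
      -- compare with a point `y` outside `closure Ω` at bounded distance, where `g` vanishes
      set y : Vec d := EuclideanSpace.single ⟨0, Nat.pos_of_ne_zero hd⟩ (|R| + 1) with hy
      have hyn : ‖y‖ = |R| + 1 := by
        rw [hy, PiLp.norm_single, Real.norm_of_nonneg (by positivity)]
      have hy0 : g y = 0 := by
        refine hzero y fun h => ?_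
        have := hR h
        rw [mem_closedBall_zero_iff, hyn] at this
        linarith [le_abs_self R]
      have h1 := hg.dist_le_mul x y
      rw [hy0, dist_zero_right] at h1
      refine h1.trans ?_
      have h2 : dist x y ≤ 2 * |R| + 1 := by
        rw [dist_eq_norm]
        refine (norm_sub_le _ _).trans ?_
        rw [hyn]
        linarith [le_abs_self R]
      calc _ ≤ ((lipschitzExtensionConstant (Vec d) * L.toNNReal : NNReal) : ℝ) * (2 * |R| + 1) :=
            mul_le_mul_of_nonneg_left h2 (NNReal.coe_nonneg _)
        _ = _ := by
            rw [NNReal.coe_mul, Real.coe_toNNReal _ hL0]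
            ring
    · rw [hzero x hx, norm_zero]
      positivity

end Lipschitz

/-! ### Piecewise Lipschitz fields on a mesh -/

section PiecewiseLip

variable {d : ℕ} {Ω : Set (Vec d)} {M : Mesh Ω}

theorem Mesh.volume_diff_iUnion_elems (M : Mesh Ω) :
    volume (Ω \ ⋃ K ∈ M.elems, K) = 0 := by
  refine measure_mono_null (t := ⋃ K ∈ M.elems, frontier K) (fun x hx => ?_) ?_
  · have h1 : x ∈ ⋃ K ∈ M.elems, closure K := by
      rw [← M.cover]; exact subset_closure hx.1
    simp only [Set.mem_iUnion] at h1 ⊢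
    obtain ⟨K, hK, hxK⟩ := h1
    refine ⟨K, hK, hxK, fun h => hx.2 ?_⟩
    exact Set.mem_biUnion hK (interior_subset h)
  · exact (measure_biUnion_null_iff (Finset.countable_toSet _)).2 fun K hK =>
      (M.cell K hK).convex.addHaar_frontier volume

theorem Mesh.iUnion_elems_subset (M : Mesh Ω) : ⋃ K ∈ M.elems, K ⊆ Ω :=
  Set.iUnion₂_subset M.subset

/-- The elements fill `Ω` up to their boundaries, which are null sets. -/
theorem Mesh.restrict_eq (M : Mesh Ω) :
    (volume : Measure (Vec d)).restrict Ω = volume.restrict (⋃ K ∈ M.elems, K) := by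
  refine Measure.restrict_congr_set (Filter.EventuallyLE.antisymm ?_ ?_)
  · exact ae_le_set.2 M.volume_diff_iUnion_elems
  · exact ae_le_set.2 (by rw [Set.sdiff_eq_empty.2 M.iUnion_elems_subset, measure_empty])

theorem Mesh.ae_restrict_of_forall (M : Mesh Ω) {p : Vec d → Prop}
    (h : ∀ K ∈ M.elems, ∀ᵐ x ∂(volume.restrict K), p x) : ∀ᵐ x ∂(volume.restrict Ω), p x := by
  rw [M.restrict_eq, ae_restrict_biUnion_finset_iff]
  exact h

theorem Mesh.ae_restrict_elem (M : Mesh Ω) {p : Vec d → Prop}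
    (h : ∀ᵐ x ∂(volume.restrict Ω), p x) {K : Set (Vec d)} (hK : K ∈ M.elems) :
    ∀ᵐ x ∂(volume.restrict K), p x :=
  ae_restrict_of_ae_restrict_of_subset (M.subset K hK) h

theorem Mesh.setIntegral_eq_sum (M : Mesh Ω) {E : Type*} [NormedAddCommGroup E] [NormedSpace ℝ E]
    {f : Vec d → E} (hf : ∀ K ∈ M.elems, IntegrableOn f K) :
    ∫ x in Ω, f x = ∑ K ∈ M.elems, ∫ x in K, f x := by
  rw [M.restrict_eq]
  exact integral_biUnion_finset _ (fun K hK => (M.cell K hK).isOpen.measurableSet)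
    (fun K hK K' hK' hne => M.disjoint K hK K' hK' hne) hf

theorem Mesh.integrableOn (M : Mesh Ω) {E : Type*} [NormedAddCommGroup E]
    {f : Vec d → E} (hf : ∀ K ∈ M.elems, IntegrableOn f K) : IntegrableOn f Ω := by
  rw [IntegrableOn, M.restrict_eq]
  exact integrableOn_finset_iUnion.2 hf

/-- `w` agrees almost everywhere on each element `K` with the field `g K`, which is Lipschitz up to
the boundary of `K`. -/
def PiecewiseLip (M : Mesh Ω) (w : Vec d → Vec d) (g : Set (Vec d) → Vec d → Vec d) : Prop :=
  ∀ K ∈ M.elems, LipClosure K (g K) ∧ w =ᵐ[volume.restrict K] g K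

theorem PiecewiseLip.sub {w v : Vec d → Vec d} {g f : Set (Vec d) → Vec d → Vec d}
    (hw : PiecewiseLip M w g) (hv : PiecewiseLip M v f) :
    PiecewiseLip M (w - v) (fun K x => g K x - f K x) := fun K hK => by
  refine ⟨(hw K hK).1.sub (hv K hK).1, ?_⟩
  filter_upwards [(hw K hK).2, (hv K hK).2] with x h1 h2
  rw [Pi.sub_apply, h1, h2]

theorem FEPair.exists_piecewiseLip (P : FEPair M) {v : Vec d → Vec d} (hv : v ∈ P.Vh) :
    ∃ g, PiecewiseLip M v g := by
  classical
  choose! g hg using P.piecewise v hv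
  refine ⟨g, fun K hK => ⟨(hg K hK).1.lipClosure (M.cell K hK), ?_⟩⟩
  filter_upwards [ae_restrict_mem (M.cell K hK).isOpen.measurableSet] with x hx using (hg K hK).2 hx

theorem brokenGrad_eq_of_mem {w : Vec d → Vec d} {K : Set (Vec d)} (hK : K ∈ M.elems) {x : Vec d}
    (hx : x ∈ K) : brokenGrad M w x = weakGrad K w x := by
  rw [brokenGrad, Finset.sum_eq_single_of_mem K hK, Set.indicator_of_mem hx]
  intro K' hK' hne
  exact Set.indicator_of_notMem (fun h => Set.disjoint_left.1 (M.disjoint K' hK' K hK hne) h hx) _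

theorem HasWeakGrad.brokenGrad_ae_eq {w : Vec d → Vec d} {K : Set (Vec d)} (hK : K ∈ M.elems)
    {G : Vec d → Vec d →L[ℝ] Vec d} (hG : HasWeakGrad K w G) :
    brokenGrad M w =ᵐ[volume.restrict K] G := by
  filter_upwards [hG.weakGrad_ae_eq (M.cell K hK).isOpen,
    ae_restrict_mem (M.cell K hK).isOpen.measurableSet] with x hx hxK
  rw [brokenGrad_eq_of_mem hK hxK, hx]

theorem PiecewiseLip.brokenGrad_ae_eq {w : Vec d → Vec d} {g : Set (Vec d) → Vec d → Vec d}
    (hw : PiecewiseLip M w g) {K : Set (Vec d)} (hK : K ∈ M.elems) :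
    brokenGrad M w =ᵐ[volume.restrict K] fderiv ℝ (g K) :=
  ((hw K hK).1.hasWeakGrad (M.cell K hK).isOpen (hw K hK).2).brokenGrad_ae_eq hK

theorem brokenGrad_ae_eq_weakGrad (hΩ : IsOpen Ω) {w : Vec d → Vec d}
    {G : Vec d → Vec d →L[ℝ] Vec d} (hG : HasWeakGrad Ω w G) :
    brokenGrad M w =ᵐ[volume.restrict Ω] weakGrad Ω w := by
  have h1 : brokenGrad M w =ᵐ[volume.restrict Ω] G :=
    M.ae_restrict_of_forall fun K hK => (hG.mono (M.subset K hK)).brokenGrad_ae_eq hK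
  exact h1.trans (hG.weakGrad_ae_eq hΩ).symm

/-- The trace of a field that is Lipschitz up to the boundary is its boundary value. -/
theorem tr_eq_of_lipClosure {K : Set (Vec d)} (hK : IsPolytopeCell K) {w g : Vec d → Vec d}
    (hg : LipClosure K g) (hw : w =ᵐ[volume.restrict K] g) {x : Vec d} (hx : x ∈ closure K) :
    tr K w x = g x := by
  refine Tendsto.limUnder_eq ?_
  rw [Metric.tendsto_nhds]
  intro ε hε
  obtain ⟨δ, hδ, hcl⟩ := Metric.continuousOn_iff.1 hg.continuousOn x hx (ε / 2) (by positivity)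
  filter_upwards [Ioo_mem_nhdsGT hδ] with r hr
  have hopen : IsOpen (Metric.ball x r ∩ K) := Metric.isOpen_ball.inter hK.isOpen
  have hne : (Metric.ball x r ∩ K).Nonempty := by
    obtain ⟨y, hy1, hy2⟩ := Metric.mem_closure_iff.1 hx r hr.1
    exact ⟨y, by rw [Metric.mem_ball, dist_comm]; exact hy2, hy1⟩
  have hfin : volume (Metric.ball x r ∩ K) ≠ ⊤ :=
    ((measure_mono Set.inter_subset_left).trans_lt measure_ball_lt_top).ne
  have hwae : ∀ᵐ y ∂(volume.restrict (Metric.ball x r ∩ K)), w y = g y :=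
    ae_restrict_of_ae_restrict_of_subset Set.inter_subset_right hw
  have hmem : ∀ᵐ y ∂(volume.restrict (Metric.ball x r ∩ K)),
      w y ∈ Metric.closedBall (g x) (ε / 2) := by
    filter_upwards [hwae, ae_restrict_mem hopen.measurableSet] with y hy hyB
    rw [hy]
    exact (hcl y (subset_closure hyB.2) (lt_trans hyB.1 hr.2)).le
  have hint : IntegrableOn w (Metric.ball x r ∩ K) := by
    obtain ⟨B, hB⟩ := hg.exists_bound hK
    refine IntegrableOn.congr_fun_ae ?_ (hwae.mono fun y hy => hy.symm)
    refine IntegrableOn.of_bound hfin.lt_top ((hg.aestronglyMeasurable hK).mono_measure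
      (Measure.restrict_mono Set.inter_subset_right le_rfl)) B ?_
    filter_upwards [ae_restrict_mem hopen.measurableSet] with y hy using hB y (subset_closure hy.2)
  have := (convex_closedBall (g x) (ε / 2)).set_average_mem Metric.isClosed_closedBall
    (hopen.measure_pos volume hne).ne' hfin hmem hint
  rw [Metric.mem_closedBall] at this
  linarith

theorem Mesh.mem_facets_plus {F : Set (Vec d)} (hF : F ∈ M.intFacets) :
    F ∈ M.facets (M.plus F) ∧ M.outer (M.plus F) F = M.normal F := by
  have h := M.int_facet F hF
  exact ⟨M.mem_facets_of_isFacet h.1 h.2.2.2.1, M.outer_eq_of_isFacet h.1 h.2.2.2.1⟩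

theorem Mesh.mem_facets_minus {F : Set (Vec d)} (hF : F ∈ M.intFacets) :
    F ∈ M.facets (M.minus F) ∧ M.outer (M.minus F) F = -M.normal F := by
  have h := M.int_facet F hF
  exact ⟨M.mem_facets_of_isFacet h.2.1 h.2.2.2.2, M.outer_eq_of_isFacet h.2.1 h.2.2.2.2⟩

theorem Mesh.mem_facets_bd {F : Set (Vec d)} (hF : F ∈ M.bdFacets) :
    F ∈ M.facets (M.plus F) ∧ M.outer (M.plus F) F = M.normal F := by
  have h := M.bd_facet F hF
  exact ⟨M.mem_facets_of_isFacet h.1 h.2.1, M.outer_eq_of_isFacet h.1 h.2.1⟩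

/-- The jump is computed from the one-sided values of the representatives. -/
theorem PiecewiseLip.jump_eq {w : Vec d → Vec d} {g : Set (Vec d) → Vec d → Vec d}
    (hw : PiecewiseLip M w g) {F : Set (Vec d)} (hF : F ∈ M.intFacets) {x : Vec d} (hx : x ∈ F) :
    M.jump F w x = g (M.plus F) x - g (M.minus F) x := by
  have h := M.int_facet F hF
  rw [Mesh.jump, tr_eq_of_lipClosure (M.cell _ h.1) (hw _ h.1).1 (hw _ h.1).2
    (M.facet_subset (M.mem_facets_plus hF).1 hx), tr_eq_of_lipClosure (M.cell _ h.2.1)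
    (hw _ h.2.1).1 (hw _ h.2.1).2 (M.facet_subset (M.mem_facets_minus hF).1 hx)]

theorem PiecewiseLip.avg_eq {w : Vec d → Vec d} {g : Set (Vec d) → Vec d → Vec d}
    (hw : PiecewiseLip M w g) {F : Set (Vec d)} (hF : F ∈ M.intFacets) {x : Vec d} (hx : x ∈ F) :
    M.avg F w x = (1 / 2 : ℝ) • (g (M.plus F) x + g (M.minus F) x) := by
  have h := M.int_facet F hF
  rw [Mesh.avg, tr_eq_of_lipClosure (M.cell _ h.1) (hw _ h.1).1 (hw _ h.1).2
    (M.facet_subset (M.mem_facets_plus hF).1 hx), tr_eq_of_lipClosure (M.cell _ h.2.1)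
    (hw _ h.2.1).1 (hw _ h.2.1).2 (M.facet_subset (M.mem_facets_minus hF).1 hx)]

/-- A sum over all facets of all elements, rearranged into a sum over the facets of the mesh. -/
theorem Mesh.sum_elems_facets (M : Mesh Ω) (Φ : Set (Vec d) → Set (Vec d) → ℝ) :
    ∑ K ∈ M.elems, ∑ F ∈ M.facets K, Φ K F =
      (∑ F ∈ M.intFacets, (Φ (M.plus F) F + Φ (M.minus F) F)) +
        ∑ F ∈ M.bdFacets, Φ (M.plus F) F := by
  classical
  have h1 : ∀ K, ∑ F ∈ M.facets K, Φ K F =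
      ∑ F ∈ M.intFacets, (if K = M.plus F then Φ K F else 0) +
      ∑ F ∈ M.intFacets, (if K = M.minus F then Φ K F else 0) +
      ∑ F ∈ M.bdFacets, (if K = M.plus F then Φ K F else 0) := by
    intro K
    rw [Mesh.facets, Finset.sum_filter, Finset.sum_union M.int_bd, ← Finset.sum_add_distrib]
    congr 1
    · refine Finset.sum_congr rfl fun F hF => ?_
      have hne := (M.int_facet F hF).2.2.1
      by_cases h : K = M.plus F
      · have h' : K ≠ M.minus F := h ▸ hne
        simp [h, hne]
      · by_cases h' : K = M.minus F
        · rw [if_pos (Or.inr ⟨hF, h'⟩), if_neg h, if_pos h', zero_add]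
        · simp [h, h']
    · refine Finset.sum_congr rfl fun F hF => ?_
      have : F ∉ M.intFacets := fun h => Finset.disjoint_left.1 M.int_bd h hF
      simp [this]
  simp_rw [h1, Finset.sum_add_distrib]
  congr 1
  · congr 1
    · rw [Finset.sum_comm]
      refine Finset.sum_congr rfl fun F hF => ?_
      rw [Finset.sum_ite_eq' M.elems (M.plus F) fun K => Φ K F, if_pos (M.int_facet F hF).1]
    · rw [Finset.sum_comm]
      refine Finset.sum_congr rfl fun F hF => ?_
      rw [Finset.sum_ite_eq' M.elems (M.minus F) fun K => Φ K F, if_pos (M.int_facet F hF).2.1]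
  · rw [Finset.sum_comm]
    refine Finset.sum_congr rfl fun F hF => ?_
    rw [Finset.sum_ite_eq' M.elems (M.plus F) fun K => Φ K F, if_pos (M.bd_facet F hF).1]

/-- Elementwise integration by parts, with the boundary terms collected on the facets of the
mesh. -/
theorem Mesh.sum_integral_pointDiv (M : Mesh Ω) {V : Set (Vec d) → Vec d → Vec d}
    (hV : ∀ K ∈ M.elems, LipClosure K (V K)) :
    ∑ K ∈ M.elems, ∫ x in K, pointDiv (V K) x =
      (∑ F ∈ M.intFacets,
        ∫ x in F, inner ℝ (V (M.plus F) x - V (M.minus F) x) (M.normal F) ∂μHE[d - 1]) +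
      ∑ F ∈ M.bdFacets, ∫ x in F, inner ℝ (V (M.plus F) x) (M.normal F) ∂μHE[d - 1] := by
  rw [Finset.sum_congr rfl fun K hK => M.integral_pointDiv hK (hV K hK),
    M.sum_elems_facets fun K F => ∫ x in F, inner ℝ (V K x) (M.outer K F) ∂μHE[d - 1]]
  congr 1
  · refine Finset.sum_congr rfl fun F hF => ?_
    have h := M.int_facet F hF
    have hi : ∀ {K}, K ∈ M.elems → F ∈ M.facets K → ∀ n : Vec d,
        IntegrableOn (fun x => inner ℝ (V K x) n) F μHE[d - 1] := fun {K} hK hFK n =>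
      (M.isFacet_outer hFK).integrableOn (M.cell K hK)
        (((hV K hK).continuousOn.mono (M.facet_subset hFK)).inner continuousOn_const)
    rw [← integral_add (hi h.1 (M.mem_facets_plus hF).1 _) (hi h.2.1 (M.mem_facets_minus hF).1 _),
      (M.mem_facets_plus hF).2, (M.mem_facets_minus hF).2]
    congr 1
    ext x
    rw [inner_sub_left, inner_neg_right]
    ring
  · exact Finset.sum_congr rfl fun F hF => by rw [(M.mem_facets_bd hF).2]

end PiecewiseLip

/-! ### Continuity conditions across facets -/

section Facets

variable {d : ℕ} {Ω : Set (Vec d)} {M : Mesh Ω}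

/-- Near almost every point of a facet the element is a half-space. -/
theorem Mesh.ae_facet_halfspace {K F : Set (Vec d)} (hK : K ∈ M.elems) (hF : F ∈ M.facets K) :
    ∀ᵐ x ∂(μHE[d - 1] : Measure (Vec d)), x ∈ F → ∀ᶠ y in 𝓝 x,
      (inner ℝ (M.outer K F) y < inner ℝ (M.outer K F) x → y ∈ K) ∧
      (inner ℝ (M.outer K F) y ≤ inner ℝ (M.outer K F) x → y ∈ closure K) := by
  classical
  obtain ⟨c, hc, hFc⟩ := M.exists_polyhedron hK
  have hcell := M.cell K hK
  set i : M.facets K := ⟨F, hF⟩ with hi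
  have hn : ∀ G : M.facets K, ‖M.outer K G‖ = 1 := fun G => (M.isFacet_outer G.2).1
  have hne : (polyhedron (fun G : M.facets K => M.outer K G) c).Nonempty := hc ▸ hcell.1
  have hFi : F = polyFace (fun G : M.facets K => M.outer K G) c i := hFc i
  have hae := ae_ne_face hn M.outer_injective hne i
  have hnull : (μHE[d - 1] : Measure (Vec d))
      {x | x ∈ F ∧ ∃ G : M.facets K, G ≠ i ∧ inner ℝ (M.outer K G) x = c G} = 0 := by
    rw [measure_hyperplane (hn i) (c i) (fun x hx => by
      have := hx.1; rw [hFi] at this; exact this.1)]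
    refine measure_mono_null (fun y hy => ?_) (ae_iff.1 hae)
    obtain ⟨-, G, hG1, hG2⟩ := hy
    simp only [not_forall]
    exact ⟨G, hG1, fun h => h hG2⟩
  filter_upwards [measure_eq_zero_iff_ae_notMem.1 hnull] with x hx hxF
  have hxF' := hxF
  rw [hFi] at hxF'
  have hlt : ∀ G : M.facets K, G ≠ i → inner ℝ (M.outer K G) x < c G := fun G hG =>
    lt_of_le_of_ne (hxF'.2 G) fun h => hx ⟨hxF, G, hG, h⟩
  have hev : ∀ᶠ y in 𝓝 x, ∀ G : M.facets K, G ≠ i → inner ℝ (M.outer K G) y < c G := by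
    refine eventually_all.2 fun G => ?_
    by_cases hG : G = i
    · exact .of_forall fun y h => absurd hG h
    · have hcont : Continuous fun y : Vec d => inner ℝ (M.outer K G) y := by fun_prop
      filter_upwards [(hcont.tendsto x).eventually_lt_const (hlt G hG)] with y hy _ using hy
  have hxc : inner ℝ (M.outer K F) x = c i := hxF'.1
  filter_upwards [hev] with y hy
  constructor
  · intro h
    rw [hc]
    intro G
    by_cases hG : G = i
    · rw [hG, ← hxc]; exact h
    · exact hy G hG
  · intro h
    rw [hc, closure_polyhedron hne]
    intro G
    by_cases hG : G = i
    · rw [hG, ← hxc]; exact h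
    · exact (hy G hG).le

theorem Mesh.facet_subset_hyperplane {K F : Set (Vec d)} (hK : K ∈ M.elems) (hF : F ∈ M.facets K) :
    ∃ c, F ⊆ {x | inner ℝ (M.outer K F) x = c} := by
  obtain ⟨c, -, hFc, -⟩ := (M.isFacet_outer hF).exists_level (M.cell K hK)
  exact ⟨c, fun x hx => by rw [hFc] at hx; exact hx.2⟩

/-- Distinct facets with the same outer normal overlap in a null set: both elements contain the
points just behind the overlap, so they coincide, and a cell has one facet for each normal. -/
theorem Mesh.measure_inter_eq_zero_of_outer_eq {K K' F F' : Set (Vec d)} (hK : K ∈ M.elems)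
    (hK' : K' ∈ M.elems) (hF : F ∈ M.facets K) (hF' : F' ∈ M.facets K') (hne : F ≠ F')
    (h : M.outer K' F' = M.outer K F) : (μHE[d - 1] : Measure (Vec d)) (F ∩ F') = 0 := by
  rw [measure_eq_zero_iff_ae_notMem]
  filter_upwards [M.ae_facet_halfspace hK hF, M.ae_facet_halfspace hK' hF'] with x h1 h2 hx
  have hn := (M.isFacet_outer hF).1
  have hlim : Tendsto (fun t : ℝ => x - t • M.outer K F) (𝓝[>] 0) (𝓝 x) := by
    have : Tendsto (fun t : ℝ => x - t • M.outer K F) (𝓝 0) (𝓝 (x - (0 : ℝ) • M.outer K F)) :=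
      Continuous.tendsto (by fun_prop) 0
    rw [zero_smul, sub_zero] at this
    exact this.mono_left nhdsWithin_le_nhds
  obtain ⟨t, ht1, ht2, ht⟩ := ((hlim.eventually (h1 hx.1)).and ((hlim.eventually (h2 hx.2)).and
    self_mem_nhdsWithin)).exists
  have hlt : inner ℝ (M.outer K F) (x - t • M.outer K F) < inner ℝ (M.outer K F) x := by
    rw [inner_sub_right, inner_smul_right, real_inner_self_eq_norm_sq, hn]
    have : 0 < t := ht
    linarith
  have hyK := ht1.1 hlt
  have hyK' := ht2.1 (by rw [h]; exact hlt)
  by_cases hKK : K = K'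
  · subst hKK
    exact hne (congrArg Subtype.val
      (M.outer_injective (a₁ := ⟨F, hF⟩) (a₂ := ⟨F', hF'⟩) h.symm))
  · exact Set.disjoint_left.1 (M.disjoint K hK K' hK' hKK) hyK hyK'

theorem Mesh.exists_elem_of_mem_union {F : Set (Vec d)} (hF : F ∈ M.intFacets ∨ F ∈ M.bdFacets) :
    M.plus F ∈ M.elems ∧ F ∈ M.facets (M.plus F) := by
  rcases hF with hF | hF
  · exact ⟨(M.int_facet F hF).1, (M.mem_facets_plus hF).1⟩
  · exact ⟨(M.bd_facet F hF).1, (M.mem_facets_bd hF).1⟩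

/-- Distinct facets of the mesh meet in a null set. Two facets with opposite outer normals that
overlap lie in the interior of `Ω` there, because `Ω` lies on one side of its boundary; then both are
interior facets and can be compared from the same side. -/
theorem Mesh.measure_inter_eq_zero (hΩ : IsOpen Ω) (hΩr : interior (closure Ω) = Ω)
    {F F' : Set (Vec d)} (hF : F ∈ M.intFacets ∨ F ∈ M.bdFacets)
    (hF' : F' ∈ M.intFacets ∨ F' ∈ M.bdFacets) (hne : F ≠ F') :
    (μHE[d - 1] : Measure (Vec d)) (F ∩ F') = 0 := by
  obtain ⟨hK, hFK⟩ := M.exists_elem_of_mem_union hF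
  obtain ⟨hK', hFK'⟩ := M.exists_elem_of_mem_union hF'
  set n := M.outer (M.plus F) F with hn
  set n' := M.outer (M.plus F') F' with hn'
  have hn1 : ‖n‖ = 1 := (M.isFacet_outer hFK).1
  have hn1' : ‖n'‖ = 1 := (M.isFacet_outer hFK').1
  obtain ⟨c, hc⟩ := M.facet_subset_hyperplane hK hFK
  obtain ⟨c', hc'⟩ := M.facet_subset_hyperplane hK' hFK'
  by_cases h1 : n' = n
  · exact M.measure_inter_eq_zero_of_outer_eq hK hK' hFK hFK' hne h1
  by_cases h2 : n' = -n
  · by_cases hint : F ∈ M.intFacets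
    · have hm := M.mem_facets_minus hint
      have hp := M.mem_facets_plus hint
      refine M.measure_inter_eq_zero_of_outer_eq (M.int_facet F hint).2.1 hK' hm.1 hFK' hne ?_
      rw [← hn', h2, hm.2, ← hp.2]
    · have hbd : F ∈ M.bdFacets := hF.resolve_left hint
      rw [measure_eq_zero_iff_ae_notMem]
      filter_upwards [M.ae_facet_halfspace hK hFK, M.ae_facet_halfspace hK' hFK'] with x e1 e2 hx
      have hcl : ∀ {K}, K ∈ M.elems → closure K ⊆ closure Ω := fun hK =>
        closure_mono (M.subset _ hK)
      have hxint : x ∈ interior (closure Ω) := by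
        rw [mem_interior_iff_mem_nhds]
        filter_upwards [e1 hx.1, e2 hx.2] with y hy1 hy2
        rcases le_total (inner ℝ n y) (inner ℝ n x) with h | h
        · exact hcl hK (hy1.2 h)
        · refine hcl hK' (hy2.2 ?_)
          rw [← hn', h2, inner_neg_left, inner_neg_left]
          linarith
      rw [hΩr] at hxint
      have := (M.bd_facet F hbd).2.2 hx.1
      rw [hΩ.frontier_eq] at this
      exact this.2 hxint
  · rw [measure_hyperplane hn1 c (Set.inter_subset_left.trans hc)]
    refine measure_mono_null (fun y hy => ?_)
      (ae_iff.1 (ae_inner_normalCoord_ne hn1 hn1' h1 h2 c c'))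
    exact fun h => h (hc' hy.2)

/-- Continuous densities on the facets that annihilate all test functions vanish. -/
theorem Mesh.ae_eq_zero_of_sum_integral_eq_zero (hΩ : IsOpen Ω) (hΩr : interior (closure Ω) = Ω)
    {J : Set (Vec d) → Vec d → ℝ}
    (hJ : ∀ F, F ∈ M.intFacets ∨ F ∈ M.bdFacets → ContinuousOn (J F) F)
    (h : ∀ φ : Vec d → ℝ, ContDiff ℝ ∞ φ → HasCompactSupport φ →
      (∑ F ∈ M.intFacets, ∫ x in F, φ x * J F x ∂μHE[d - 1]) +
        ∑ F ∈ M.bdFacets, ∫ x in F, φ x * J F x ∂μHE[d - 1] = 0)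
    {F : Set (Vec d)} (hF : F ∈ M.intFacets ∨ F ∈ M.bdFacets) :
    ∀ᵐ x ∂((μHE[d - 1] : Measure (Vec d)).restrict F), J F x = 0 := by
  classical
  obtain ⟨hK, hFK⟩ := M.exists_elem_of_mem_union hF
  have hcomp : ∀ G, G ∈ M.intFacets ∨ G ∈ M.bdFacets → IsCompact G := fun G hG =>
    (M.isFacet_outer (M.exists_elem_of_mem_union hG).2).isCompact
      (M.cell _ (M.exists_elem_of_mem_union hG).1)
  have hmem : ∀ {G}, G ∈ M.intFacets ∪ M.bdFacets ↔ G ∈ M.intFacets ∨ G ∈ M.bdFacets :=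
    fun {G} => Finset.mem_union
  -- test with functions supported away from all other facets
  set U : Set (Vec d) := (⋃ G ∈ (M.intFacets ∪ M.bdFacets).erase F, G)ᶜ with hU
  have hUo : IsOpen U := by
    refine IsClosed.isOpen_compl (self := ?_)
    exact (Finset.finite_toSet _).isClosed_biUnion fun G hG =>
      (hcomp G (hmem.1 (Finset.mem_erase.1 hG).2)).isClosed
  have hJi : IntegrableOn (J F) F μHE[d - 1] :=
    (M.isFacet_outer hFK).integrableOn (M.cell _ hK) (hJ F hF)
  have hloc := hUo.ae_eq_zero_of_integral_contDiff_smul_eq_zero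
    (hJi.locallyIntegrable.locallyIntegrableOn U) (fun φ h1 h2 h3 => by
      have hsum := h φ h1 h2
      rw [← Finset.sum_union M.int_bd, ← Finset.add_sum_erase _ _ (hmem.2 hF),
        Finset.sum_eq_zero, add_zero] at hsum
      · exact hsum
      · intro G hG
        refine (setIntegral_congr_fun (hcomp G (hmem.1 (Finset.mem_erase.1 hG).2)).measurableSet
          fun x hx => ?_).trans (integral_zero _ _)
        have : x ∉ tsupport φ := fun hxs => h3 hxs (Set.mem_biUnion hG hx)
        simp [image_eq_zero_of_notMem_tsupport this])
  have hnull : (μHE[d - 1] : Measure (Vec d)).restrict F Uᶜ = 0 := by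
    rw [hU, compl_compl]
    refine (measure_biUnion_null_iff (Finset.countable_toSet _)).2 fun G hG => ?_
    have hG' := Finset.mem_erase.1 hG
    rw [Measure.restrict_apply (hcomp G (hmem.1 hG'.2)).measurableSet]
    exact M.measure_inter_eq_zero hΩ hΩr (hmem.1 hG'.2) hF hG'.1
  filter_upwards [hloc, measure_eq_zero_iff_ae_notMem.1 hnull] with x hx hxU
  exact hx (not_not.1 hxU)

theorem LipClosure.integrableOn {K : Set (Vec d)} (hK : IsPolytopeCell K) {E : Type*}
    [NormedAddCommGroup E] {f : Vec d → E} (hf : LipClosure K f) : IntegrableOn f K := by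
  obtain ⟨B, hB⟩ := hf.exists_bound hK
  refine IntegrableOn.of_bound hK.isBounded.measure_lt_top
    ((hf.continuousOn.mono subset_closure).aestronglyMeasurable hK.isOpen.measurableSet) B ?_
  filter_upwards [ae_restrict_mem hK.isOpen.measurableSet] with x hx using hB x (subset_closure hx)

/-- Fields in `H(div)` with vanishing divergence and vanishing normal component on `∂Ω`, in terms of
a piecewise Lipschitz representative: the divergence vanishes on each element, and the normal
component is continuous across interior facets and zero on boundary facets. -/
theorem PiecewiseLip.normal_continuity (hΩ : IsOpen Ω) (hΩr : interior (closure Ω) = Ω)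
    {v : Vec d → Vec d} {g : Set (Vec d) → Vec d → Vec d} (hv : PiecewiseLip M v g)
    (hdiv : ∀ φ : Vec d → ℝ, ContDiff ℝ ∞ φ → HasCompactSupport φ →
      ∫ x in Ω, fderiv ℝ φ x (v x) = 0) :
    (∀ K ∈ M.elems, ∀ᵐ x ∂(volume.restrict K), pointDiv (g K) x = 0) ∧
    (∀ F ∈ M.intFacets, ∀ᵐ x ∂((μHE[d - 1] : Measure (Vec d)).restrict F),
      inner ℝ (g (M.plus F) x) (M.normal F) = inner ℝ (g (M.minus F) x) (M.normal F)) ∧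
    (∀ F ∈ M.bdFacets, ∀ᵐ x ∂((μHE[d - 1] : Measure (Vec d)).restrict F),
      inner ℝ (g (M.plus F) x) (M.normal F) = 0) := by
  classical
  have hloc : LocallyIntegrableOn v Ω := by
    refine IntegrableOn.locallyIntegrableOn (M.integrableOn fun K hK => ?_)
    exact ((hv K hK).1.integrableOn (M.cell K hK)).congr_fun_ae (hv K hK).2.symm
  have hzero : HasWeakDiv Ω v 0 :=
    ⟨hloc, locallyIntegrableOn_zero, fun φ h1 h2 _ => by simpa using hdiv φ h1 h2⟩
  have hpd : ∀ K ∈ M.elems, ∀ᵐ x ∂(volume.restrict K), pointDiv (g K) x = 0 := by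
    intro K hK
    have h1 := ((hv K hK).1.hasWeakGrad (M.cell K hK).isOpen (hv K hK).2).hasWeakDiv
    filter_upwards [HasWeakDiv.ae_unique (M.cell K hK).isOpen h1 (hzero.mono (M.subset K hK))]
      with x hx
    rw [pointDiv_eq_traceCLM, hx]
    rfl
  have hJcont : ∀ {K F}, K ∈ M.elems → F ∈ M.facets K →
      ContinuousOn (fun x => inner ℝ (g K x) (M.normal F)) F := fun {K F} hK hF =>
    ((hv K hK).1.continuousOn.mono (M.facet_subset hF)).inner continuousOn_const
  set J : Set (Vec d) → Vec d → ℝ := fun F x => if F ∈ M.intFacets then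
    inner ℝ (g (M.plus F) x) (M.normal F) - inner ℝ (g (M.minus F) x) (M.normal F)
    else inner ℝ (g (M.plus F) x) (M.normal F) with hJ
  suffices hall : (∀ F, F ∈ M.intFacets ∨ F ∈ M.bdFacets → ContinuousOn (J F) F) ∧
      ∀ φ : Vec d → ℝ, ContDiff ℝ ∞ φ → HasCompactSupport φ →
        (∑ F ∈ M.intFacets, ∫ x in F, φ x * J F x ∂μHE[d - 1]) +
          ∑ F ∈ M.bdFacets, ∫ x in F, φ x * J F x ∂μHE[d - 1] = 0 by
    have key : ∀ {F}, F ∈ M.intFacets ∨ F ∈ M.bdFacets →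
        ∀ᵐ x ∂((μHE[d - 1] : Measure (Vec d)).restrict F), J F x = 0 := fun hF =>
      M.ae_eq_zero_of_sum_integral_eq_zero hΩ hΩr hall.1 hall.2 hF
    refine ⟨hpd, fun F hF => ?_, fun F hF => ?_⟩
    · filter_upwards [key (Or.inl hF)] with x hx
      simp only [hJ, if_pos hF] at hx
      linarith
    · filter_upwards [key (Or.inr hF)] with x hx
      have : F ∉ M.intFacets := fun h => Finset.disjoint_left.1 M.int_bd h hF
      simpa only [hJ, if_neg this] using hx
  refine ⟨fun F hF => ?_, fun φ h1 h2 => ?_⟩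
  · obtain ⟨hK, hFK⟩ := M.exists_elem_of_mem_union hF
    by_cases hint : F ∈ M.intFacets
    · simp only [hJ, if_pos hint]
      exact (hJcont hK hFK).sub (hJcont (M.int_facet F hint).2.1 (M.mem_facets_minus hint).1)
    · simp only [hJ, if_neg hint]
      exact hJcont hK hFK
  · have hφ1 : ContDiff ℝ 1 φ := h1.of_le (by simp)
    have hφL : ∀ K ∈ M.elems, LipClosure K φ := fun K hK => hφ1.lipClosure (M.cell K hK)
    have hgreen := M.sum_integral_pointDiv (V := fun K x => φ x • g K x)
      fun K hK => (hφL K hK).smul (M.cell K hK) (hv K hK).1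
    have hleft : ∀ K ∈ M.elems, ∫ x in K, pointDiv (fun x => φ x • g K x) x =
        ∫ x in K, fderiv ℝ φ x (v x) := by
      intro K hK
      refine integral_congr_ae ?_
      filter_upwards [hpd K hK, (hv K hK).2, (hv K hK).1.ae_differentiableAt (M.cell K hK).isOpen]
        with x e1 e2 e3
      rw [pointDiv_smul (hφ1.differentiable one_ne_zero x) e3, e1, e2, mul_zero, zero_add]
    have hint : ∀ K ∈ M.elems, IntegrableOn (fun x => fderiv ℝ φ x (v x)) K := by
      intro K hK
      refine IntegrableOn.congr_fun_ae (f := fun x => pointDiv (fun x => φ x • g K x) x) ?_ ?_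
      · exact ((hφL K hK).smul (M.cell K hK) (hv K hK).1).integrableOn_pointDiv (M.cell K hK)
      · filter_upwards [hpd K hK, (hv K hK).2,
          (hv K hK).1.ae_differentiableAt (M.cell K hK).isOpen] with x e1 e2 e3
        rw [pointDiv_smul (hφ1.differentiable one_ne_zero x) e3, e1, e2, mul_zero, zero_add]
    rw [Finset.sum_congr rfl hleft, ← M.setIntegral_eq_sum hint, hdiv φ h1 h2] at hgreen
    rw [hgreen]
    congr 1
    · refine Finset.sum_congr rfl fun F hF => integral_congr_ae (.of_forall fun x => ?_)
      simp only [hJ, if_pos hF, ← smul_sub, real_inner_smul_left, inner_sub_left]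
    · refine Finset.sum_congr rfl fun F hF => integral_congr_ae (.of_forall fun x => ?_)
      have : F ∉ M.intFacets := fun h => Finset.disjoint_left.1 M.int_bd h hF
      simp only [hJ, if_neg this, real_inner_smul_left]

/-- Piecewise Lipschitz fields in `H¹₀` have no jumps across interior facets. -/
theorem PiecewiseLip.jump_eq_zero_of_memH10 (hΩ : IsOpen Ω) (hΩr : interior (closure Ω) = Ω)
    {v : Vec d → Vec d} {g : Set (Vec d) → Vec d → Vec d} (hv : PiecewiseLip M v g)
    (hv0 : MemH10 Ω v) {F : Set (Vec d)} (hF : F ∈ M.intFacets) :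
    ∀ᵐ x ∂((μHE[d - 1] : Measure (Vec d)).restrict F), M.jump F v x = 0 := by
  classical
  obtain ⟨G, hG, hG2, hGt⟩ := hv0.exists_grad
  have hGg : ∀ K ∈ M.elems, G =ᵐ[volume.restrict K] fderiv ℝ (g K) := fun K hK =>
    HasWeakGrad.ae_unique (M.cell K hK).isOpen (hG.mono (M.subset K hK))
      ((hv K hK).1.hasWeakGrad (M.cell K hK).isOpen (hv K hK).2)
  have key : ∀ i : Fin d, ∀ᵐ x ∂((μHE[d - 1] : Measure (Vec d)).restrict F),
      (g (M.plus F) x i - g (M.minus F) x i) * inner ℝ (M.normal F) (M.normal F) = 0 := by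
    intro i
    set a := M.normal F with ha
    have hgi : ∀ K ∈ M.elems, LipClosure K fun x => g K x i := fun K hK =>
      (hv K hK).1.clm (EuclideanSpace.proj i : Vec d →L[ℝ] ℝ)
    have hJcont : ∀ {K F}, K ∈ M.elems → F ∈ M.facets K →
        ContinuousOn (fun x => g K x i) F := fun {K F} hK hF =>
      (hgi K hK).continuousOn.mono (M.facet_subset hF)
    set J : Set (Vec d) → Vec d → ℝ := fun F x => if F ∈ M.intFacets then
      (g (M.plus F) x i - g (M.minus F) x i) * inner ℝ a (M.normal F)
      else g (M.plus F) x i * inner ℝ a (M.normal F) with hJ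
    have key := M.ae_eq_zero_of_sum_integral_eq_zero hΩ hΩr (J := J) (fun F hF => ?_)
      (fun φ h1 h2 => ?_) (Or.inl hF)
    · filter_upwards [key] with x hx
      simpa only [hJ, if_pos hF] using hx
    · obtain ⟨hK, hFK⟩ := M.exists_elem_of_mem_union hF
      by_cases hint : F ∈ M.intFacets
      · simp only [hJ, if_pos hint]
        exact ((hJcont hK hFK).sub (hJcont (M.int_facet F hint).2.1
          (M.mem_facets_minus hint).1)).mul continuousOn_const
      · simp only [hJ, if_neg hint]
        exact (hJcont hK hFK).mul continuousOn_const
    · have hφ1 : ContDiff ℝ 1 φ := h1.of_le (by simp)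
      have hφL : ∀ K ∈ M.elems, LipClosure K φ := fun K hK => hφ1.lipClosure (M.cell K hK)
      have hVL : ∀ K ∈ M.elems, LipClosure K (fun x => (φ x * g K x i) • a) := fun K hK =>
        ((hφL K hK).smul (M.cell K hK) (hgi K hK)).smul (M.cell K hK) (lipClosure_const a)
      have hgreen := M.sum_integral_pointDiv (V := fun K x => (φ x * g K x i) • a) hVL
      have hpt : ∀ K ∈ M.elems, ∀ᵐ x ∂(volume.restrict K),
          pointDiv (fun x => (φ x * g K x i) • a) x =
            ((fderiv ℝ φ x a) • v x + φ x • G x a) i := by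
        intro K hK
        filter_upwards [hGg K hK, (hv K hK).2,
          (hv K hK).1.ae_differentiableAt (M.cell K hK).isOpen] with x e1 e2 e3
        have hφd := hφ1.differentiable one_ne_zero x
        have e4 : HasFDerivAt (fun x => g K x i)
            ((EuclideanSpace.proj i : Vec d →L[ℝ] ℝ).comp (fderiv ℝ (g K) x)) x :=
          (EuclideanSpace.proj i : Vec d →L[ℝ] ℝ).hasFDerivAt.comp x e3.hasFDerivAt
        have e5 : pointDiv (fun _ : Vec d => a) x = 0 := by
          simp [pointDiv]
        rw [pointDiv_smul (hφd.fun_mul e4.differentiableAt) (differentiableAt_const a), e5,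
          fderiv_fun_mul hφd e4.differentiableAt, e4.fderiv, e1, e2]
        simp
        ring
      have hint : ∀ K ∈ M.elems,
          IntegrableOn (fun x => ((fderiv ℝ φ x a) • v x + φ x • G x a) i) K := fun K hK =>
        ((hVL K hK).integrableOn_pointDiv (M.cell K hK)).congr_fun_ae (hpt K hK)
      have hφd : Continuous fun x => fderiv ℝ φ x a :=
        (h1.continuous_fderiv (by simp)).clm_apply continuous_const
      have i1 : Integrable (fun x => (fderiv ℝ φ x a) • v x) (volume.restrict Ω) :=
        integrable_smul_of_memLp_two hφd (h2.fderiv_apply (𝕜 := ℝ) a) hv0.1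
      have i2 : Integrable (fun x => φ x • G x a) (volume.restrict Ω) :=
        ContinuousLinearMap.integrable_comp (ContinuousLinearMap.apply ℝ (Vec d) a)
          (integrable_smul_of_memLp_two h1.continuous h2 hG2)
      have hzero : ∫ x in Ω, ((fderiv ℝ φ x a) • v x + φ x • G x a) i = 0 := by
        have h3 := (EuclideanSpace.proj i : Vec d →L[ℝ] ℝ).integral_comp_comm (i1.add i2)
        refine h3.trans ?_
        have h4 : ∫ x in Ω, ((fun x => (fderiv ℝ φ x a) • v x) + fun x => φ x • G x a) x = 0 := by
          rw [integral_add' i1 i2, hGt φ h1 h2 a, neg_add_cancel]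
        rw [h4, map_zero]
      rw [Finset.sum_congr rfl fun K hK => integral_congr_ae (hpt K hK),
        ← M.setIntegral_eq_sum hint, hzero] at hgreen
      rw [hgreen]
      congr 1
      · refine Finset.sum_congr rfl fun F hF => integral_congr_ae (.of_forall fun x => ?_)
        simp only [hJ, if_pos hF, ← sub_smul, real_inner_smul_left]
        ring
      · refine Finset.sum_congr rfl fun F hF => integral_congr_ae (.of_forall fun x => ?_)
        have : F ∉ M.intFacets := fun h => Finset.disjoint_left.1 M.int_bd h hF
        simp only [hJ, if_neg this, real_inner_smul_left]
        ring
  have hn : ‖M.normal F‖ = 1 := (M.int_facet F hF).2.2.2.1.1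
  have hFm : MeasurableSet F := ((M.isFacet_outer (M.mem_facets_plus hF).1).isCompact
    (M.cell _ (M.int_facet F hF).1)).measurableSet
  filter_upwards [ae_all_iff.2 key, ae_restrict_mem hFm] with x hx hxF
  rw [hv.jump_eq hF hxF]
  ext i
  have := hx i
  rw [real_inner_self_eq_norm_sq, hn, one_pow, mul_one] at this
  simpa using this

end Facets

/-! ### The error identity for the convective terms -/

section DivergenceFree

variable {d : ℕ} {Ω : Set (Vec d)} {M : Mesh Ω}

/-- An `L²` function that is orthogonal to itself vanishes almost everywhere. -/
theorem ae_eq_zero_of_integral_mul_self {μ : Measure (Vec d)} {q : Vec d → ℝ} (hq : MemLp q 2 μ)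
    (h : ∫ x, q x * q x ∂μ = 0) : q =ᵐ[μ] 0 := by
  have h1 := (integral_eq_zero_iff_of_nonneg (fun x => mul_self_nonneg (q x))
    (by simpa [pow_two] using hq.integrable_sq)).1 h
  filter_upwards [h1] with x hx using mul_self_eq_zero.1 hx

/-- Discretely divergence-free velocities are divergence-free, because `∇·V_h ⊆ Q_h`. -/
theorem FEPair.MemVhdiv.divergence_free (hΩ : IsOpen Ω) {P : FEPair M} {v : Vec d → Vec d}
    (hv : P.MemVhdiv v) :
    weakDiv Ω v =ᵐ[volume.restrict Ω] 0 ∧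
    ∀ φ : Vec d → ℝ, ContDiff ℝ ∞ φ → HasCompactSupport φ →
      ∫ x in Ω, fderiv ℝ φ x (v x) = 0 := by
  obtain ⟨q, hqQ, hq⟩ := P.divConf v hv.1
  have hwq := hq.weakDiv_ae_eq hΩ
  have hb := hv.2 q hqQ
  rw [bForm, neg_eq_zero] at hb
  have h0 : ∫ x in Ω, q x * q x = 0 := by
    rw [← hb]
    refine integral_congr_ae ?_
    filter_upwards [hwq] with x hx
    rw [hx]
  have hq0 := ae_eq_zero_of_integral_mul_self (P.l20 q hqQ).1 h0
  refine ⟨hwq.trans hq0, fun φ h1 h2 => ?_⟩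
  obtain ⟨-, g, hg2, hg⟩ := P.hdiv v hv.1
  have hgw : HasWeakDiv Ω v g := ⟨hq.1,
    locallyIntegrableOn_of_locallyIntegrable_restrict (hg2.locallyIntegrable one_le_two),
    fun φ h1 h2 _ => hg φ h1 h2⟩
  rw [hg φ h1 h2, neg_eq_zero]
  refine (integral_congr_ae ?_).trans (integral_zero _ _)
  filter_upwards [hgw.ae_unique hΩ hq, hq0] with x h1 h2
  simp [h1, h2]

/-- The divergence of a field in `H¹₀` has mean zero, so it is an admissible pressure; if it is
orthogonal to all pressures, it vanishes. -/
theorem MemVdiv.weakDiv_ae_eq_zero (hΩ : IsOpen Ω) (hb : Bornology.IsBounded Ω)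
    {v : Vec d → Vec d} (hv : MemVdiv Ω v) : weakDiv Ω v =ᵐ[volume.restrict Ω] 0 := by
  obtain ⟨G, hG, hG2, hGt⟩ := hv.1.exists_grad
  have hw := (hG.hasWeakDiv).weakDiv_ae_eq hΩ
  have ht2 : MemLp (fun x => traceCLM d (G x)) 2 (volume.restrict Ω) :=
    (traceCLM d).comp_memLp' hG2
  have hmean : ∫ x in Ω, traceCLM d (G x) = 0 := by
    obtain ⟨R, hR⟩ := hb.subset_ball (0 : Vec d)
    let φ : ContDiffBump (0 : Vec d) := ⟨max R 1, max R 1 + 1, by positivity, by linarith⟩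
    have hsub : Ω ⊆ Metric.ball (0 : Vec d) φ.rIn :=
      hR.trans (Metric.ball_subset_ball (le_max_left _ _))
    have hφ1 : ∀ x ∈ Ω, φ x = 1 := fun x hx =>
      φ.one_of_mem_closedBall (Metric.ball_subset_closedBall (hsub hx))
    have hφd : ∀ x ∈ Ω, fderiv ℝ φ x = 0 := fun x hx => by
      have : φ =ᶠ[𝓝 x] fun _ => (1 : ℝ) := by
        filter_upwards [hΩ.mem_nhds hx] with y hy using hφ1 y hy
      rw [this.fderiv_eq]
      simp
    have hφs : ContDiff ℝ ∞ φ := φ.contDiff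
    have key := integral_fderiv_apply_eq_of_integral_smul_eq (φ := φ) (G := G) (w := v)
      (volume.restrict Ω)
      (fun a => integrable_smul_of_memLp_two
        ((hφs.continuous_fderiv (by simp)).clm_apply continuous_const)
        (φ.hasCompactSupport.fderiv_apply (𝕜 := ℝ) a) hv.1.1)
      (fun a => ContinuousLinearMap.integrable_comp (ContinuousLinearMap.apply ℝ (Vec d) a)
          (integrable_smul_of_memLp_two hφs.continuous φ.hasCompactSupport hG2))
      (hGt φ hφs φ.hasCompactSupport)
    rw [setIntegral_congr_fun (g := fun _ => (0 : ℝ)) hΩ.measurableSet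
      (fun x hx => by simp [hφd x hx]), integral_zero,
      setIntegral_congr_fun (f := fun x => φ x * _) (g := fun x => traceCLM d (G x))
        hΩ.measurableSet (fun x hx => by simp [hφ1 x hx])] at key
    linarith
  have hb0 := hv.2 _ ⟨ht2, hmean⟩
  rw [bForm, neg_eq_zero] at hb0
  have h0 : ∫ x in Ω, traceCLM d (G x) * traceCLM d (G x) = 0 := by
    rw [← hb0]
    refine integral_congr_ae ?_
    filter_upwards [hw] with x hx
    rw [hx]
  exact hw.trans (ae_eq_zero_of_integral_mul_self ht2 h0)

end DivergenceFree

section Identity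

variable {d : ℕ} {Ω : Set (Vec d)} {M : Mesh Ω}

/-- Jump on an interior facet of a family of fields indexed by the elements. -/
def Mesh.pjump (M : Mesh Ω) (g : Set (Vec d) → Vec d → Vec d) (F : Set (Vec d)) (x : Vec d) :
    Vec d := g (M.plus F) x - g (M.minus F) x

/-- Average on an interior facet of a family of fields indexed by the elements. -/
def Mesh.pavg (M : Mesh Ω) (g : Set (Vec d) → Vec d → Vec d) (F : Set (Vec d)) (x : Vec d) :
    Vec d := (1 / 2 : ℝ) • (g (M.plus F) x + g (M.minus F) x)

theorem Mesh.measurableSet_facet {F : Set (Vec d)} (hF : F ∈ M.intFacets) : MeasurableSet F :=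
  ((M.int_facet F hF).2.2.2.1.isCompact (M.cell _ (M.int_facet F hF).1)).measurableSet

variable {w v β : Vec d → Vec d} {f g b e : Set (Vec d) → Vec d → Vec d}

theorem PiecewiseLip.continuousOn_sides (hg : PiecewiseLip M w g) {F : Set (Vec d)}
    (hF : F ∈ M.intFacets) : ContinuousOn (g (M.plus F)) F ∧ ContinuousOn (g (M.minus F)) F :=
  ⟨(hg _ (M.int_facet F hF).1).1.continuousOn.mono (M.facet_subset (M.mem_facets_plus hF).1),
    (hg _ (M.int_facet F hF).2.1).1.continuousOn.mono (M.facet_subset (M.mem_facets_minus hF).1)⟩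

theorem PiecewiseLip.continuousOn_pjump (hg : PiecewiseLip M w g) {F : Set (Vec d)}
    (hF : F ∈ M.intFacets) : ContinuousOn (M.pjump g F) F :=
  (hg.continuousOn_sides hF).1.sub (hg.continuousOn_sides hF).2

theorem PiecewiseLip.continuousOn_pavg (hg : PiecewiseLip M w g) {F : Set (Vec d)}
    (hF : F ∈ M.intFacets) : ContinuousOn (M.pavg g F) F :=
  ContinuousOn.const_smul (g := fun x => g (M.plus F) x + g (M.minus F) x)
    ((hg.continuousOn_sides hF).1.add (hg.continuousOn_sides hF).2) (1 / 2 : ℝ)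

theorem Mesh.integrableOn_facet {F : Set (Vec d)} (hF : F ∈ M.intFacets) {f : Vec d → ℝ}
    (hf : ContinuousOn f F) : IntegrableOn f F μHE[d - 1] :=
  (M.int_facet F hF).2.2.2.1.integrableOn (M.cell _ (M.int_facet F hF).1) hf

theorem continuousOn_centered_flux (hβ : PiecewiseLip M β b) (hw : PiecewiseLip M w f)
    (hv : PiecewiseLip M v e) {F : Set (Vec d)} (hF : F ∈ M.intFacets) :
    ContinuousOn (fun x => inner ℝ (M.pavg b F x) (M.normal F) *
      inner ℝ (M.pjump f F x) (M.pavg e F x)) F :=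
  ((hβ.continuousOn_pavg hF).inner continuousOn_const).mul
    ((hw.continuousOn_pjump hF).inner (hv.continuousOn_pavg hF))

theorem continuousOn_upwind_flux (hβ : PiecewiseLip M β b) (hw : PiecewiseLip M w f)
    (hv : PiecewiseLip M v e) {F : Set (Vec d)} (hF : F ∈ M.intFacets) :
    ContinuousOn (fun x => 1 / 2 * |inner ℝ (M.pavg b F x) (M.normal F)| *
      inner ℝ (M.pjump f F x) (M.pjump e F x)) F :=
  (continuousOn_const.mul ((hβ.continuousOn_pavg hF).inner continuousOn_const).abs).mul
    ((hw.continuousOn_pjump hF).inner (hv.continuousOn_pjump hF))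

/-- A product of a bounded derivative with Lipschitz fields is integrable on the element. -/
theorem integrableOn_inner_fderiv {K : Set (Vec d)} (hK : IsPolytopeCell K)
    {f b e : Vec d → Vec d} (hf : LipClosure K f) (hb : LipClosure K b) (he : LipClosure K e) :
    IntegrableOn (fun x => inner ℝ (fderiv ℝ f x (b x)) (e x)) K := by
  obtain ⟨A, hA⟩ := hf.exists_fderiv_bound hK.isOpen
  obtain ⟨B, hB⟩ := hb.exists_bound hK
  obtain ⟨E, hE⟩ := he.exists_bound hK
  refine IntegrableOn.of_bound hK.isBounded.measure_lt_top ?_ (A * B * E) ?_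
  · have h1 : AEStronglyMeasurable (fderiv ℝ f) (volume.restrict K) :=
      (measurable_fderiv ℝ f).aestronglyMeasurable
    have h2 : AEStronglyMeasurable (fun x => fderiv ℝ f x (b x)) (volume.restrict K) :=
      isBoundedBilinearMap_apply.continuous.comp_aestronglyMeasurable
        (h1.prodMk (hb.aestronglyMeasurable hK))
    exact h2.inner (he.aestronglyMeasurable hK)
  · filter_upwards [ae_restrict_mem hK.isOpen.measurableSet] with x hx
    have hx' := subset_closure hx
    have hA0 : 0 ≤ A := (norm_nonneg _).trans (hA x hx)
    have hB0 : 0 ≤ B := (norm_nonneg _).trans (hB x hx')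
    calc ‖inner ℝ (fderiv ℝ f x (b x)) (e x)‖ ≤ ‖fderiv ℝ f x (b x)‖ * ‖e x‖ :=
          norm_inner_le_norm _ _
      _ ≤ (‖fderiv ℝ f x‖ * ‖b x‖) * ‖e x‖ := by gcongr; exact (fderiv ℝ f x).le_opNorm _
      _ ≤ (A * B) * E := by
          gcongr
          exacts [hA x hx, hB x hx', hE x hx']

/-- The convective form with a divergence-free velocity, in terms of piecewise Lipschitz
representatives. -/
theorem ch_eq_of_piecewiseLip (hβ : PiecewiseLip M β b) (hw : PiecewiseLip M w f)
    (hv : PiecewiseLip M v e) (hdiv : weakDiv Ω β =ᵐ[volume.restrict Ω] 0) :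
    ch M β w v = (∑ K ∈ M.elems, ∫ x in K, inner ℝ (fderiv ℝ (f K) x (b K x)) (e K x))
      - ∑ F ∈ M.intFacets, ∫ x in F,
        (inner ℝ (M.pavg b F x) (M.normal F) * inner ℝ (M.pjump f F x) (M.pavg e F x)
        - 1 / 2 * |inner ℝ (M.pavg b F x) (M.normal F)| * inner ℝ (M.pjump f F x) (M.pjump e F x))
          ∂μHE[d - 1] := by
  have h1 : ∀ K ∈ M.elems, (fun x => inner ℝ (brokenGrad M w x (β x)) (v x))
      =ᵐ[volume.restrict K] fun x => inner ℝ (fderiv ℝ (f K) x (b K x)) (e K x) := by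
    intro K hK
    filter_upwards [hw.brokenGrad_ae_eq hK, (hβ K hK).2, (hv K hK).2] with x e1 e2 e3
    rw [e1, e2, e3]
  have hi : ∀ K ∈ M.elems,
      IntegrableOn (fun x => inner ℝ (fderiv ℝ (f K) x (b K x)) (e K x)) K := fun K hK =>
    integrableOn_inner_fderiv (M.cell K hK) (hw K hK).1 (hβ K hK).1 (hv K hK).1
  have h2 : ∫ x in Ω, weakDiv Ω β x * inner ℝ (w x) (v x) = 0 := by
    refine (integral_congr_ae ?_).trans (integral_zero _ _)
    filter_upwards [hdiv] with x hx
    simp [hx]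
  rw [ch, M.setIntegral_eq_sum fun K hK => (hi K hK).congr_fun_ae (h1 K hK).symm, h2, mul_zero,
    add_zero, Finset.sum_congr rfl fun K hK => integral_congr_ae (h1 K hK), sub_add,
    ← Finset.sum_sub_distrib]
  congr 1
  refine Finset.sum_congr rfl fun F hF => ?_
  rw [integral_sub (M.integrableOn_facet hF (continuousOn_centered_flux hβ hw hv hF))
    (M.integrableOn_facet hF (continuousOn_upwind_flux hβ hw hv hF))]
  congr 1
  · refine setIntegral_congr_fun (M.measurableSet_facet hF) fun x hx => ?_
    simp only [hβ.avg_eq hF hx, hw.jump_eq hF hx, hv.avg_eq hF hx, Mesh.pavg, Mesh.pjump]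
  · refine setIntegral_congr_fun (M.measurableSet_facet hF) fun x hx => ?_
    simp only [hβ.avg_eq hF hx, hw.jump_eq hF hx, hv.jump_eq hF hx, Mesh.pavg, Mesh.pjump]

theorem upwSq_eq_of_piecewiseLip (hβ : PiecewiseLip M β b) (hw : PiecewiseLip M w f) :
    upwSq M β w = ∑ F ∈ M.intFacets, ∫ x in F,
      1 / 2 * |inner ℝ (M.pavg b F x) (M.normal F)| * ‖M.pjump f F x‖ ^ 2 ∂μHE[d - 1] := by
  refine Finset.sum_congr rfl fun F hF =>
    setIntegral_congr_fun (M.measurableSet_facet hF) fun x hx => ?_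
  simp only [hβ.avg_eq hF hx, hw.jump_eq hF hx, Mesh.pavg, Mesh.pjump]

/-- Skew-symmetry of the convective form: for a divergence-free velocity with continuous normal
components, Green's formula for `½ |e|² b` turns the volume term into a facet term. -/
theorem PiecewiseLip.sum_integral_convective_self (hΩ : IsOpen Ω) (hΩr : interior (closure Ω) = Ω)
    (hβ : PiecewiseLip M β b) (hv : PiecewiseLip M v e)
    (hdiv : ∀ φ : Vec d → ℝ, ContDiff ℝ ∞ φ → HasCompactSupport φ →
      ∫ x in Ω, fderiv ℝ φ x (β x) = 0) :
    ∑ K ∈ M.elems, ∫ x in K, inner ℝ (fderiv ℝ (e K) x (b K x)) (e K x) =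
      ∑ F ∈ M.intFacets, ∫ x in F,
        inner ℝ (M.pavg b F x) (M.normal F) * inner ℝ (M.pjump e F x) (M.pavg e F x)
          ∂μHE[d - 1] := by
  obtain ⟨hb1, hb2, hb3⟩ := hβ.normal_continuity hΩ hΩr hdiv
  have hE : ∀ K ∈ M.elems, LipClosure K fun x => (1 / 2 : ℝ) • inner ℝ (e K x) (e K x) :=
    fun K hK => (lipClosure_const _).smul (M.cell K hK) ((hv K hK).1.inner (M.cell K hK) (hv K hK).1)
  have hgreen := M.sum_integral_pointDiv
    (V := fun K x => ((1 / 2 : ℝ) • inner ℝ (e K x) (e K x)) • b K x)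
    fun K hK => (hE K hK).smul (M.cell K hK) (hβ K hK).1
  have hbd : ∑ F ∈ M.bdFacets, ∫ x in F, inner ℝ
      (((1 / 2 : ℝ) • inner ℝ (e (M.plus F) x) (e (M.plus F) x)) • b (M.plus F) x) (M.normal F)
        ∂μHE[d - 1] = 0 := by
    refine Finset.sum_eq_zero fun F hF => (integral_congr_ae ?_).trans (integral_zero _ _)
    filter_upwards [hb3 F hF] with x hx
    rw [real_inner_smul_left, hx, mul_zero]
  rw [hbd, add_zero] at hgreen
  have hvol : ∀ K ∈ M.elems, ∫ x in K, pointDiv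
      (fun x => ((1 / 2 : ℝ) • inner ℝ (e K x) (e K x)) • b K x) x =
      ∫ x in K, inner ℝ (fderiv ℝ (e K) x (b K x)) (e K x) := by
    intro K hK
    refine integral_congr_ae ?_
    filter_upwards [hb1 K hK, (hv K hK).1.ae_differentiableAt (M.cell K hK).isOpen,
      (hβ K hK).1.ae_differentiableAt (M.cell K hK).isOpen] with x e1 e2 e3
    have hd : HasFDerivAt (fun x => (1 / 2 : ℝ) • inner ℝ (e K x) (e K x)) _ x :=
      (e2.hasFDerivAt.inner ℝ e2.hasFDerivAt).const_smul (1 / 2 : ℝ)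
    rw [pointDiv_smul hd.differentiableAt e3, e1, mul_zero, zero_add, hd.fderiv]
    simp [fderivInnerCLM_apply, real_inner_comm (e K x)]
    ring
  rw [Finset.sum_congr rfl hvol] at hgreen
  rw [hgreen]
  refine Finset.sum_congr rfl fun F hF => integral_congr_ae ?_
  filter_upwards [hb2 F hF] with x hx
  simp only [Mesh.pavg, Mesh.pjump, inner_sub_left, real_inner_smul_left, real_inner_smul_right,
    inner_add_left, inner_add_right, hx, smul_eq_mul,
    real_inner_comm (e (M.plus F) x) (e (M.minus F) x)]
  ring

/-- The error identity: the difference of the convective terms consists of the upwind dissipation,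
of volume terms and of facet terms that contain the jumps of `p`. -/
theorem convective_error_identity (hΩ : IsOpen Ω) (hΩr : interior (closure Ω) = Ω)
    {u uh p : Vec d → Vec d} {g : Vec d → Vec d} (hu : PiecewiseLip M u fun _ => g)
    (hp : PiecewiseLip M p f) (he : PiecewiseLip M (uh - p) e)
    (hudiv : weakDiv Ω u =ᵐ[volume.restrict Ω] 0)
    (huhdiv : weakDiv Ω uh =ᵐ[volume.restrict Ω] 0)
    (huht : ∀ φ : Vec d → ℝ, ContDiff ℝ ∞ φ → HasCompactSupport φ →
      ∫ x in Ω, fderiv ℝ φ x (uh x) = 0) :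
    ch M u u (uh - p) - ch M uh uh (uh - p) = - upwSq M uh (uh - p)
      + (∑ K ∈ M.elems, ∫ x in K, (inner ℝ (fderiv ℝ g x (g x)) (e K x) -
          inner ℝ (fderiv ℝ (f K) x (f K x + e K x)) (e K x)))
      + ∑ F ∈ M.intFacets, ∫ x in F,
        (inner ℝ (M.pavg (fun K x => f K x + e K x) F x) (M.normal F)
            * inner ℝ (M.pjump f F x) (M.pavg e F x)
          - 1 / 2 * |inner ℝ (M.pavg (fun K x => f K x + e K x) F x) (M.normal F)|
            * inner ℝ (M.pjump f F x) (M.pjump e F x)) ∂μHE[d - 1] := by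
  have huh : PiecewiseLip M uh fun K x => f K x + e K x := fun K hK => by
    refine ⟨(hp K hK).1.add (he K hK).1, ?_⟩
    filter_upwards [(hp K hK).2, (he K hK).2] with x h1 h2
    rw [← h1, ← h2]
    simp
  -- the part of the volume term of `c_h(u_h; u_h, e)` in which `e` itself is convected
  have hskew := huh.sum_integral_convective_self hΩ hΩr he huht
  rw [ch_eq_of_piecewiseLip hu hu he hudiv, ch_eq_of_piecewiseLip huh huh he huhdiv,
    upwSq_eq_of_piecewiseLip huh he]
  have hj : ∀ F ∈ M.intFacets, ∫ x in F,
        (inner ℝ (M.pavg (fun _ => g) F x) (M.normal F)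
          * inner ℝ (M.pjump (fun _ => g) F x) (M.pavg e F x)
        - 1 / 2 * |inner ℝ (M.pavg (fun _ => g) F x) (M.normal F)|
          * inner ℝ (M.pjump (fun _ => g) F x) (M.pjump e F x)) ∂μHE[d - 1] = 0 := fun F _ =>
    (integral_congr_ae (.of_forall fun x => by simp [Mesh.pjump])).trans (integral_zero _ _)
  rw [Finset.sum_eq_zero hj, sub_zero]
  have hvol : ∀ K ∈ M.elems,
      ∫ x in K, inner ℝ (fderiv ℝ (fun x => f K x + e K x) x (f K x + e K x)) (e K x) =
      (∫ x in K, inner ℝ (fderiv ℝ (f K) x (f K x + e K x)) (e K x)) +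
      ∫ x in K, inner ℝ (fderiv ℝ (e K) x (f K x + e K x)) (e K x) := by
    intro K hK
    have hc := M.cell K hK
    rw [← integral_add
      (integrableOn_inner_fderiv hc (hp K hK).1 (huh K hK).1 (he K hK).1)
      (integrableOn_inner_fderiv hc (he K hK).1 (huh K hK).1 (he K hK).1)]
    refine integral_congr_ae ?_
    filter_upwards [(hp K hK).1.ae_differentiableAt hc.isOpen,
      (he K hK).1.ae_differentiableAt hc.isOpen] with x h1 h2
    rw [fderiv_fun_add h1 h2, _root_.add_apply, inner_add_left]
  have hvol2 : ∀ K ∈ M.elems, ∫ x in K, (inner ℝ (fderiv ℝ g x (g x)) (e K x) -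
          inner ℝ (fderiv ℝ (f K) x (f K x + e K x)) (e K x)) =
      (∫ x in K, inner ℝ (fderiv ℝ g x (g x)) (e K x)) -
      ∫ x in K, inner ℝ (fderiv ℝ (f K) x (f K x + e K x)) (e K x) := fun K hK =>
    integral_sub
      (integrableOn_inner_fderiv (M.cell K hK) (hu K hK).1 (hu K hK).1 (he K hK).1)
      (integrableOn_inner_fderiv (M.cell K hK) (hp K hK).1 (huh K hK).1 (he K hK).1)
  rw [Finset.sum_congr rfl hvol, Finset.sum_congr rfl hvol2, Finset.sum_add_distrib,
    Finset.sum_sub_distrib, hskew]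
  -- the facet integrand is linear in the convected field `f + e`
  have hfac : ∀ F ∈ M.intFacets, ∫ x in F,
        (inner ℝ (M.pavg (fun K x => f K x + e K x) F x) (M.normal F)
            * inner ℝ (M.pjump (fun K x => f K x + e K x) F x) (M.pavg e F x)
          - 1 / 2 * |inner ℝ (M.pavg (fun K x => f K x + e K x) F x) (M.normal F)|
            * inner ℝ (M.pjump (fun K x => f K x + e K x) F x) (M.pjump e F x)) ∂μHE[d - 1] =
      (∫ x in F,
        (inner ℝ (M.pavg (fun K x => f K x + e K x) F x) (M.normal F)
            * inner ℝ (M.pjump f F x) (M.pavg e F x)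
          - 1 / 2 * |inner ℝ (M.pavg (fun K x => f K x + e K x) F x) (M.normal F)|
            * inner ℝ (M.pjump f F x) (M.pjump e F x)) ∂μHE[d - 1]) +
      (∫ x in F, inner ℝ (M.pavg (fun K x => f K x + e K x) F x) (M.normal F)
            * inner ℝ (M.pjump e F x) (M.pavg e F x) ∂μHE[d - 1]) -
      ∫ x in F, 1 / 2 * |inner ℝ (M.pavg (fun K x => f K x + e K x) F x) (M.normal F)|
            * ‖M.pjump e F x‖ ^ 2 ∂μHE[d - 1] := by
    intro F hF
    have i1 := M.integrableOn_facet hF (continuousOn_centered_flux huh hp he hF)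
    have i2 := M.integrableOn_facet hF (continuousOn_upwind_flux huh hp he hF)
    have i3 := M.integrableOn_facet hF (continuousOn_centered_flux huh he he hF)
    have i4 := M.integrableOn_facet hF (continuousOn_upwind_flux huh he he hF)
    simp only [real_inner_self_eq_norm_sq] at i4
    rw [← integral_add (i1.fun_sub i2) i3, ← integral_sub ((i1.fun_sub i2).fun_add i3) i4]
    refine integral_congr_ae (.of_forall fun x => ?_)
    have hsplit : M.pjump (fun K x => f K x + e K x) F x = M.pjump f F x + M.pjump e F x := by
      simp only [Mesh.pjump]; abel
    simp only [hsplit, inner_add_left, real_inner_self_eq_norm_sq]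
    ring
  rw [Finset.sum_congr rfl hfac, Finset.sum_sub_distrib, Finset.sum_add_distrib]
  ring

end Identity

/-! ### Norms of piecewise Lipschitz fields -/

section Norms

variable {d : ℕ} {Ω : Set (Vec d)} {M : Mesh Ω}

theorem continuous_frob : Continuous (frob : (Vec d →L[ℝ] Vec d) → ℝ) := by
  unfold frob frobInner
  fun_prop

theorem LipClosure.exists_frob_bound {K : Set (Vec d)} (hK : IsPolytopeCell K)
    {a : Vec d → Vec d} (ha : LipClosure K a) : ∃ C, ∀ x ∈ K, frob (fderiv ℝ a x) ≤ C := by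
  obtain ⟨C, hC⟩ := ha.exists_fderiv_bound hK.isOpen
  exact ⟨√d * C, fun x hx => (frob_le _).trans (by gcongr; exact hC x hx)⟩

theorem aestronglyMeasurable_frob_fderiv (a : Vec d → Vec d) (μ : Measure (Vec d)) :
    AEStronglyMeasurable (fun x => frob (fderiv ℝ a x)) μ :=
  (continuous_frob.measurable.comp (measurable_fderiv ℝ a)).aestronglyMeasurable

/-- The product of two functions bounded on a cell is integrable there. -/
theorem integrableOn_mul_of_bounded {K : Set (Vec d)} (hK : IsPolytopeCell K) {φ χ : Vec d → ℝ}
    (hφ : AEStronglyMeasurable φ (volume.restrict K))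
    (hχ : AEStronglyMeasurable χ (volume.restrict K))
    (hφb : ∃ C, ∀ x ∈ K, |φ x| ≤ C) (hχb : ∃ C, ∀ x ∈ K, |χ x| ≤ C) :
    IntegrableOn (fun x => φ x * χ x) K := by
  obtain ⟨A, hA⟩ := hφb
  obtain ⟨B, hB⟩ := hχb
  refine IntegrableOn.of_bound hK.isBounded.measure_lt_top (hφ.mul hχ) (A * B) ?_
  filter_upwards [ae_restrict_mem hK.isOpen.measurableSet] with x hx
  rw [Real.norm_eq_abs, abs_mul]
  exact mul_le_mul (hA x hx) (hB x hx) (abs_nonneg _) ((abs_nonneg _).trans (hA x hx))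

/-- Elementwise bounded functions are in `L²`. -/
theorem Mesh.memLp_two (hΩb : Bornology.IsBounded Ω) {φ : Vec d → ℝ}
    (h : ∀ K ∈ M.elems, AEStronglyMeasurable φ (volume.restrict K) ∧
      ∃ C, ∀ᵐ x ∂(volume.restrict K), |φ x| ≤ C) : MemLp φ 2 (volume.restrict Ω) := by
  have : IsFiniteMeasure ((volume : Measure (Vec d)).restrict Ω) :=
    ⟨by rw [Measure.restrict_apply_univ]; exact hΩb.measure_lt_top⟩
  have hi : IntegrableOn φ Ω := M.integrableOn fun K hK =>
    IntegrableOn.of_bound (M.cell K hK).isBounded.measure_lt_top (h K hK).1 _ (h K hK).2.choose_spec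
  choose! C hC using fun K hK => (h K hK).2
  refine MemLp.of_bound hi.aestronglyMeasurable (∑ K ∈ M.elems, |C K|)
    (M.ae_restrict_of_forall fun K hK => ?_)
  filter_upwards [hC K hK] with x hx
  exact (hx.trans (le_abs_self _)).trans
    (Finset.single_le_sum (f := fun K => |C K|) (fun K _ => abs_nonneg _) hK)

theorem sq_toReal_eLpNorm_two {μ : Measure (Vec d)} {E : Type*} [NormedAddCommGroup E]
    {φ : Vec d → E} (hφ : MemLp φ 2 μ) :
    (eLpNorm φ 2 μ).toReal ^ 2 = ∫ x, ‖φ x‖ ^ 2 ∂μ := by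
  rw [hφ.eLpNorm_eq_integral_rpow_norm two_ne_zero ENNReal.ofNat_ne_top,
    ENNReal.toReal_ofReal (by positivity), ← Real.rpow_natCast, ← Real.rpow_mul (by positivity)]
  simp

/-- Cauchy-Schwarz for functions given elementwise. -/
theorem Mesh.sum_integral_mul_le (M : Mesh Ω) {φ χ : Vec d → ℝ} {φ' χ' : Set (Vec d) → Vec d → ℝ}
    (hφ : MemLp φ 2 (volume.restrict Ω)) (hχ : MemLp χ 2 (volume.restrict Ω))
    (h1 : ∀ K ∈ M.elems, φ =ᵐ[volume.restrict K] φ' K)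
    (h2 : ∀ K ∈ M.elems, χ =ᵐ[volume.restrict K] χ' K) :
    ∑ K ∈ M.elems, ∫ x in K, φ' K x * χ' K x ≤
      (eLpNorm φ 2 (volume.restrict Ω)).toReal * (eLpNorm χ 2 (volume.restrict Ω)).toReal := by
  have hi : IntegrableOn (fun x => φ x * χ x) Ω := hφ.integrable_mul hχ
  have e : ∑ K ∈ M.elems, ∫ x in K, φ' K x * χ' K x = ∫ x in Ω, φ x * χ x := by
    rw [M.setIntegral_eq_sum fun K hK => hi.mono_set (M.subset K hK)]
    refine Finset.sum_congr rfl fun K hK => integral_congr_ae ?_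
    filter_upwards [h1 K hK, h2 K hK] with x e1 e2
    rw [e1, e2]
  rw [e]
  have h3 : ∫ x in Ω, φ x * χ x ≤ ∫ x in Ω, ‖φ x‖ * ‖χ x‖ :=
    integral_mono hi (hφ.norm.integrable_mul hχ.norm) fun x => by
      simpa [abs_mul] using le_abs_self (φ x * χ x)
  refine h3.trans ((integral_mul_le_Lp_mul_Lq_of_nonneg Real.HolderConjugate.two_two
    (.of_forall fun x => norm_nonneg _) (.of_forall fun x => norm_nonneg _)
    (by simpa using hφ.norm) (by simpa using hχ.norm)).trans_eq ?_)
  rw [hφ.eLpNorm_eq_integral_rpow_norm two_ne_zero ENNReal.ofNat_ne_top,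
    hχ.eLpNorm_eq_integral_rpow_norm two_ne_zero ENNReal.ofNat_ne_top,
    ENNReal.toReal_ofReal (by positivity), ENNReal.toReal_ofReal (by positivity)]
  simp

variable {w : Vec d → Vec d} {a : Set (Vec d) → Vec d → Vec d}

theorem PiecewiseLip.memLp_norm (hΩb : Bornology.IsBounded Ω) (hw : PiecewiseLip M w a) :
    MemLp (fun x => ‖w x‖) 2 (volume.restrict Ω) := by
  refine M.memLp_two hΩb fun K hK => ⟨?_, ?_⟩
  · exact (((hw K hK).1.aestronglyMeasurable (M.cell K hK)).congr (hw K hK).2.symm).norm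
  · obtain ⟨C, hC⟩ := (hw K hK).1.exists_bound (M.cell K hK)
    refine ⟨C, ?_⟩
    filter_upwards [(hw K hK).2, ae_restrict_mem (M.cell K hK).isOpen.measurableSet] with x h1 h2
    rw [h1, abs_of_nonneg (norm_nonneg _)]
    exact hC x (subset_closure h2)

theorem PiecewiseLip.memLp_frob (hΩb : Bornology.IsBounded Ω) (hw : PiecewiseLip M w a) :
    MemLp (fun x => frob (brokenGrad M w x)) 2 (volume.restrict Ω) := by
  refine M.memLp_two hΩb fun K hK => ⟨?_, ?_⟩
  · refine (aestronglyMeasurable_frob_fderiv (a K) _).congr ?_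
    filter_upwards [hw.brokenGrad_ae_eq hK] with x hx
    rw [hx]
  · obtain ⟨C, hC⟩ := (hw K hK).1.exists_frob_bound (M.cell K hK)
    refine ⟨C, ?_⟩
    filter_upwards [hw.brokenGrad_ae_eq hK, ae_restrict_mem (M.cell K hK).isOpen.measurableSet]
      with x h1 h2
    rw [h1, abs_of_nonneg (frob_nonneg _)]
    exact hC x h2

theorem normL2_eq (Ω : Set (Vec d)) (w : Vec d → Vec d) :
    normL2 Ω w = (eLpNorm (fun x => ‖w x‖) 2 (volume.restrict Ω)).toReal := by
  rw [normL2, eLpNorm_norm]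

theorem PiecewiseLip.sum_integral_sq (hΩb : Bornology.IsBounded Ω) (hw : PiecewiseLip M w a) :
    ∑ K ∈ M.elems, ∫ x in K, ‖a K x‖ ^ 2 = normL2 Ω w ^ 2 := by
  have hm := hw.memLp_norm hΩb
  have hi : IntegrableOn (fun x => ‖w x‖ ^ 2) Ω := hm.integrable_sq
  rw [normL2_eq, sq_toReal_eLpNorm_two hm]
  simp only [norm_norm]
  rw [M.setIntegral_eq_sum fun K hK => hi.mono_set (M.subset K hK)]
  refine Finset.sum_congr rfl fun K hK => integral_congr_ae ?_
  filter_upwards [(hw K hK).2] with x hx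
  rw [hx]

theorem PiecewiseLip.sum_integral_norm_mul_norm (hΩb : Bornology.IsBounded Ω)
    (hw : PiecewiseLip M w a) {v : Vec d → Vec d} {e : Set (Vec d) → Vec d → Vec d}
    (hv : PiecewiseLip M v e) :
    ∑ K ∈ M.elems, ∫ x in K, ‖a K x‖ * ‖e K x‖ ≤ normL2 Ω w * normL2 Ω v := by
  rw [normL2_eq, normL2_eq]
  exact M.sum_integral_mul_le (hw.memLp_norm hΩb) (hv.memLp_norm hΩb)
    (fun K hK => (hw K hK).2.fun_comp norm) fun K hK => (hv K hK).2.fun_comp norm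

theorem PiecewiseLip.sum_integral_frob_mul_norm (hΩb : Bornology.IsBounded Ω)
    (hw : PiecewiseLip M w a) {v : Vec d → Vec d} {e : Set (Vec d) → Vec d → Vec d}
    (hv : PiecewiseLip M v e) :
    ∑ K ∈ M.elems, ∫ x in K, frob (fderiv ℝ (a K) x) * ‖e K x‖ ≤
      tnormL2 Ω (brokenGrad M w) * normL2 Ω v := by
  rw [normL2_eq]
  exact M.sum_integral_mul_le (hw.memLp_frob hΩb) (hv.memLp_norm hΩb)
    (fun K hK => (hw.brokenGrad_ae_eq hK).fun_comp frob) fun K hK => (hv K hK).2.fun_comp norm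

end Norms

/-! ### Trace inequalities -/

section Trace

variable {d : ℕ} {Ω : Set (Vec d)} {M : Mesh Ω}

/-- The integrals of `φ K` over the boundary of `K`, summed over all elements. -/
def Mesh.skeletonSum (M : Mesh Ω) (φ : Set (Vec d) → Vec d → ℝ) : ℝ :=
  ∑ K ∈ M.elems, ∑ F ∈ M.facets K, ∫ x in F, φ K x ∂μHE[d - 1]

/-- Trace inequality on a cell that contains a ball of radius `r` about `x₀`: Green's formula for
the field `f(x) (x - x₀)`, whose normal component is at least `r f` on the boundary. -/
theorem Mesh.mul_sum_integral_facets_le {K : Set (Vec d)} (hK : K ∈ M.elems) {x₀ : Vec d} {r : ℝ}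
    (hr : 0 < r) (hball : Metric.ball x₀ r ⊆ K) {f : Vec d → ℝ} (hf : LipClosure K f)
    (hf0 : ∀ x ∈ closure K, 0 ≤ f x) {G : Vec d → ℝ} (hG : IntegrableOn G K)
    (hfG : ∀ᵐ x ∂(volume.restrict K), ‖fderiv ℝ f x‖ ≤ G x) :
    r * ∑ F ∈ M.facets K, ∫ x in F, f x ∂μHE[d - 1] ≤
      d * (∫ x in K, f x) + Metric.diam K * ∫ x in K, G x := by
  have hc := M.cell K hK
  have hlip : LipClosure K fun x : Vec d => x - x₀ :=
    (LipschitzWith.id.sub (LipschitzWith.const x₀)).lipClosure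
  have hV := hf.smul hc hlip
  have hgreen := M.integral_pointDiv hK hV
  have hdiv : ∀ x : Vec d, pointDiv (fun x : Vec d => x - x₀) x = d := fun x => by
    simp [pointDiv, fderiv_sub_const]
  have hle : ∫ x in K, pointDiv (fun x => f x • (x - x₀)) x ≤
      ∫ x in K, (d * f x + Metric.diam K * G x) := by
    refine integral_mono_ae (hV.integrableOn_pointDiv hc)
      (((hf.integrableOn hc).const_mul _).add (hG.const_mul _)) ?_
    filter_upwards [hfG, hf.ae_differentiableAt hc.isOpen,
      ae_restrict_mem hc.isOpen.measurableSet] with x h1 h2 h3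
    rw [pointDiv_smul h2 (by fun_prop), hdiv]
    have h4 : fderiv ℝ f x (x - x₀) ≤ G x * Metric.diam K := by
      have h5 : ‖x - x₀‖ ≤ Metric.diam K := by
        rw [← dist_eq_norm]
        exact Metric.dist_le_diam_of_mem hc.isBounded h3 (hball (Metric.mem_ball_self hr))
      calc fderiv ℝ f x (x - x₀) ≤ ‖fderiv ℝ f x (x - x₀)‖ := le_abs_self _
        _ ≤ ‖fderiv ℝ f x‖ * ‖x - x₀‖ := (fderiv ℝ f x).le_opNorm _
        _ ≤ G x * Metric.diam K := mul_le_mul h1 h5 (norm_nonneg _) ((norm_nonneg _).trans h1)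
    linarith
  rw [integral_add ((hf.integrableOn hc).const_mul _) (hG.const_mul _), integral_const_mul,
    integral_const_mul, hgreen] at hle
  refine le_trans ?_ hle
  rw [Finset.mul_sum]
  refine Finset.sum_le_sum fun F hF => ?_
  have hfac := M.isFacet_outer hF
  have hcF : ContinuousOn f F := hf.continuousOn.mono (M.facet_subset hF)
  rw [← integral_const_mul]
  refine setIntegral_mono_on ((hfac.integrableOn hc hcF).const_mul r)
    (hfac.integrableOn hc ((hV.continuousOn.mono (M.facet_subset hF)).inner continuousOn_const))
    (hfac.isCompact hc).measurableSet fun x hx => ?_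
  have hxF := hx
  rw [hfac.2.1] at hxF
  -- the ball of radius `r` about `x₀` lies behind the hyperplane of the facet
  have hn : r ≤ inner ℝ (x - x₀) (M.outer K F) := by
    refine le_of_forall_lt_imp_le_of_dense fun s hs => ?_
    rcases le_or_gt 0 s with h0 | h0
    · have hy : x₀ + s • M.outer K F ∈ K := hball (by
        rw [Metric.mem_ball, dist_eq_norm, add_sub_cancel_left, norm_smul, hfac.1, mul_one,
          Real.norm_eq_abs, abs_of_nonneg h0]
        exact hs)
      have := hxF.2 _ hy
      rw [inner_add_right, real_inner_smul_right, real_inner_self_eq_norm_sq, hfac.1] at this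
      rw [inner_sub_left, real_inner_comm, real_inner_comm _ x₀]
      linarith
    · have := hxF.2 _ (hball (Metric.mem_ball_self hr))
      rw [inner_sub_left, real_inner_comm, real_inner_comm _ x₀]
      linarith
  rw [real_inner_smul_left, mul_comm]
  exact mul_le_mul_of_nonneg_left hn (hf0 x hxF.1)

theorem Mesh.diam_pos (hd : d ≠ 0) {K : Set (Vec d)} (hK : K ∈ M.elems) : 0 < Metric.diam K := by
  have hc := M.cell K hK
  have : Nontrivial (Vec d) := by
    have : Nonempty (Fin d) := ⟨⟨0, Nat.pos_of_ne_zero hd⟩⟩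
    infer_instance
  obtain ⟨x, hx⟩ := hc.1
  have hnt : K.Nontrivial := by
    by_contra h
    rw [Set.not_nontrivial_iff] at h
    have hK1 : K = {x} := h.eq_singleton_of_mem hx
    have := hc.isOpen
    rw [hK1] at this
    exact not_isOpen_singleton x this
  obtain ⟨y, hy, hxy⟩ := hnt.exists_ne x
  exact (dist_pos.2 hxy).trans_le (Metric.dist_le_diam_of_mem hc.isBounded hy hx)

theorem Mesh.diam_le_h {K : Set (Vec d)} (hK : K ∈ M.elems) : Metric.diam K ≤ M.h :=
  le_csSup ((M.elems.finite_toSet.image _).bddAbove) ⟨K, hK, rfl⟩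

theorem Mesh.elems_nonempty (hΩ : Ω.Nonempty) : M.elems.Nonempty := by
  obtain ⟨x, hx⟩ := hΩ
  have := subset_closure hx
  rw [M.cover] at this
  obtain ⟨K, hK, -⟩ := Set.mem_iUnion₂.1 this
  exact ⟨K, hK⟩

theorem Mesh.h_pos (hd : d ≠ 0) (hΩ : Ω.Nonempty) : 0 < M.h := by
  obtain ⟨K, hK⟩ := M.elems_nonempty hΩ
  exact (M.diam_pos hd hK).trans_le (M.diam_le_h hK)

theorem Mesh.h_le_diam (hΩ : Ω.Nonempty) (hΩb : Bornology.IsBounded Ω) :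
    M.h ≤ Metric.diam Ω := by
  obtain ⟨K, hK⟩ := M.elems_nonempty hΩ
  refine csSup_le ⟨_, K, hK, rfl⟩ ?_
  rintro _ ⟨K, hK, rfl⟩
  exact Metric.diam_mono (M.subset K hK) hΩb

theorem Mesh.QuasiUniform.inv_diam_le {θ : ℝ} (hθ : M.QuasiUniform θ) (hd : d ≠ 0)
    (hΩ : Ω.Nonempty) {K : Set (Vec d)} (hK : K ∈ M.elems) :
    (Metric.diam K)⁻¹ ≤ |θ| * M.h⁻¹ := by
  have h1 := M.diam_pos hd hK
  have h2 := M.h_pos hd hΩ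
  rw [← div_eq_mul_inv, le_div_iff₀ h2, inv_mul_le_iff₀ h1]
  have := hθ K hK
  nlinarith [le_abs_self θ]

/-- The continuous trace inequality, summed over the elements of a quasi-uniform mesh. -/
theorem Mesh.skeletonSum_le (hd : d ≠ 0) (hΩ : Ω.Nonempty) {κ θ : ℝ} (hκ : 0 < κ)
    (hM : M.ShapeRegular κ) (hθ : M.QuasiUniform θ) {f G : Set (Vec d) → Vec d → ℝ}
    (hf : ∀ K ∈ M.elems, LipClosure K (f K)) (hf0 : ∀ K ∈ M.elems, ∀ x ∈ closure K, 0 ≤ f K x)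
    (hG : ∀ K ∈ M.elems, IntegrableOn (G K) K)
    (hfG : ∀ K ∈ M.elems, ∀ᵐ x ∂(volume.restrict K), ‖fderiv ℝ (f K) x‖ ≤ G K x) :
    M.skeletonSum f ≤ κ⁻¹ * (d * |θ| * M.h⁻¹ * (∑ K ∈ M.elems, ∫ x in K, f K x)
      + ∑ K ∈ M.elems, ∫ x in K, G K x) := by
  rw [Mesh.skeletonSum, le_inv_mul_iff₀ hκ, Finset.mul_sum, Finset.mul_sum,
    ← Finset.sum_add_distrib]
  refine Finset.sum_le_sum fun K hK => ?_
  obtain ⟨x₀, hx₀⟩ := hM K hK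
  have hK0 := M.diam_pos hd hK
  have h1 := M.mul_sum_integral_facets_le hK (mul_pos hκ hK0) hx₀ (hf K hK) (hf0 K hK) (hG K hK)
    (hfG K hK)
  have hi0 : 0 ≤ ∫ x in K, f K x := setIntegral_nonneg (M.cell K hK).isOpen.measurableSet
    fun x hx => hf0 K hK x (subset_closure hx)
  have h2 : d * (Metric.diam K)⁻¹ * (∫ x in K, f K x) ≤
      d * |θ| * M.h⁻¹ * (∫ x in K, f K x) := by
    rw [mul_assoc (d : ℝ) |θ|]
    gcongr
    exact hθ.inv_diam_le hd hΩ hK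
  refine le_trans ?_ (add_le_add_left h2 _)
  have h3 : d * (Metric.diam K)⁻¹ * (∫ x in K, f K x) + ∫ x in K, G K x =
      (Metric.diam K)⁻¹ * (d * (∫ x in K, f K x) + Metric.diam K * ∫ x in K, G K x) := by
    field_simp
  rw [h3, le_inv_mul_iff₀ hK0]
  calc _ = κ * Metric.diam K * ∑ F ∈ M.facets K, ∫ x in F, f K x ∂μHE[d - 1] := by ring
    _ ≤ _ := h1

theorem Mesh.facet_subset_frontier {K F : Set (Vec d)} (hK : K ∈ M.elems) (hF : F ∈ M.facets K) :
    F ⊆ frontier K := by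
  obtain ⟨c, hc, hFc⟩ := M.exists_polyhedron hK
  intro x hx
  rw [(M.cell K hK).isOpen.frontier_eq]
  refine ⟨M.facet_subset hF hx, fun hxK => ?_⟩
  rw [hc] at hxK
  have hx' : x ∈ (((⟨F, hF⟩ : M.facets K) : Set (Vec d))) := hx
  rw [hFc ⟨F, hF⟩] at hx'
  exact (hxK ⟨F, hF⟩).ne hx'.1

/-- Distinct facets of one cell meet in a null set. This needs no assumption on `Ω`. -/
theorem Mesh.aedisjoint_facets {K F F' : Set (Vec d)} (hK : K ∈ M.elems) (hF : F ∈ M.facets K)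
    (hF' : F' ∈ M.facets K) (hne : F ≠ F') : (μHE[d - 1] : Measure (Vec d)) (F ∩ F') = 0 := by
  obtain ⟨c, hc, hFc⟩ := M.exists_polyhedron hK
  have hn : ∀ G : M.facets K, ‖M.outer K G‖ = 1 := fun G => (M.isFacet_outer G.2).1
  have hne' : (polyhedron (fun G : M.facets K => M.outer K G) c).Nonempty := hc ▸ (M.cell K hK).1
  have e1 : F = polyFace (fun G : M.facets K => M.outer K G) c ⟨F, hF⟩ := hFc ⟨F, hF⟩
  have e2 : F' = polyFace (fun G : M.facets K => M.outer K G) c ⟨F', hF'⟩ := hFc ⟨F', hF'⟩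
  rw [measure_hyperplane (hn ⟨F, hF⟩) (c ⟨F, hF⟩) (fun x hx => by
      have := hx.1; rw [e1] at this; exact this.1)]
  refine measure_mono_null (fun y hy => ?_)
    (ae_iff.1 (ae_ne_face hn M.outer_injective hne' ⟨F, hF⟩))
  have h2 := hy.2
  rw [e2] at h2
  intro h
  exact h ⟨F', hF'⟩ (fun h => hne (congrArg Subtype.val h).symm) h2.1

/-- The discrete trace inequality in terms of a representative that is Lipschitz up to the boundary
of the element. -/
theorem DiscreteTrace.sum_integral_le {P : FEPair M} {C : ℝ} (hC : DiscreteTrace P C)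
    (hd : d ≠ 0) {v : Vec d → Vec d} (hv : v ∈ P.Vh) {e : Set (Vec d) → Vec d → Vec d}
    (he : PiecewiseLip M v e) {K : Set (Vec d)} (hK : K ∈ M.elems) :
    ∑ F ∈ M.facets K, ∫ x in F, ‖e K x‖ ^ 2 ∂μHE[d - 1] ≤
      C ^ 2 * (Metric.diam K)⁻¹ * ∫ x in K, ‖e K x‖ ^ 2 := by
  have hc := M.cell K hK
  have hK0 := M.diam_pos hd hK
  have h := hC v hv K hK
  have hcont : ∀ F ∈ M.facets K, ContinuousOn (fun x => ‖e K x‖ ^ 2) F := fun F hF =>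
    ((he K hK).1.continuousOn.mono (M.facet_subset hF)).norm.pow 2
  have hsq : ∀ x, ENNReal.ofReal (‖e K x‖ ^ 2) = ‖e K x‖ₑ ^ (2 : ℝ) := fun x => by
    rw [ENNReal.ofReal_pow (norm_nonneg _), ofReal_norm, ENNReal.rpow_two]
  -- the square of the left-hand side bounds the sum of the facet integrals
  have hleft : ENNReal.ofReal (∑ F ∈ M.facets K, ∫ x in F, ‖e K x‖ ^ 2 ∂μHE[d - 1]) ≤
      eLpNorm (tr K v) 2 ((μHE[d - 1] : Measure (Vec d)).restrict (frontier K)) ^ (2 : ℝ) := by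
    have e1 : eLpNorm (tr K v) 2 ((μHE[d - 1] : Measure (Vec d)).restrict (frontier K)) ^ (2 : ℝ) =
        ∫⁻ x in frontier K, ‖tr K v x‖ₑ ^ (2 : ℝ) ∂μHE[d - 1] := by
      have := eLpNorm_nnreal_pow_eq_lintegral (f := tr K v) (p := 2)
        (μ := (μHE[d - 1] : Measure (Vec d)).restrict (frontier K)) two_ne_zero
      simpa using this
    rw [e1]
    calc _ = ∑ F ∈ M.facets K, ∫⁻ x in F, ‖tr K v x‖ₑ ^ (2 : ℝ) ∂μHE[d - 1] := by
          rw [ENNReal.ofReal_sum_of_nonneg fun F _ => integral_nonneg fun x => sq_nonneg _]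
          refine Finset.sum_congr rfl fun F hF => ?_
          have hFf := M.isFacet_outer hF
          rw [ofReal_integral_eq_lintegral_ofReal (hFf.integrableOn hc (hcont F hF))
            (.of_forall fun x => sq_nonneg _)]
          refine setLIntegral_congr_fun (hFf.isCompact hc).measurableSet fun x hx => ?_
          rw [hsq, tr_eq_of_lipClosure hc (he K hK).1 (he K hK).2 (M.facet_subset hF hx)]
      _ = ∫⁻ x in ⋃ F ∈ M.facets K, F, ‖tr K v x‖ₑ ^ (2 : ℝ) ∂μHE[d - 1] := by
          refine (lintegral_biUnion_finset₀ (fun F hF F' hF' hne =>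
            M.aedisjoint_facets hK hF hF' hne) (fun F hF =>
            ((M.isFacet_outer hF).isCompact hc).measurableSet.nullMeasurableSet) _).symm
      _ ≤ _ := lintegral_mono_set (Set.iUnion₂_subset fun F hF => M.facet_subset_frontier hK hF)
  have hint : IntegrableOn (fun x => ‖e K x‖ ^ 2) K :=
    (((he K hK).1.continuousOn.norm.pow 2).integrableOn_compact hc.isCompact_closure).mono_set
      subset_closure
  have hright : eLpNorm v 2 (volume.restrict K) ^ (2 : ℝ) =
      ENNReal.ofReal (∫ x in K, ‖e K x‖ ^ 2) := by
    rw [eLpNorm_congr_ae (he K hK).2, ofReal_integral_eq_lintegral_ofReal hint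
      (.of_forall fun x => sq_nonneg _)]
    have := eLpNorm_nnreal_pow_eq_lintegral (f := e K) (p := 2)
        (μ := volume.restrict K) two_ne_zero
    simp only [hsq]
    simpa using this
  have h2 := hleft.trans (ENNReal.rpow_le_rpow h zero_le_two)
  have hpow : (C * Metric.diam K ^ (-(1 / 2) : ℝ)) ^ 2 = C ^ 2 * (Metric.diam K)⁻¹ := by
    rw [mul_pow, ← Real.rpow_natCast (Metric.diam K ^ (-(1 / 2) : ℝ)), ← Real.rpow_mul hK0.le]
    norm_num [Real.rpow_neg_one]
  have hconst : ENNReal.ofReal (C * Metric.diam K ^ (-(1 / 2) : ℝ)) ^ 2 ≤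
      ENNReal.ofReal (C ^ 2 * (Metric.diam K)⁻¹) := by
    rw [← hpow, ← sq_abs (C * _), ENNReal.ofReal_pow (abs_nonneg _)]
    gcongr
    exact le_abs_self _
  rw [ENNReal.mul_rpow_of_nonneg _ _ zero_le_two, hright, ENNReal.rpow_two] at h2
  have h3 := h2.trans (mul_le_mul_left hconst _)
  rw [← ENNReal.ofReal_mul (by positivity)] at h3
  exact (ENNReal.ofReal_le_ofReal_iff (mul_nonneg (by positivity)
    (integral_nonneg fun x => sq_nonneg _))).1 h3

end Trace

/-! ### Estimates of the volume and facet terms -/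

section Elementary

/-- Optimizing `τ` in `X ≤ τ a + τ⁻¹ b`. -/
theorem sq_le_of_forall_le_add {X a b : ℝ} (hX : 0 ≤ X) (ha : 0 ≤ a) (hb : 0 ≤ b)
    (h : ∀ τ : ℝ, 0 < τ → X ≤ τ * a + τ⁻¹ * b) : X ^ 2 ≤ 4 * a * b := by
  rcases hX.eq_or_lt with rfl | hX
  · rw [zero_pow two_ne_zero]; positivity
  rcases ha.eq_or_lt with rfl | ha
  -- for `a = 0` the hypothesis with large `τ` contradicts `X > 0`
  · exfalso
    have h1 := h (b / X + 1) (by positivity)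
    rw [mul_zero, zero_add, ← div_eq_inv_mul, le_div_iff₀ (by positivity)] at h1
    have : X * (b / X + 1) = b + X := by field_simp
    linarith
  · have h1 := h (X / (2 * a)) (by positivity)
    have h2 : X / (2 * a) * a = X / 2 := by field_simp
    have h3 : (X / (2 * a))⁻¹ * b = 2 * a * b / X := by field_simp
    rw [h2, h3] at h1
    have h4 : X / 2 ≤ 2 * a * b / X := by linarith
    rw [le_div_iff₀ hX] at h4
    nlinarith

theorem two_mul_le_young {x y τ : ℝ} (hτ : 0 < τ) : 2 * (x * y) ≤ τ * x ^ 2 + τ⁻¹ * y ^ 2 := by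
  have h := sq_nonneg (τ * x - y)
  have : 0 ≤ τ⁻¹ * (τ * x - y) ^ 2 := by positivity
  have e : τ⁻¹ * (τ * x - y) ^ 2 = τ * x ^ 2 - 2 * (x * y) + τ⁻¹ * y ^ 2 := by
    field_simp
    ring
  linarith

/-- Distributing the error terms with Young's inequality. -/
theorem le_of_young {X U L A B D h C₁ C₂ C ε₁ ε₂ ε₃ ε₄ : ℝ} (hU : 0 ≤ U) (hL : 0 ≤ L)
    (hA : 0 ≤ A) (hB : 0 ≤ B) (hh : 0 < h) (hC0 : 0 ≤ C) (hC₁ : C₁ ≤ C) (hC₂ : C₂ ≤ C)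
    (h1 : 0 < ε₁) (h2 : 0 < ε₂) (h3 : 0 < ε₃) (h4 : 0 < ε₄)
    (hX : X ≤ 2 * U * D * B + C₁ * h⁻¹ * L * (A * B) + C₂ * L * B ^ 2) :
    X ≤ ε₁⁻¹ * U * D ^ 2 + (ε₂⁻¹ + C * (ε₃⁻¹ + ε₄⁻¹) * h⁻¹) * L * A ^ 2 +
      (ε₁ * U + (C + ε₂ + C * (ε₃ + ε₄) * h⁻¹) * L) * B ^ 2 := by
  have y1 := mul_le_mul_of_nonneg_left (two_mul_le_young (x := B) (y := D) h1) hU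
  have y3 := two_mul_le_young (x := B) (y := A) h3
  have hAB : 0 ≤ A * B := mul_nonneg hA hB
  have hhL : 0 ≤ h⁻¹ * L := by positivity
  have z1 : C₁ * h⁻¹ * L * (A * B) ≤ C * (h⁻¹ * L) * (A * B) := by
    rw [mul_assoc C₁]; gcongr
  have z2 : C₂ * L * B ^ 2 ≤ C * L * B ^ 2 := by gcongr
  have z3 : C * (h⁻¹ * L) * (A * B) ≤ C * (h⁻¹ * L) * (ε₃ * B ^ 2 + ε₃⁻¹ * A ^ 2) := by
    gcongr
    linarith
  have w1 : 0 ≤ ε₂⁻¹ * L * A ^ 2 := by positivity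
  have w2 : 0 ≤ ε₂ * L * B ^ 2 := by positivity
  have w3 : 0 ≤ C * (h⁻¹ * L) * (ε₄ * B ^ 2 + ε₄⁻¹ * A ^ 2) := by positivity
  linarith

end Elementary

section Estimates

variable {d : ℕ} {Ω : Set (Vec d)} {M : Mesh Ω} {u p v : Vec d → Vec d} {g : Vec d → Vec d}
  {f e : Set (Vec d) → Vec d → Vec d}

/-- A continuous function that is bounded almost everywhere on a cell is bounded on its closure. -/
theorem le_of_ae_le_of_continuousOn {K : Set (Vec d)} (hK : IsOpen K) {φ : Vec d → ℝ}
    (hφ : ContinuousOn φ (closure K)) {H : ℝ} (h : ∀ᵐ x ∂(volume.restrict K), φ x ≤ H) :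
    ∀ x ∈ closure K, φ x ≤ H := by
  have hopen : IsOpen (K ∩ φ ⁻¹' Set.Ioi H) :=
    (hφ.mono subset_closure).isOpen_inter_preimage hK isOpen_Ioi
  have hnull : volume (K ∩ φ ⁻¹' Set.Ioi H) = 0 := by
    have h1 := (ae_restrict_iff' hK.measurableSet).1 h
    refine measure_mono_null (fun x hx => ?_) (ae_iff.1 h1)
    exact fun h2 => not_lt.2 (h2 hx.1) hx.2
  have hempty := hopen.eq_empty_of_measure_zero hnull
  refine fun x hx => le_on_closure (fun y hy => ?_) hφ continuousOn_const hx
  by_contra hlt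
  have : y ∈ K ∩ φ ⁻¹' Set.Ioi H := ⟨hy, not_le.1 hlt⟩
  rw [hempty] at this
  exact this

/-- The volume terms: the velocity is bounded by `U` and the gradient of the Stokes projection
by `N`. -/
theorem volume_terms_le (hΩb : Bornology.IsBounded Ω) (hu : PiecewiseLip M u fun _ => g)
    (hp : PiecewiseLip M p f) (hv : PiecewiseLip M v e) {U N : ℝ}
    (hU : ∀ K ∈ M.elems, ∀ x ∈ closure K, ‖g x‖ ≤ U) (hU0 : 0 ≤ U) (hN0 : 0 ≤ N)
    (hN : ∀ K ∈ M.elems, ∀ᵐ x ∂(volume.restrict K), frob (fderiv ℝ (f K) x) ≤ N) :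
    ∑ K ∈ M.elems, ∫ x in K, (inner ℝ (fderiv ℝ g x (g x)) (e K x) -
        inner ℝ (fderiv ℝ (f K) x (f K x + e K x)) (e K x)) ≤
      U * (tnormL2 Ω (brokenGrad M (u - p)) * normL2 Ω v) +
        N * (normL2 Ω (u - p) * normL2 Ω v) + N * normL2 Ω v ^ 2 := by
  have hη := hu.sub hp
  have h1 := hη.sum_integral_frob_mul_norm hΩb hv
  have h2 := hη.sum_integral_norm_mul_norm hΩb hv
  have h3 := hv.sum_integral_sq hΩb
  refine le_trans ?_ (add_le_add (add_le_add (mul_le_mul_of_nonneg_left h1 hU0)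
    (mul_le_mul_of_nonneg_left h2 hN0)) (mul_le_mul_of_nonneg_left h3.le hN0))
  rw [Finset.mul_sum, Finset.mul_sum, Finset.mul_sum, ← Finset.sum_add_distrib,
    ← Finset.sum_add_distrib]
  refine Finset.sum_le_sum fun K hK => ?_
  have hc := M.cell K hK
  have bnorm : ∀ {w : Vec d → Vec d}, LipClosure K w → ∃ C, ∀ x ∈ K, |‖w x‖| ≤ C := fun hw => by
    obtain ⟨C, hC⟩ := hw.exists_bound hc
    exact ⟨C, fun x hx => by rw [abs_norm]; exact hC x (subset_closure hx)⟩
  have bfrob : ∃ C, ∀ x ∈ K, |frob (fderiv ℝ (fun x => g x - f K x) x)| ≤ C := by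
    obtain ⟨C, hC⟩ := (hη K hK).1.exists_frob_bound hc
    exact ⟨C, fun x hx => by rw [abs_of_nonneg (frob_nonneg _)]; exact hC x hx⟩
  have me := ((hv K hK).1.aestronglyMeasurable hc).norm
  have i1 : IntegrableOn (fun x => frob (fderiv ℝ (fun x => g x - f K x) x) * ‖e K x‖) K :=
    integrableOn_mul_of_bounded hc (aestronglyMeasurable_frob_fderiv _ _) me bfrob
      (bnorm (hv K hK).1)
  have i2 : IntegrableOn (fun x => ‖g x - f K x‖ * ‖e K x‖) K :=
    integrableOn_mul_of_bounded hc ((hη K hK).1.aestronglyMeasurable hc).norm me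
      (bnorm (hη K hK).1) (bnorm (hv K hK).1)
  have i3 : IntegrableOn (fun x => ‖e K x‖ ^ 2) K := by
    simp only [pow_two]
    exact integrableOn_mul_of_bounded hc me me (bnorm (hv K hK).1) (bnorm (hv K hK).1)
  rw [← integral_const_mul, ← integral_const_mul, ← integral_const_mul,
    ← integral_add (i1.const_mul U) (i2.const_mul N),
    ← integral_add ((i1.const_mul U).fun_add (i2.const_mul N)) (i3.const_mul N)]
  refine integral_mono_ae ?_ (((i1.const_mul U).add (i2.const_mul N)).add (i3.const_mul N)) ?_
  · exact (integrableOn_inner_fderiv hc (hu K hK).1 (hu K hK).1 (hv K hK).1).sub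
      (integrableOn_inner_fderiv hc (hp K hK).1 ((hp K hK).1.add (hv K hK).1) (hv K hK).1)
  · filter_upwards [hN K hK, (hu K hK).1.ae_differentiableAt hc.isOpen,
      (hp K hK).1.ae_differentiableAt hc.isOpen, ae_restrict_mem hc.isOpen.measurableSet]
      with x e1 e2 e3 e4
    have hgx := hU K hK x (subset_closure e4)
    set E := e K x
    have hD : fderiv ℝ (fun x => g x - f K x) x = fderiv ℝ g x - fderiv ℝ (f K) x :=
      fderiv_fun_sub e2 e3
    -- `∇u u - ∇p (p + e) = ∇(u - p) u + ∇p (u - p) - ∇p e`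
    have hsplit : inner ℝ (fderiv ℝ g x (g x)) E - inner ℝ (fderiv ℝ (f K) x (f K x + E)) E =
        inner ℝ ((fderiv ℝ (fun x => g x - f K x) x) (g x)) E +
        inner ℝ (fderiv ℝ (f K) x (g x - f K x)) E + inner ℝ (-(fderiv ℝ (f K) x E)) E := by
      rw [hD, ← inner_sub_left, ← inner_add_left, ← inner_add_left]
      congr 1
      simp only [_root_.sub_apply, map_add, map_sub]
      abel
    rw [hsplit]
    have t1 : inner ℝ ((fderiv ℝ (fun x => g x - f K x) x) (g x)) E ≤
        U * (frob (fderiv ℝ (fun x => g x - f K x) x) * ‖E‖) :=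
      calc _ ≤ ‖(fderiv ℝ (fun x => g x - f K x) x) (g x)‖ * ‖E‖ := real_inner_le_norm _ _
        _ ≤ (frob (fderiv ℝ (fun x => g x - f K x) x) * U) * ‖E‖ := by
          gcongr
          exact (norm_apply_le_frob _ _).trans (mul_le_mul_of_nonneg_left hgx (frob_nonneg _))
        _ = _ := by ring
    have t2 : inner ℝ (fderiv ℝ (f K) x (g x - f K x)) E ≤ N * (‖g x - f K x‖ * ‖E‖) :=
      calc _ ≤ ‖fderiv ℝ (f K) x (g x - f K x)‖ * ‖E‖ := real_inner_le_norm _ _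
        _ ≤ (N * ‖g x - f K x‖) * ‖E‖ := by
          gcongr
          exact (norm_apply_le_frob _ _).trans (mul_le_mul_of_nonneg_right e1 (norm_nonneg _))
        _ = _ := by ring
    have t3 : inner ℝ (-(fderiv ℝ (f K) x E)) E ≤ N * ‖E‖ ^ 2 :=
      calc _ ≤ ‖-(fderiv ℝ (f K) x E)‖ * ‖E‖ := real_inner_le_norm _ _
        _ ≤ (N * ‖E‖) * ‖E‖ := by
          rw [norm_neg]
          gcongr
          exact (norm_apply_le_frob _ _).trans (mul_le_mul_of_nonneg_right e1 (norm_nonneg _))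
        _ = _ := by ring
    exact add_le_add (add_le_add t1 t2) t3

/-- Boundary facets only increase the sum of nonnegative integrals over the skeleton. -/
theorem Mesh.sum_intFacets_le_skeletonSum {φ : Set (Vec d) → Vec d → ℝ}
    (hφ : ∀ K ∈ M.elems, ContinuousOn (φ K) (closure K))
    (hφ0 : ∀ K ∈ M.elems, ∀ x ∈ closure K, 0 ≤ φ K x) :
    ∑ F ∈ M.intFacets, ∫ x in F, (φ (M.plus F) x + φ (M.minus F) x) ∂μHE[d - 1] ≤
      M.skeletonSum φ := by
  rw [Mesh.skeletonSum, M.sum_elems_facets fun K F => ∫ x in F, φ K x ∂μHE[d - 1]]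
  refine le_add_of_le_of_nonneg (Finset.sum_le_sum fun F hF => ?_)
    (Finset.sum_nonneg fun F hF => ?_)
  · have h := M.int_facet F hF
    rw [integral_add]
    · exact M.integrableOn_facet hF ((hφ _ h.1).mono (M.facet_subset (M.mem_facets_plus hF).1))
    · exact M.integrableOn_facet hF ((hφ _ h.2.1).mono (M.facet_subset (M.mem_facets_minus hF).1))
  · have h := M.bd_facet F hF
    exact setIntegral_nonneg (h.2.1.isCompact (M.cell _ h.1)).measurableSet fun x hx =>
      hφ0 _ h.1 x (M.facet_subset (M.mem_facets_bd hF).1 hx)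

theorem Mesh.skeletonSum_nonneg {φ : Set (Vec d) → Vec d → ℝ}
    (hφ0 : ∀ K ∈ M.elems, ∀ x ∈ closure K, 0 ≤ φ K x) : 0 ≤ M.skeletonSum φ :=
  Finset.sum_nonneg fun K hK => Finset.sum_nonneg fun _ hF =>
    setIntegral_nonneg ((M.isFacet_outer hF).isCompact (M.cell K hK)).measurableSet fun x hx =>
      hφ0 K hK x (M.facet_subset hF hx)

/-- Cauchy-Schwarz on the skeleton. -/
theorem Mesh.sq_sum_intFacets_le {ψ φ χ : Set (Vec d) → Vec d → ℝ}
    (hφ : ∀ K ∈ M.elems, ContinuousOn (φ K) (closure K))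
    (hφ0 : ∀ K ∈ M.elems, ∀ x ∈ closure K, 0 ≤ φ K x)
    (hχ : ∀ K ∈ M.elems, ContinuousOn (χ K) (closure K))
    (hχ0 : ∀ K ∈ M.elems, ∀ x ∈ closure K, 0 ≤ χ K x)
    (hψ : ∀ F ∈ M.intFacets, ContinuousOn (ψ F) F)
    (hψ0 : ∀ F ∈ M.intFacets, ∀ x ∈ F, 0 ≤ ψ F x)
    (hle : ∀ F ∈ M.intFacets, ∀ x ∈ F, ∀ τ : ℝ, 0 < τ →
      ψ F x ≤ τ * (φ (M.plus F) x + φ (M.minus F) x) +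
        τ⁻¹ * (χ (M.plus F) x + χ (M.minus F) x)) :
    (∑ F ∈ M.intFacets, ∫ x in F, ψ F x ∂μHE[d - 1]) ^ 2 ≤
      4 * M.skeletonSum φ * M.skeletonSum χ := by
  refine sq_le_of_forall_le_add (Finset.sum_nonneg fun F hF =>
    setIntegral_nonneg (M.measurableSet_facet hF) (hψ0 F hF)) (M.skeletonSum_nonneg hφ0)
    (M.skeletonSum_nonneg hχ0) fun τ hτ => ?_
  refine le_trans ?_ (add_le_add
    (mul_le_mul_of_nonneg_left (M.sum_intFacets_le_skeletonSum hφ hφ0) hτ.le)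
    (mul_le_mul_of_nonneg_left (M.sum_intFacets_le_skeletonSum hχ hχ0) (inv_pos.2 hτ).le))
  rw [Finset.mul_sum, Finset.mul_sum, ← Finset.sum_add_distrib]
  refine Finset.sum_le_sum fun F hF => ?_
  have h := M.int_facet F hF
  have hs : ∀ {ζ : Set (Vec d) → Vec d → ℝ}, (∀ K ∈ M.elems, ContinuousOn (ζ K) (closure K)) →
      IntegrableOn (fun x => ζ (M.plus F) x + ζ (M.minus F) x) F μHE[d - 1] := fun hζ =>
    M.integrableOn_facet hF (((hζ _ h.1).mono (M.facet_subset (M.mem_facets_plus hF).1)).add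
      ((hζ _ h.2.1).mono (M.facet_subset (M.mem_facets_minus hF).1)))
  rw [← integral_const_mul, ← integral_const_mul,
    ← integral_add ((hs hφ).const_mul _) ((hs hχ).const_mul _)]
  exact setIntegral_mono_on (M.integrableOn_facet hF (hψ F hF))
    (((hs hφ).const_mul _).add ((hs hχ).const_mul _)) (M.measurableSet_facet hF)
    fun x hx => hle F hF x hx τ hτ

/-- Pointwise bound of the facet integrand. The velocity `½ (f₁ + e₁ + f₂ + e₂)` differs from `g` by
averages of `g - f` and `e`. -/
theorem facet_integrand_le {g f₁ f₂ e₁ e₂ n : Vec d} {U H : ℝ} (hn : ‖n‖ = 1) (hU : ‖g‖ ≤ U)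
    (h1 : ‖g - f₁‖ ≤ H) (h2 : ‖g - f₂‖ ≤ H) :
    inner ℝ ((1 / 2 : ℝ) • (f₁ + e₁ + (f₂ + e₂))) n * inner ℝ (f₁ - f₂) ((1 / 2 : ℝ) • (e₁ + e₂)) -
      1 / 2 * |inner ℝ ((1 / 2 : ℝ) • (f₁ + e₁ + (f₂ + e₂))) n| * inner ℝ (f₁ - f₂) (e₁ - e₂) ≤
    U * ((‖g - f₁‖ + ‖g - f₂‖) * (‖e₁‖ + ‖e₂‖)) +
      (‖g - f₁‖ + ‖g - f₂‖) ^ 2 * (‖e₁‖ + ‖e₂‖) + 2 * H * (‖e₁‖ ^ 2 + ‖e₂‖ ^ 2) := by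
  set β := inner ℝ ((1 / 2 : ℝ) • (f₁ + e₁ + (f₂ + e₂))) n with hβ
  set α := ‖g - f₁‖ + ‖g - f₂‖ with hα
  set ε := ‖e₁‖ + ‖e₂‖ with hε
  have hα0 : 0 ≤ α := by positivity
  have hε0 : 0 ≤ ε := by positivity
  have hβle : |β| ≤ U + 1 / 2 * α + 1 / 2 * ε := by
    have e0 : (1 / 2 : ℝ) • (f₁ + e₁ + (f₂ + e₂)) =
        g - (1 / 2 : ℝ) • (g - f₁) - (1 / 2 : ℝ) • (g - f₂) + (1 / 2 : ℝ) • e₁ +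
          (1 / 2 : ℝ) • e₂ := by module
    have hb : |β| ≤ ‖(1 / 2 : ℝ) • (f₁ + e₁ + (f₂ + e₂))‖ := by
      have := abs_real_inner_le_norm ((1 / 2 : ℝ) • (f₁ + e₁ + (f₂ + e₂))) n
      rwa [hn, mul_one] at this
    have hs : ∀ z : Vec d, ‖(1 / 2 : ℝ) • z‖ = 1 / 2 * ‖z‖ := fun z => by
      rw [norm_smul]; norm_num
    rw [e0] at hb
    have q1 := norm_add_le (g - (1 / 2 : ℝ) • (g - f₁) - (1 / 2 : ℝ) • (g - f₂) + (1 / 2 : ℝ) • e₁)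
      ((1 / 2 : ℝ) • e₂)
    have q2 := norm_add_le (g - (1 / 2 : ℝ) • (g - f₁) - (1 / 2 : ℝ) • (g - f₂)) ((1 / 2 : ℝ) • e₁)
    have q3 := norm_sub_le (g - (1 / 2 : ℝ) • (g - f₁)) ((1 / 2 : ℝ) • (g - f₂))
    have q4 := norm_sub_le g ((1 / 2 : ℝ) • (g - f₁))
    rw [hs] at q1 q2 q3 q4
    linarith
  have hjump : ‖f₁ - f₂‖ ≤ α := by
    have : f₁ - f₂ = (g - f₂) - (g - f₁) := by abel
    rw [this]
    exact (norm_sub_le _ _).trans_eq (add_comm _ _)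
  have hi1 : |inner ℝ (f₁ - f₂) ((1 / 2 : ℝ) • (e₁ + e₂))| ≤ 1 / 2 * (α * ε) := by
    rw [real_inner_smul_right, abs_mul, abs_of_pos (by norm_num : (0 : ℝ) < 1 / 2)]
    gcongr
    exact (abs_real_inner_le_norm _ _).trans (mul_le_mul hjump (norm_add_le _ _) (norm_nonneg _) hα0)
  have hi2 : |inner ℝ (f₁ - f₂) (e₁ - e₂)| ≤ α * ε :=
    (abs_real_inner_le_norm _ _).trans (mul_le_mul hjump (norm_sub_le _ _) (norm_nonneg _) hα0)
  have hfirst : inner ℝ ((1 / 2 : ℝ) • (f₁ + e₁ + (f₂ + e₂))) n *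
      inner ℝ (f₁ - f₂) ((1 / 2 : ℝ) • (e₁ + e₂)) - 1 / 2 * |β| * inner ℝ (f₁ - f₂) (e₁ - e₂) ≤
      |β| * (α * ε) := by
    have r1 : β * inner ℝ (f₁ - f₂) ((1 / 2 : ℝ) • (e₁ + e₂)) ≤ |β| * (1 / 2 * (α * ε)) := by
      refine (le_abs_self _).trans ?_
      rw [abs_mul]
      gcongr
    have r2 : -(1 / 2 * |β| * inner ℝ (f₁ - f₂) (e₁ - e₂)) ≤ 1 / 2 * |β| * (α * ε) := by
      rw [← mul_neg]
      gcongr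
      exact (neg_le_abs _).trans hi2
    rw [← hβ]
    linarith
  refine hfirst.trans ?_
  have hαε : 0 ≤ α * ε := mul_nonneg hα0 hε0
  have hβ2 := mul_le_mul_of_nonneg_right hβle hαε
  have hH : α ≤ 2 * H := by linarith
  have hε2 : ε ^ 2 ≤ 2 * (‖e₁‖ ^ 2 + ‖e₂‖ ^ 2) := by
    rw [hε]; nlinarith [sq_nonneg (‖e₁‖ - ‖e₂‖)]
  have s1 : 1 / 2 * ε * (α * ε) ≤ 2 * H * (‖e₁‖ ^ 2 + ‖e₂‖ ^ 2) := by
    have : α * ε ^ 2 ≤ 2 * H * (2 * (‖e₁‖ ^ 2 + ‖e₂‖ ^ 2)) :=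
      mul_le_mul hH hε2 (sq_nonneg _) (hα0.trans hH)
    nlinarith
  have s2 : 1 / 2 * α * (α * ε) ≤ α ^ 2 * ε := by
    have : 0 ≤ α ^ 2 * ε := by positivity
    nlinarith
  nlinarith

end Estimates

/-! ### Bounds on the skeleton of the mesh -/

section SkeletonBounds

variable {d : ℕ} {Ω : Set (Vec d)} {M : Mesh Ω} {u p w v : Vec d → Vec d} {g : Vec d → Vec d}
  {a f e : Set (Vec d) → Vec d → Vec d}

theorem LipClosure.norm_sq {K : Set (Vec d)} (hK : IsPolytopeCell K) {a : Vec d → Vec d}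
    (ha : LipClosure K a) : LipClosure K fun x => ‖a x‖ ^ 2 := by
  simpa only [real_inner_self_eq_norm_sq] using ha.inner hK ha

theorem LipClosure.norm_pow_four {K : Set (Vec d)} (hK : IsPolytopeCell K) {a : Vec d → Vec d}
    (ha : LipClosure K a) : LipClosure K fun x => (‖a x‖ ^ 2) ^ 2 := by
  simpa only [smul_eq_mul, ← pow_two] using (ha.norm_sq hK).smul hK (ha.norm_sq hK)

theorem norm_fderiv_norm_sq_le {a : Vec d → Vec d} {x : Vec d} (ha : DifferentiableAt ℝ a x) :
    ‖fderiv ℝ (fun x => ‖a x‖ ^ 2) x‖ ≤ 2 * (‖a x‖ * frob (fderiv ℝ a x)) := by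
  have h : HasFDerivAt (fun x => ‖a x‖ ^ 2) _ x := ha.hasFDerivAt.norm_sq
  rw [h.fderiv]
  refine ContinuousLinearMap.opNorm_le_bound _
    (mul_nonneg zero_le_two (mul_nonneg (norm_nonneg _) (frob_nonneg _))) fun y => ?_
  have h1 : |inner ℝ (a x) (fderiv ℝ a x y)| ≤ ‖a x‖ * (frob (fderiv ℝ a x) * ‖y‖) :=
    (abs_real_inner_le_norm _ _).trans (by gcongr; exact norm_apply_le_frob _ _)
  simp only [_root_.smul_apply, ContinuousLinearMap.comp_apply, innerSL_apply_apply,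
    nsmul_eq_mul, norm_mul, Real.norm_eq_abs]
  norm_num
  linarith

theorem norm_fderiv_norm_pow_four_le {a : Vec d → Vec d} {x : Vec d}
    (ha : DifferentiableAt ℝ a x) :
    ‖fderiv ℝ (fun x => (‖a x‖ ^ 2) ^ 2) x‖ ≤
      4 * (‖a x‖ ^ 2 * (‖a x‖ * frob (fderiv ℝ a x))) := by
  have h0 : DifferentiableAt ℝ (fun x => ‖a x‖ ^ 2) x := ha.norm_sq ℝ
  have h : HasFDerivAt (fun x => (‖a x‖ ^ 2) ^ 2) _ x := h0.hasFDerivAt.pow 2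
  rw [h.fderiv, norm_smul]
  have h1 := norm_fderiv_norm_sq_le ha
  have : 0 ≤ ‖a x‖ ^ 2 := by positivity
  simp
  nlinarith

/-- The continuous trace inequality for the square of a piecewise Lipschitz field. -/
theorem PiecewiseLip.skeletonSum_sq_le (hd : d ≠ 0) (hΩ : Ω.Nonempty)
    (hΩb : Bornology.IsBounded Ω) {κ θ : ℝ} (hκ : 0 < κ) (hM : M.ShapeRegular κ)
    (hθ : M.QuasiUniform θ) (hw : PiecewiseLip M w a) :
    M.skeletonSum (fun K x => ‖a K x‖ ^ 2) ≤ κ⁻¹ * (d * |θ| * M.h⁻¹ * normL2 Ω w ^ 2 +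
      2 * (tnormL2 Ω (brokenGrad M w) * normL2 Ω w)) := by
  have h := M.skeletonSum_le hd hΩ hκ hM hθ (f := fun K x => ‖a K x‖ ^ 2)
    (G := fun K x => 2 * (‖a K x‖ * frob (fderiv ℝ (a K) x)))
    (fun K hK => (hw K hK).1.norm_sq (M.cell K hK)) (fun K hK x hx => sq_nonneg _)
    (fun K hK => by
      have hc := M.cell K hK
      refine (integrableOn_mul_of_bounded hc ((hw K hK).1.aestronglyMeasurable hc).norm
        (aestronglyMeasurable_frob_fderiv _ _) ?_ ?_).const_mul 2
      · obtain ⟨C, hC⟩ := (hw K hK).1.exists_bound hc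
        exact ⟨C, fun x hx => by rw [abs_norm]; exact hC x (subset_closure hx)⟩
      · obtain ⟨C, hC⟩ := (hw K hK).1.exists_frob_bound hc
        exact ⟨C, fun x hx => by rw [abs_of_nonneg (frob_nonneg _)]; exact hC x hx⟩)
    (fun K hK => by
      filter_upwards [(hw K hK).1.ae_differentiableAt (M.cell K hK).isOpen] with x hx using
        norm_fderiv_norm_sq_le hx)
  rw [hw.sum_integral_sq hΩb] at h
  refine h.trans ?_
  simp only [integral_const_mul, ← Finset.mul_sum]
  gcongr
  simpa only [mul_comm] using hw.sum_integral_frob_mul_norm hΩb hw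

/-- The continuous trace inequality for the fourth power of a small piecewise Lipschitz field: one
power of the field is traded for its supremum. -/
theorem PiecewiseLip.skeletonSum_pow_four_le (hd : d ≠ 0) (hΩ : Ω.Nonempty)
    (hΩb : Bornology.IsBounded Ω) {κ θ H N : ℝ} (hκ : 0 < κ) (hM : M.ShapeRegular κ)
    (hθ : M.QuasiUniform θ) (hw : PiecewiseLip M w a) (hH0 : 0 ≤ H)
    (hH : ∀ K ∈ M.elems, ∀ x ∈ closure K, ‖a K x‖ ≤ H)
    (hN : ∀ K ∈ M.elems, ∀ᵐ x ∂(volume.restrict K), frob (fderiv ℝ (a K) x) ≤ N) :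
    M.skeletonSum (fun K x => (‖a K x‖ ^ 2) ^ 2) ≤
      κ⁻¹ * (d * |θ| * M.h⁻¹ * H ^ 2 + 4 * (H * N)) * normL2 Ω w ^ 2 := by
  have i2 : ∀ K ∈ M.elems, IntegrableOn (fun x => ‖a K x‖ ^ 2) K := fun K hK =>
    ((hw K hK).1.norm_sq (M.cell K hK)).integrableOn (M.cell K hK)
  have h := M.skeletonSum_le hd hΩ hκ hM hθ (f := fun K x => (‖a K x‖ ^ 2) ^ 2)
    (G := fun K x => 4 * (H * N) * ‖a K x‖ ^ 2)
    (fun K hK => (hw K hK).1.norm_pow_four (M.cell K hK)) (fun K hK x hx => sq_nonneg _)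
    (fun K hK => (i2 K hK).const_mul _)
    (fun K hK => by
      have hc := M.cell K hK
      filter_upwards [(hw K hK).1.ae_differentiableAt hc.isOpen, hN K hK,
        ae_restrict_mem hc.isOpen.measurableSet] with x h1 h2 h3
      refine (norm_fderiv_norm_pow_four_le h1).trans ?_
      have : ‖a K x‖ * frob (fderiv ℝ (a K) x) ≤ H * N :=
        mul_le_mul (hH K hK x (subset_closure h3)) h2 (frob_nonneg _) hH0
      have h4 : 0 ≤ ‖a K x‖ ^ 2 := sq_nonneg _
      nlinarith)
  refine h.trans ?_
  have hM0 := M.h_pos hd hΩ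
  have h4 : ∑ K ∈ M.elems, ∫ x in K, (‖a K x‖ ^ 2) ^ 2 ≤
      H ^ 2 * ∑ K ∈ M.elems, ∫ x in K, ‖a K x‖ ^ 2 := by
    rw [Finset.mul_sum]
    refine Finset.sum_le_sum fun K hK => ?_
    have hc := M.cell K hK
    rw [← integral_const_mul]
    refine setIntegral_mono_on (((hw K hK).1.norm_pow_four hc).integrableOn hc)
      ((i2 K hK).const_mul _) hc.isOpen.measurableSet fun x hx => ?_
    rw [pow_two (‖a K x‖ ^ 2)]
    gcongr
    exact hH K hK x (subset_closure hx)
  rw [mul_assoc κ⁻¹, add_mul, ← hw.sum_integral_sq hΩb, mul_assoc _ (H ^ 2)]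
  simp only [integral_const_mul, ← Finset.mul_sum]
  gcongr

/-- The discrete trace inequality, summed over the elements of a quasi-uniform mesh. -/
theorem DiscreteTrace.skeletonSum_le {P : FEPair M} {C θ : ℝ} (hC : DiscreteTrace P C)
    (hd : d ≠ 0) (hΩ : Ω.Nonempty) (hΩb : Bornology.IsBounded Ω) (hθ : M.QuasiUniform θ)
    (hv : v ∈ P.Vh) (he : PiecewiseLip M v e) :
    M.skeletonSum (fun K x => ‖e K x‖ ^ 2) ≤ C ^ 2 * |θ| * M.h⁻¹ * normL2 Ω v ^ 2 := by
  rw [← he.sum_integral_sq hΩb, Finset.mul_sum]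
  refine Finset.sum_le_sum fun K hK => (hC.sum_integral_le hd hv he hK).trans ?_
  rw [mul_assoc (C ^ 2) |θ|]
  gcongr
  exact hθ.inv_diam_le hd hΩ hK

/-- Bound of the facet terms by integrals over the skeleton of powers of `g - f` and `e`. -/
theorem facet_terms_le (hu : PiecewiseLip M u fun _ => g)
    (hp : PiecewiseLip M p f) (hv : PiecewiseLip M v e) {U H S₁ S₂ S Y₁ Y₂ : ℝ} (hU0 : 0 ≤ U) (hH0 : 0 ≤ H)
    (hU : ∀ K ∈ M.elems, ∀ x ∈ closure K, ‖g x‖ ≤ U)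
    (hH : ∀ K ∈ M.elems, ∀ x ∈ closure K, ‖g x - f K x‖ ≤ H)
    (hS₁ : M.skeletonSum (fun K x => ‖g x - f K x‖ ^ 2) ≤ S₁)
    (hS₂ : M.skeletonSum (fun K x => (‖g x - f K x‖ ^ 2) ^ 2) ≤ S₂)
    (hS : M.skeletonSum (fun K x => ‖e K x‖ ^ 2) ≤ S) (hY₁0 : 0 ≤ Y₁) (hY₂0 : 0 ≤ Y₂)
    (hY₁ : 4 * S₁ * S ≤ Y₁ ^ 2) (hY₂ : 4 * S₂ * S ≤ Y₂ ^ 2) :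
    ∑ F ∈ M.intFacets, ∫ x in F,
        (inner ℝ (M.pavg (fun K x => f K x + e K x) F x) (M.normal F)
            * inner ℝ (M.pjump f F x) (M.pavg e F x)
          - 1 / 2 * |inner ℝ (M.pavg (fun K x => f K x + e K x) F x) (M.normal F)|
            * inner ℝ (M.pjump f F x) (M.pjump e F x)) ∂μHE[d - 1] ≤
      U * Y₁ + 4 * Y₂ + 2 * H * S := by
  have hη := hu.sub hp
  -- the integrands that are linear and quadratic in `g - f`; the factor `1 / 4` makes the
  -- hypothesis of the Cauchy-Schwarz inequality hold without further constants
  set ψ₁ : Set (Vec d) → Vec d → ℝ := fun F x =>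
    (‖g x - f (M.plus F) x‖ + ‖g x - f (M.minus F) x‖) * (‖e (M.plus F) x‖ + ‖e (M.minus F) x‖)
    with hψ₁
  set ψ₂ : Set (Vec d) → Vec d → ℝ := fun F x => 1 / 4 *
    ((‖g x - f (M.plus F) x‖ + ‖g x - f (M.minus F) x‖) ^ 2 *
      (‖e (M.plus F) x‖ + ‖e (M.minus F) x‖)) with hψ₂
  have cη : ∀ K ∈ M.elems, ContinuousOn (fun x => ‖g x - f K x‖ ^ 2) (closure K) := fun K hK =>
    (hη K hK).1.continuousOn.norm.pow 2
  have cη4 : ∀ K ∈ M.elems, ContinuousOn (fun x => (‖g x - f K x‖ ^ 2) ^ 2) (closure K) :=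
    fun K hK => (cη K hK).pow 2
  have ce : ∀ K ∈ M.elems, ContinuousOn (fun x => ‖e K x‖ ^ 2) (closure K) := fun K hK =>
    (hv K hK).1.continuousOn.norm.pow 2
  have cα : ∀ F ∈ M.intFacets, ContinuousOn
      (fun x => ‖g x - f (M.plus F) x‖ + ‖g x - f (M.minus F) x‖) F := fun F hF =>
    (hη.continuousOn_sides hF).1.norm.add (hη.continuousOn_sides hF).2.norm
  have cε : ∀ F ∈ M.intFacets, ContinuousOn
      (fun x => ‖e (M.plus F) x‖ + ‖e (M.minus F) x‖) F := fun F hF =>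
    (hv.continuousOn_sides hF).1.norm.add (hv.continuousOn_sides hF).2.norm
  have c1 : ∀ F ∈ M.intFacets, ContinuousOn (ψ₁ F) F := fun F hF => (cα F hF).mul (cε F hF)
  have c2 : ∀ F ∈ M.intFacets, ContinuousOn (ψ₂ F) F := fun F hF =>
    continuousOn_const.mul (((cα F hF).pow 2).mul (cε F hF))
  have z1 := M.sq_sum_intFacets_le cη (fun K hK x hx => sq_nonneg _) ce
    (fun K hK x hx => sq_nonneg _) c1 (fun F hF x hx => by positivity) (fun F hF x hx τ hτ => by
      have h := two_mul_le_young (x := ‖g x - f (M.plus F) x‖ + ‖g x - f (M.minus F) x‖)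
        (y := ‖e (M.plus F) x‖ + ‖e (M.minus F) x‖) hτ
      have h1 := mul_le_mul_of_nonneg_left
        (add_sq_le (a := ‖g x - f (M.plus F) x‖) (b := ‖g x - f (M.minus F) x‖)) hτ.le
      have h2 := mul_le_mul_of_nonneg_left
        (add_sq_le (a := ‖e (M.plus F) x‖) (b := ‖e (M.minus F) x‖)) (inv_pos.2 hτ).le
      simp only [hψ₁]
      linarith)
  have z2 := M.sq_sum_intFacets_le cη4 (fun K hK x hx => sq_nonneg _) ce
    (fun K hK x hx => sq_nonneg _) c2 (fun F hF x hx => by positivity) (fun F hF x hx τ hτ => by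
      set α := ‖g x - f (M.plus F) x‖
      set α' := ‖g x - f (M.minus F) x‖
      have h := two_mul_le_young (x := (α + α') ^ 2)
        (y := ‖e (M.plus F) x‖ + ‖e (M.minus F) x‖) hτ
      have h0 : ((α + α') ^ 2) ^ 2 ≤ 8 * ((α ^ 2) ^ 2 + (α' ^ 2) ^ 2) := by
        have k1 : (α + α') ^ 2 ≤ 2 * (α ^ 2 + α' ^ 2) := add_sq_le
        have k2 : (α ^ 2 + α' ^ 2) ^ 2 ≤ 2 * ((α ^ 2) ^ 2 + (α' ^ 2) ^ 2) := add_sq_le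
        have k3 := pow_le_pow_left₀ (sq_nonneg (α + α')) k1 2
        linarith
      have h1 := mul_le_mul_of_nonneg_left h0 hτ.le
      have h2 := mul_le_mul_of_nonneg_left
        (add_sq_le (a := ‖e (M.plus F) x‖) (b := ‖e (M.minus F) x‖)) (inv_pos.2 hτ).le
      have h3 : 0 ≤ τ⁻¹ * (‖e (M.plus F) x‖ ^ 2 + ‖e (M.minus F) x‖ ^ 2) := by positivity
      simp only [hψ₂]
      linarith)
  have he0 : 0 ≤ M.skeletonSum fun K x => ‖e K x‖ ^ 2 :=
    M.skeletonSum_nonneg fun _ _ _ _ => sq_nonneg _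
  have hη0 : 0 ≤ M.skeletonSum fun K x => ‖g x - f K x‖ ^ 2 :=
    M.skeletonSum_nonneg fun _ _ _ _ => sq_nonneg _
  have hη40 : 0 ≤ M.skeletonSum fun K x => (‖g x - f K x‖ ^ 2) ^ 2 :=
    M.skeletonSum_nonneg fun _ _ _ _ => sq_nonneg _
  have z1' := abs_le_of_sq_le_sq ((z1.trans (mul_le_mul (mul_le_mul_of_nonneg_left hS₁ zero_le_four)
    hS he0 (mul_nonneg zero_le_four (hη0.trans hS₁)))).trans hY₁) hY₁0
  have z2' := abs_le_of_sq_le_sq ((z2.trans (mul_le_mul (mul_le_mul_of_nonneg_left hS₂ zero_le_four)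
    hS he0 (mul_nonneg zero_le_four (hη40.trans hS₂)))).trans hY₂) hY₂0
  have z3 := (M.sum_intFacets_le_skeletonSum ce (fun K hK x hx => sq_nonneg _)).trans hS
  refine le_trans ?_ (add_le_add (add_le_add (mul_le_mul_of_nonneg_left (le_of_abs_le z1') hU0)
    (mul_le_mul_of_nonneg_left (le_of_abs_le z2') (by norm_num : (0 : ℝ) ≤ 4)))
    (mul_le_mul_of_nonneg_left z3 (by positivity : (0 : ℝ) ≤ 2 * H)))
  rw [Finset.mul_sum, Finset.mul_sum, Finset.mul_sum, ← Finset.sum_add_distrib,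
    ← Finset.sum_add_distrib]
  refine Finset.sum_le_sum fun F hF => ?_
  have huh : PiecewiseLip M (p + v) fun K x => f K x + e K x := fun K hK => by
    refine ⟨(hp K hK).1.add (hv K hK).1, ?_⟩
    filter_upwards [(hp K hK).2, (hv K hK).2] with x h1 h2
    rw [← h1, ← h2]
    rfl
  have i1 := (M.integrableOn_facet hF (c1 F hF)).const_mul U
  have i2 := (M.integrableOn_facet hF (c2 F hF)).const_mul 4
  have i3 : IntegrableOn (fun x => 2 * H * (‖e (M.plus F) x‖ ^ 2 + ‖e (M.minus F) x‖ ^ 2)) F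
      μHE[d - 1] := (M.integrableOn_facet hF (((hv.continuousOn_sides hF).1.norm.pow 2).fun_add
    ((hv.continuousOn_sides hF).2.norm.pow 2))).const_mul (2 * H)
  rw [← integral_const_mul, ← integral_const_mul, ← integral_const_mul, ← integral_add i1 i2,
    ← integral_add (i1.fun_add i2) i3]
  refine setIntegral_mono_on ((M.integrableOn_facet hF (continuousOn_centered_flux huh hp hv hF)).sub
    (M.integrableOn_facet hF (continuousOn_upwind_flux huh hp hv hF))) ((i1.fun_add i2).fun_add i3)
    (M.measurableSet_facet hF) fun x hx => ?_
  have hfac := M.int_facet F hF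
  have hxp := M.facet_subset (M.mem_facets_plus hF).1 hx
  have hxm := M.facet_subset (M.mem_facets_minus hF).1 hx
  refine (facet_integrand_le (g := g x) hfac.2.2.2.1.1 (hU _ hfac.1 x hxp) (hH _ hfac.1 x hxp)
    (hH _ hfac.2.1 x hxm)).trans_eq ?_
  simp only [hψ₁, hψ₂]
  ring

end SkeletonBounds

/-! ### The two classes of methods -/

section Constants

variable {k t q c r h h' A B G U L D E S R : ℝ}

/-- Cauchy-Schwarz applied to `|η|²` and `|e|²` on the skeleton. Here `A`, `B` and `G` are the
`L²` norms of `η`, `e` and `∇_h η`, and `h' = h⁻¹`; the constant `c` makes the square on the right dominate. -/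
theorem four_mul_trace_bound_le (hk : 0 ≤ k) (ht : 0 ≤ t) (hr : 0 ≤ r) (hh : 0 ≤ h') (hA : 0 ≤ A)
    (hB : 0 ≤ B) (hG : 0 ≤ G) (hc : c = 4 * k * t + 4 * r * t + 1) :
    4 * (k * h' * A ^ 2 + 2 * r * (G * A)) * (t * h' * B ^ 2) ≤
      (c * h' * (A * B) + G * B) ^ 2 := by
  have hkt : 0 ≤ k * t := by positivity
  have hrt : 0 ≤ r * t := by positivity
  have e1 : 4 * (k * t) ≤ c ^ 2 := by
    have : 4 * (k * t) ≤ c := by rw [hc]; linarith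
    have hc1 : 1 ≤ c := by rw [hc]; linarith
    nlinarith
  have e2 : 4 * (2 * r * t) ≤ 2 * c := by rw [hc]; linarith
  have e3 := mul_le_mul_of_nonneg_right e1 (by positivity : 0 ≤ (h' * A * B) ^ 2)
  have e4 := mul_le_mul_of_nonneg_right e2 (by positivity : 0 ≤ h' * A * B * (G * B))
  have e5 : 0 ≤ (G * B) ^ 2 := sq_nonneg _
  linarith

/-- Cauchy-Schwarz applied to `|η|⁴` and `|e|²` on the skeleton; the powers of `h` cancel. -/
theorem four_mul_quartic_bound_le (hq : 0 ≤ q) (ht : 0 ≤ t) (hhh : h * h' = 1) :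
    4 * (q * h * L ^ 2 * A ^ 2) * (t * h' * B ^ 2) ≤ ((4 * q * t + 1) * (L * A * B)) ^ 2 := by
  have hqt : 0 ≤ q * t := by positivity
  have e1 : 4 * (q * t) ≤ (4 * q * t + 1) ^ 2 := by nlinarith
  have e3 := mul_le_mul_of_nonneg_right e1 (sq_nonneg (L * A * B))
  calc _ = 4 * (q * t) * (L * A * B) ^ 2 * (h * h') := by ring
    _ = 4 * (q * t) * (L * A * B) ^ 2 := by rw [hhh, mul_one]
    _ ≤ _ := by linarith

/-- The constants of all volume and facet terms, collected. The factor `U ≤ D L` removes the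
supremum of the velocity and `1 ≤ R / h` the terms that carry no negative power of `h`. -/
theorem collected_terms_le (hL : 0 ≤ L) (hA : 0 ≤ A) (hB : 0 ≤ B) (hh : 0 ≤ h')
    (hhh : h * h' = 1) (hE : 0 ≤ E) (hq : 0 ≤ q) (ht : 0 ≤ t) (hc : 0 ≤ c) (hUD : U ≤ D * L)
    (hR : 1 ≤ R * h') (hS : S ≤ t * h' * B ^ 2) (hh0 : 0 ≤ h) :
    U * (G * B) + E * L * (A * B) + E * L * B ^ 2 +
      (U * (c * h' * (A * B) + G * B) + 4 * ((4 * q * t + 1) * (L * A * B)) +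
        2 * (E * h * L) * S) ≤
      2 * U * G * B + (D * c + (E + 4 * (4 * q * t + 1)) * R) * h' * L * (A * B) +
        (E + 2 * E * t) * L * B ^ 2 := by
  have r1 : U * (c * h' * (A * B)) ≤ D * L * (c * h' * (A * B)) := by gcongr
  have r2 := mul_le_mul_of_nonneg_left hR
    (by positivity : 0 ≤ (E + 4 * (4 * q * t + 1)) * L * (A * B))
  have r3 : 2 * (E * h * L) * S ≤ 2 * E * t * L * B ^ 2 := by
    calc 2 * (E * h * L) * S ≤ 2 * (E * h * L) * (t * h' * B ^ 2) := by gcongr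
      _ = 2 * E * t * L * B ^ 2 * (h * h') := by ring
      _ = _ := by rw [hhh, mul_one]
  linarith

end Constants

section Main

variable {d : ℕ} {Ω : Set (Vec d)} {M : Mesh Ω} {u uh p : Vec d → Vec d} {g : Vec d → Vec d}
  {f e : Set (Vec d) → Vec d → Vec d}

theorem ae_norm_le_of_eLpNorm_top_le {E : Type*} [NormedAddCommGroup E] {μ : Measure (Vec d)}
    {φ : Vec d → E} {c : ℝ} (hc : 0 ≤ c) (h : eLpNorm φ ∞ μ ≤ ENNReal.ofReal c) :
    ∀ᵐ x ∂μ, ‖φ x‖ ≤ c := by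
  rw [eLpNorm_exponent_top] at h
  filter_upwards [ae_le_eLpNormEssSup (f := φ) (μ := μ)] with x hx
  have h1 := hx.trans h
  rwa [← ofReal_norm, ENNReal.ofReal_le_ofReal_iff hc] at h1

/-- For a field in `W^{1,∞}` the broken gradient is the weak gradient, and its norm is finite. -/
theorem eLpNorm_frob_brokenGrad (hΩ : IsOpen Ω) (hu : MemW1inf Ω u) :
    eLpNorm (fun x => frob (brokenGrad M u x)) ∞ (volume.restrict Ω) =
      ENNReal.ofReal (tnormLinf Ω (weakGrad Ω u)) := by
  obtain ⟨-, G, hG, hG2⟩ := hu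
  have h1 := (ae_norm_apply_le_of_weakGrad hG2).1
  have h2 : (fun x => frob (weakGrad Ω u x)) =ᵐ[volume.restrict Ω] fun x => frob (G x) :=
    (hG.weakGrad_ae_eq hΩ).fun_comp frob
  have h3 : (fun x => frob (brokenGrad M u x)) =ᵐ[volume.restrict Ω] fun x => frob (weakGrad Ω u x) :=
    (brokenGrad_ae_eq_weakGrad hΩ hG).fun_comp frob
  rw [tnormLinf, eLpNorm_congr_ae h3, eLpNorm_congr_ae h2, ENNReal.ofReal_toReal h1.ne]

/-- Bounds on the broken gradient carry over to the elementwise representatives. -/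
theorem PiecewiseLip.ae_frob_le (hu : PiecewiseLip M u f) {N : ℝ} (hN : 0 ≤ N)
    (h : eLpNorm (fun x => frob (brokenGrad M u x)) ∞ (volume.restrict Ω) ≤ ENNReal.ofReal N) :
    ∀ K ∈ M.elems, ∀ᵐ x ∂(volume.restrict K), frob (fderiv ℝ (f K) x) ≤ N := fun K hK => by
  filter_upwards [M.ae_restrict_elem (ae_norm_le_of_eLpNorm_top_le hN h) hK,
    hu.brokenGrad_ae_eq hK] with x h1 h2
  rw [← h2]
  exact (le_abs_self _).trans h1

/-- Bounds in `L^∞` carry over to the elementwise representatives, up to the boundary. -/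
theorem PiecewiseLip.norm_le (hu : PiecewiseLip M u f) {N : ℝ} (hN : 0 ≤ N)
    (h : eLpNorm u ∞ (volume.restrict Ω) ≤ ENNReal.ofReal N) :
    ∀ K ∈ M.elems, ∀ x ∈ closure K, ‖f K x‖ ≤ N := fun K hK => by
  refine le_of_ae_le_of_continuousOn (M.cell K hK).isOpen (hu K hK).1.continuousOn.norm ?_
  filter_upwards [M.ae_restrict_elem (ae_norm_le_of_eLpNorm_top_le hN h) hK, (hu K hK).2]
    with x h1 h2
  rwa [← h2]

/-- The error identity with the volume terms estimated. -/
theorem convective_difference_le (hΩ : IsOpen Ω) (hΩb : Bornology.IsBounded Ω)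
    (hΩr : interior (closure Ω) = Ω) {P : FEPair M} (hu1 : MemW1inf Ω u) (huV : MemVdiv Ω u)
    (huh : P.MemVhdiv uh) (hu : PiecewiseLip M u fun _ => g) (hp : PiecewiseLip M p f)
    (he : PiecewiseLip M (uh - p) e) {N R : ℝ} (hN : 0 ≤ N)
    (hpN : eLpNorm (fun x => frob (brokenGrad M p x)) ∞ (volume.restrict Ω) ≤ ENNReal.ofReal N)
    (hR : ∑ F ∈ M.intFacets, ∫ x in F,
        (inner ℝ (M.pavg (fun K x => f K x + e K x) F x) (M.normal F)
            * inner ℝ (M.pjump f F x) (M.pavg e F x)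
          - 1 / 2 * |inner ℝ (M.pavg (fun K x => f K x + e K x) F x) (M.normal F)|
            * inner ℝ (M.pjump f F x) (M.pjump e F x)) ∂μHE[d - 1] ≤ R) :
    ch M u u (uh - p) - ch M uh uh (uh - p) ≤ - upwSq M uh (uh - p) +
      (normLinf Ω u * (tnormL2 Ω (brokenGrad M (u - p)) * normL2 Ω (uh - p)) +
        N * (normL2 Ω (u - p) * normL2 Ω (uh - p)) + N * normL2 Ω (uh - p) ^ 2) + R := by
  obtain ⟨h1, h2⟩ := huh.divergence_free hΩ
  rw [convective_error_identity hΩ hΩr hu hp he (huV.weakDiv_ae_eq_zero hΩ hΩb) h1 h2]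
  have hU := hu.norm_le (N := normLinf Ω u) ENNReal.toReal_nonneg
    (by rw [normLinf, ENNReal.ofReal_toReal hu1.1.2.ne])
  have hv := volume_terms_le hΩb hu hp he hU ENNReal.toReal_nonneg hN (hp.ae_frob_le hN hpN)
  linarith

theorem PiecewiseLip.of_lipschitzWith {C : NNReal} (hg : LipschitzWith C g)
    (h : u =ᵐ[volume.restrict Ω] g) : PiecewiseLip M u fun _ => g := fun _ hK =>
  ⟨hg.lipClosure, M.ae_restrict_elem h hK⟩

/-- The estimate for `H¹`-conforming methods: `p` has no jumps, so the facet terms vanish. -/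
theorem convectiveBound_h1Conforming (hd : d ≠ 0) (hΩ : IsOpen Ω) (hΩn : Ω.Nonempty)
    (hΩb : Bornology.IsBounded Ω) (hΩr : interior (closure Ω) = Ω) {P : FEPair M}
    (hP : P.H1Conforming) {CE : ℝ} (hCE : 0 ≤ CE) (hu1 : MemW1inf Ω u) (huV : MemVdiv Ω u)
    (huh : P.MemVhdiv uh) (hpV : P.MemVhdiv p)
    (hstab : eLpNorm (fun x => frob (brokenGrad M p x)) ∞ (volume.restrict Ω) ≤
      ENNReal.ofReal CE * eLpNorm (fun x => frob (brokenGrad M u x)) ∞ (volume.restrict Ω))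
    {C ε₁ ε₂ ε₃ ε₄ : ℝ} (hC : CE * (1 + Metric.diam Ω) ≤ C)
    (h1 : 0 < ε₁) (h2 : 0 < ε₂) (h3 : 0 < ε₃) (h4 : 0 < ε₄) :
    ConvectiveBound M C ε₁ ε₂ ε₃ ε₄ u uh p := by
  obtain ⟨D, -, hD⟩ := exists_lipschitz_extension_of_memH10 hd hΩ hΩb
  obtain ⟨g, Cg, hg, hug, -, -⟩ := hD u hu1 huV.1
  have hu : PiecewiseLip M u fun _ => g := .of_lipschitzWith hg hug
  obtain ⟨f, hp⟩ := P.exists_piecewiseLip hpV.1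
  obtain ⟨e, he⟩ := P.exists_piecewiseLip (P.Vh.sub_mem huh.1 hpV.1)
  set L := tnormLinf Ω (weakGrad Ω u) with hL
  have hL0 : 0 ≤ L := ENNReal.toReal_nonneg
  rw [eLpNorm_frob_brokenGrad hΩ hu1, ← ENNReal.ofReal_mul hCE, ← hL] at hstab
  have hR : ∑ F ∈ M.intFacets, ∫ x in F,
        (inner ℝ (M.pavg (fun K x => f K x + e K x) F x) (M.normal F)
            * inner ℝ (M.pjump f F x) (M.pavg e F x)
          - 1 / 2 * |inner ℝ (M.pavg (fun K x => f K x + e K x) F x) (M.normal F)|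
            * inner ℝ (M.pjump f F x) (M.pjump e F x)) ∂μHE[d - 1] ≤ 0 := by
    refine (Finset.sum_eq_zero fun F hF => ?_).le
    refine (integral_congr_ae ?_).trans (integral_zero _ _)
    filter_upwards [hp.jump_eq_zero_of_memH10 hΩ hΩr (hP p hpV.1) hF,
      ae_restrict_mem (M.measurableSet_facet hF)] with x hx hxF
    rw [hp.jump_eq hF hxF] at hx
    simp only [Mesh.pjump, hx, inner_zero_left, mul_zero, sub_zero]
  have hmain := convective_difference_le hΩ hΩb hΩr hu1 huV huh hu hp he
    (mul_nonneg hCE hL0) hstab hR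
  have hA : 0 ≤ normL2 Ω (u - p) := ENNReal.toReal_nonneg
  have hB : 0 ≤ normL2 Ω (uh - p) := ENNReal.toReal_nonneg
  have hU : 0 ≤ normLinf Ω u := ENNReal.toReal_nonneg
  have hDn : 0 ≤ tnormL2 Ω (brokenGrad M (u - p)) := ENNReal.toReal_nonneg
  have hh := M.h_pos hd hΩn
  have hdiam : 0 ≤ Metric.diam Ω := Metric.diam_nonneg
  have hh1 : 1 ≤ Metric.diam Ω * M.h⁻¹ := by
    rw [← div_eq_mul_inv, one_le_div hh]
    exact M.h_le_diam hΩn hΩb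
  have hX : normLinf Ω u * (tnormL2 Ω (brokenGrad M (u - p)) * normL2 Ω (uh - p)) +
        CE * L * (normL2 Ω (u - p) * normL2 Ω (uh - p)) + CE * L * normL2 Ω (uh - p) ^ 2 ≤
      2 * normLinf Ω u * tnormL2 Ω (brokenGrad M (u - p)) * normL2 Ω (uh - p) +
        (CE * Metric.diam Ω) * M.h⁻¹ * L * (normL2 Ω (u - p) * normL2 Ω (uh - p)) +
        CE * L * normL2 Ω (uh - p) ^ 2 := by
    have q1 : 0 ≤ normLinf Ω u * tnormL2 Ω (brokenGrad M (u - p)) * normL2 Ω (uh - p) := by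
      positivity
    have q2 := mul_le_mul_of_nonneg_left hh1
      (by positivity : 0 ≤ CE * L * (normL2 Ω (u - p) * normL2 Ω (uh - p)))
    linarith
  have hC1 : CE * Metric.diam Ω ≤ C := by linarith
  have hC2 : CE ≤ C := le_trans (by nlinarith) hC
  have := le_of_young hU hL0 hA hB hh (hCE.trans hC2) hC1 hC2 h1 h2 h3 h4 hX
  rw [ConvectiveBound]
  linarith

/-- The estimate for `H(div)`-conforming methods. The facet terms contain `p - u`, which is
controlled by trace inequalities and the stability of the Stokes projection. -/
theorem convectiveBound_hdivConforming (hd : d ≠ 0) (hΩ : IsOpen Ω) (hΩn : Ω.Nonempty)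
    (hΩb : Bornology.IsBounded Ω) (hΩr : interior (closure Ω) = Ω) {P : FEPair M}
    {D κ θ CE Ctr k t q c : ℝ} (hκ : 0 < κ) (hM : M.ShapeRegular κ) (hθ : M.QuasiUniform θ)
    (htr : DiscreteTrace P Ctr) (hCE : 0 ≤ CE) (hu1 : MemW1inf Ω u) (huV : MemVdiv Ω u)
    (huh : P.MemVhdiv uh) (hpV : P.MemVhdiv p)
    (hg : ∃ Cg, LipschitzWith Cg g) (hug : u =ᵐ[volume.restrict Ω] g)
    (hgD : ∀ x, ‖g x‖ ≤ D * tnormLinf Ω (weakGrad Ω u)) (hD : 0 ≤ D)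
    (hstab1 : eLpNorm (u - p) ∞ (volume.restrict Ω) ≤
      ENNReal.ofReal (CE * M.h * tnormLinf Ω (weakGrad Ω u)))
    (hstab2 : eLpNorm (fun x => frob (brokenGrad M p x)) ∞ (volume.restrict Ω) ≤
      ENNReal.ofReal (CE * tnormLinf Ω (weakGrad Ω u)))
    (hk : k = κ⁻¹ * (d * |θ|)) (ht : t = Ctr ^ 2 * |θ|)
    (hq : q = k * CE ^ 2 + 4 * κ⁻¹ * (CE * (1 + CE)))
    (hc : c = 4 * k * t + 4 * κ⁻¹ * t + 1)
    {C ε₁ ε₂ ε₃ ε₄ : ℝ}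
    (hC₁ : D * c + (CE + 4 * (4 * q * t + 1)) * Metric.diam Ω ≤ C) (hC₂ : CE + 2 * CE * t ≤ C)
    (h1 : 0 < ε₁) (h2 : 0 < ε₂) (h3 : 0 < ε₃) (h4 : 0 < ε₄) :
    ConvectiveBound M C ε₁ ε₂ ε₃ ε₄ u uh p := by
  obtain ⟨Cg, hg⟩ := hg
  have hu : PiecewiseLip M u fun _ => g := .of_lipschitzWith hg hug
  obtain ⟨f, hp⟩ := P.exists_piecewiseLip hpV.1
  obtain ⟨e, he⟩ := P.exists_piecewiseLip (P.Vh.sub_mem huh.1 hpV.1)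
  have hη := hu.sub hp
  set L := tnormLinf Ω (weakGrad Ω u) with hL
  have hL0 : 0 ≤ L := ENNReal.toReal_nonneg
  have hh := M.h_pos hd hΩn
  set A := normL2 Ω (u - p) with hA_def
  set B := normL2 Ω (uh - p) with hB_def
  set U := normLinf Ω u with hU_def
  set G := tnormL2 Ω (brokenGrad M (u - p)) with hG_def
  have hA : 0 ≤ A := ENNReal.toReal_nonneg
  have hB : 0 ≤ B := ENNReal.toReal_nonneg
  have hU0 : 0 ≤ U := ENNReal.toReal_nonneg
  have hG0 : 0 ≤ G := ENNReal.toReal_nonneg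
  have hH0 : 0 ≤ CE * M.h * L := by positivity
  have hN0 : 0 ≤ CE * L := by positivity
  have hk0 : 0 ≤ k := by rw [hk]; positivity
  have ht0 : 0 ≤ t := by rw [ht]; positivity
  have hq0 : 0 ≤ q := by rw [hq]; positivity
  have hκ' : 0 < κ⁻¹ := inv_pos.2 hκ
  have hkt : 0 ≤ k * t := by positivity
  have hκt : 0 ≤ κ⁻¹ * t := by positivity
  have hc1 : 1 ≤ c := by rw [hc]; nlinarith
  have hU := hu.norm_le (N := U) ENNReal.toReal_nonneg
    (by rw [hU_def, normLinf, ENNReal.ofReal_toReal hu1.1.2.ne])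
  have hUD : U ≤ D * L := by
    refine ENNReal.toReal_le_of_le_ofReal (by positivity) ?_
    rw [eLpNorm_congr_ae hug, eLpNorm_exponent_top]
    exact eLpNormEssSup_le_of_ae_bound (.of_forall hgD)
  have hH := hη.norm_le hH0 hstab1
  have hfp := hp.ae_frob_le hN0 hstab2
  have hfu := hu.ae_frob_le hL0 (eLpNorm_frob_brokenGrad hΩ hu1).le
  have hfη : ∀ K ∈ M.elems, ∀ᵐ x ∂(volume.restrict K),
      frob (fderiv ℝ (fun x => g x - f K x) x) ≤ (1 + CE) * L := fun K hK => by
    filter_upwards [hfp K hK, hfu K hK, (hu K hK).1.ae_differentiableAt (M.cell K hK).isOpen,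
      (hp K hK).1.ae_differentiableAt (M.cell K hK).isOpen] with x e1 e2 e3 e4
    rw [fderiv_fun_sub e3 e4, sub_eq_add_neg]
    have := frob_add_le (fderiv ℝ g x) (-fderiv ℝ (f K) x)
    rw [frob_neg] at this
    linarith
  have hS1 := hη.skeletonSum_sq_le hd hΩn hΩb hκ hM hθ
  have hS4 := hη.skeletonSum_pow_four_le hd hΩn hΩb hκ hM hθ hH0 hH hfη
  have hSe := htr.skeletonSum_le hd hΩn hΩb hθ (P.Vh.sub_mem huh.1 hpV.1) he
  set h' := M.h⁻¹ with hh'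
  have hh'0 : 0 < h' := inv_pos.2 hh
  have hhh : M.h * h' = 1 := mul_inv_cancel₀ hh.ne'
  rw [← ht] at hSe
  have hS1' : M.skeletonSum (fun K x => ‖g x - f K x‖ ^ 2) ≤
      k * h' * A ^ 2 + 2 * κ⁻¹ * (G * A) := hS1.trans_eq (by rw [hk]; ring)
  have hS4' : M.skeletonSum (fun K x => (‖g x - f K x‖ ^ 2) ^ 2) ≤ q * M.h * L ^ 2 * A ^ 2 :=
    hS4.trans_eq (by
      have e1 : h' * (CE * M.h * L) ^ 2 = CE ^ 2 * M.h * L ^ 2 := by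
        calc _ = CE ^ 2 * M.h * L ^ 2 * (M.h * h') := by ring
          _ = _ := by rw [hhh, mul_one]
      rw [mul_assoc _ h', e1, hq, hk]
      ring)
  have hflux := facet_terms_le hu hp he (Y₁ := c * h' * (A * B) + G * B)
    (Y₂ := (4 * q * t + 1) * (L * A * B)) hU0 hH0 hU hH hS1' hS4' hSe (by positivity)
    (by positivity) (four_mul_trace_bound_le hk0 ht0 hκ'.le hh'0.le hA hB hG0 hc)
    (four_mul_quartic_bound_le hq0 ht0 hhh)
  have hmain := convective_difference_le hΩ hΩb hΩr hu1 huV huh hu hp he hN0 hstab2 hflux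
  have hdiam : 0 ≤ Metric.diam Ω := Metric.diam_nonneg
  have hh1 : 1 ≤ Metric.diam Ω * h' := by
    rw [hh', ← div_eq_mul_inv, one_le_div hh]
    exact M.h_le_diam hΩn hΩb
  have hX := collected_terms_le (c := c) (q := q) (G := G) hL0 hA hB hh'0.le hhh hCE hq0 ht0
    (zero_le_one.trans hc1) hUD hh1 (le_refl (t * h' * B ^ 2)) hh.le
  have hC0 : 0 ≤ C := le_trans (by positivity) hC₂
  have := le_of_young hU0 hL0 hA hB hh hC0 hC₁ hC₂ h1 h2 h3 h4 hX
  rw [← hA_def, ← hB_def, ← hU_def, ← hG_def] at hmain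
  rw [ConvectiveBound, ← hA_def, ← hB_def, ← hU_def, ← hG_def, ← hL, ← hh']
  linarith

end Main

end

theorem lemma5p5 {d : ℕ} (hd : d = 2 ∨ d = 3) (Ω : Set (Vec d)) (hΩo : IsOpen Ω)
    (hΩc : IsConnected Ω) (hΩb : Bornology.IsBounded Ω)
    -- `Ω` lies on one side of its boundary, as every Lipschitz domain does
    (hΩr : interior (closure Ω) = Ω) :
    -- `H¹`-conforming methods
    (∀ CE : ℝ, ∃ C : ℝ, 0 < C ∧
      ∀ (M : Mesh Ω) (P : FEPair M) (ν δ σ : ℝ), 0 < ν → 0 ≤ δ → 0 < σ →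
        P.H1Conforming → StokesStableH1 P ν δ σ CE →
        ∀ (T : ℝ) (u uh p : ℝ → Vec d → Vec d), 0 < T →
          MemL1W1inf Ω T u →
          (∀ᵐ t ∂(volume.restrict (Set.Ioo 0 T)), StokesAdmissible M (u t)) →
          (∀ᵐ t ∂(volume.restrict (Set.Ioo 0 T)), P.MemVhdiv (uh t)) →
          (∀ᵐ t ∂(volume.restrict (Set.Ioo 0 T)), IsStokesProj P ν δ σ (u t) (p t)) →
          ∀ᵐ t ∂(volume.restrict (Set.Ioo 0 T)),
            ∀ ε₁ ε₂ ε₃ ε₄ : ℝ, 0 < ε₁ → 0 < ε₂ → 0 < ε₃ → 0 < ε₄ →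
              ConvectiveBound M C ε₁ ε₂ ε₃ ε₄ (u t) (uh t) (p t)) ∧
    -- `H(div)`-conforming methods
    (∀ κ θ CE Ctr : ℝ, 0 < κ → ∃ C : ℝ, 0 < C ∧
      ∀ (M : Mesh Ω) (P : FEPair M) (ν δ σ : ℝ), 0 < ν → 0 ≤ δ → 0 < σ →
        M.ShapeRegular κ → M.QuasiUniform θ →
        StokesStableHdiv P ν δ σ CE → DiscreteTrace P Ctr →
        ∀ (T : ℝ) (u uh p : ℝ → Vec d → Vec d), 0 < T →
          MemL1W1inf Ω T u →
          (∀ᵐ t ∂(volume.restrict (Set.Ioo 0 T)), StokesAdmissible M (u t)) →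
          (∀ᵐ t ∂(volume.restrict (Set.Ioo 0 T)), P.MemVhdiv (uh t)) →
          (∀ᵐ t ∂(volume.restrict (Set.Ioo 0 T)), IsStokesProj P ν δ σ (u t) (p t)) →
          ∀ᵐ t ∂(volume.restrict (Set.Ioo 0 T)),
            ∀ ε₁ ε₂ ε₃ ε₄ : ℝ, 0 < ε₁ → 0 < ε₂ → 0 < ε₃ → 0 < ε₄ →
              ConvectiveBound M C ε₁ ε₂ ε₃ ε₄ (u t) (uh t) (p t)) := by
  have hd0 : d ≠ 0 := by rcases hd with rfl | rfl <;> norm_num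
  have hΩn := hΩc.nonempty
  -- no sign of `CE` or `θ` is assumed, so the constants are built from absolute values
  refine ⟨fun CE => ⟨|CE| * (1 + Metric.diam Ω) + 1, ?_, ?_⟩, fun κ θ CE Ctr hκ => ?_⟩
  · have : 0 ≤ Metric.diam Ω := Metric.diam_nonneg
    positivity
  · intro M P ν δ σ _ _ _ hP hstab T u uh p _ hu1 hu huh hp
    filter_upwards [hu1.1, hu, huh, hp] with t h1 h2 h3 h4 ε₁ ε₂ ε₃ ε₄ e1 e2 e3 e4
    refine convectiveBound_h1Conforming hd0 hΩo hΩn hΩb hΩr hP (abs_nonneg CE) h1 h2.1 h3 h4.1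
      ((hstab _ _ h2 h4).trans ?_) (le_add_of_nonneg_right zero_le_one) e1 e2 e3 e4
    gcongr
    exact le_abs_self CE
  · obtain ⟨D, hD, hext⟩ := exists_lipschitz_extension_of_memH10 hd0 hΩo hΩb
    set k := κ⁻¹ * (d * |θ|) with hk
    set s := Ctr ^ 2 * |θ| with hs
    set q := k * |CE| ^ 2 + 4 * κ⁻¹ * (|CE| * (1 + |CE|)) with hq
    set c := 4 * k * s + 4 * κ⁻¹ * s + 1 with hc
    set C₁ := D * c + (|CE| + 4 * (4 * q * s + 1)) * Metric.diam Ω with hC₁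
    set C₂ := |CE| + 2 * |CE| * s with hC₂
    have hdiam : 0 ≤ Metric.diam Ω := Metric.diam_nonneg
    have hC₁0 : 0 ≤ C₁ := by positivity
    have hC₂0 : 0 ≤ C₂ := by positivity
    refine ⟨C₁ + C₂ + 1, by positivity, ?_⟩
    intro M P ν δ σ _ _ _ hM hθ hstab htr T u uh p _ hu1 hu huh hp
    filter_upwards [hu1.1, hu, huh, hp] with t h1 h2 h3 h4 ε₁ ε₂ ε₃ ε₄ e1 e2 e3 e4
    obtain ⟨g, Cg, hg, hug, -, hgD⟩ := hext (u t) h1 h2.1.1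
    have hh := M.h_pos hd0 hΩn
    set L := tnormLinf Ω (weakGrad Ω (u t)) with hL
    have hL0 : 0 ≤ L := ENNReal.toReal_nonneg
    have hst := hstab _ _ h2 h4
    rw [eLpNorm_frob_brokenGrad hΩo h1, ← hL] at hst
    have hst' := hst.trans (mul_le_mul_left (ENNReal.ofReal_le_ofReal
      (mul_le_mul_of_nonneg_right (le_abs_self CE) hh.le)) (ENNReal.ofReal L))
    rw [← ENNReal.ofReal_mul (by positivity)] at hst'
    have hst2 := (le_add_self).trans hst'
    have hh' : |CE| * M.h * L = M.h * (|CE| * L) := by ring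
    rw [hh', ENNReal.ofReal_mul hh.le] at hst2
    exact convectiveBound_hdivConforming hd0 hΩo hΩn hΩb hΩr hκ hM hθ htr (abs_nonneg CE) h1 h2.1
      h3 h4.1 ⟨Cg, hg⟩ hug hgD hD ((le_self_add).trans hst')
      ((ENNReal.mul_le_mul_iff_right (by simpa using hh) ENNReal.ofReal_ne_top).1 hst2)
      hk hs hq hc (by linarith) (by linarith) e1 e2 e3 e4
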